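/- Let $\lambda(n)=(-1)^{\Omega(n)}$ be the Liouville function, where $\Omega(n)$ is the number of prime factors of $n\ge 1$ counted with multiplicity. Let $\vartheta$ be a real number such that for all $\varepsilon>0$ and $A>0$, as $N\to\infty$, $$\sum_{q\le N^{\vartheta-\varepsilon}}\ \max_{\substack{a\\ (a,q)=1}}\Bigl|\sum_{\substack{p\le N,\ p\text{ prime}\\ p\equiv a\ (\mathrm{mod}\ q)}}\log p-\frac{N}{\varphi(q)}\Bigr|\ll_{\varepsilon,A}\frac{N}{(\log N)^A}$$ and $$\sum_{q\le N^{\vartheta-\varepsilon}}\ \max_{y\le N}\ \max_{a}\Bigl|\sum_{\substack{1\le n\le y\\ n\equiv a\ (\mathrm{mod}\ q)}}\lambda(n)\Bigr|\ll_{\varepsilon,A}\frac{N}{(\log N)^A}.$$ Let $k=2$ and $\vartheta\ge 0.729$, or $k=3$ and $\vartheta\ge 0.616$, or $k=4$ and $\vartheta\ge 0.554$, or $k=5$ and $\vartheta\ge 0.515$. Let $\mathcal H$ be an admissible set of $k$ distinct integers, that is, one that does not occupy all residue classes modulo any prime, and let $r\ne 0$ be a fixed integer with $r\notin\mathcal H$.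 Then there are infinitely many integers $n$ such that either (i) at least two of the numbers $n+h$, $h\in\mathcal H$, are primes, or (ii) $n+h$ is prime for some $h\in\mathcal H$, and $n+r\ge 1$ with $\lambda(n+r)=-1$. -/

import Mathlib

open Filter Asymptotics

/-- The Liouville function `λ(n) = (-1)^Ω(n)` at an integer `n ≥ 1`; the value is `0` at `n ≤ 0`. -/
def liouvilleLambda (n : ℤ) : ℤ := ArithmeticFunction.liouville n.toNat

/-- The integer `n` is a (positive) prime number. -/
def IsPrimeInt (n : ℤ) : Prop := ∃ p : ℕ, p.Prime ∧ (p : ℤ) = n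

/-- A finite set of integers is admissible if it does not occupy all residue classes modulo any
prime. -/
def Admissible (H : Finset ℤ) : Prop :=
  ∀ p : ℕ, p.Prime → ∃ a : ZMod p, ∀ h ∈ H, (h : ZMod p) ≠ a

noncomputable section

open Classical in
/-- The sum of `log p` over the primes `p ≤ N` with `p ≡ a (mod q)`. -/
def thetaAP (N q : ℕ) (a : ZMod q) : ℝ :=
  ∑ p ∈ (Finset.Icc 1 N).filter (fun p : ℕ => p.Prime ∧ (p : ZMod q) = a), Real.log p

open Classical in
/-- The sum of `λ(n)` over the integers `1 ≤ n ≤ y` with `n ≡ a (mod q)`. -/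
def lambdaAP (y q : ℕ) (a : ZMod q) : ℝ :=
  ∑ n ∈ (Finset.Icc 1 y).filter (fun n : ℕ => (n : ZMod q) = a), (ArithmeticFunction.liouville n : ℝ)

/-- `max_{(a,q)=1} |∑_{p ≤ N, p ≡ a (q)} log p - N/φ(q)|` (used for `q ≥ 1`, when the supremum is
over a finite nonempty set). -/
def primeError (N q : ℕ) : ℝ :=
  ⨆ a : (ZMod q)ˣ, |thetaAP N q (a : ZMod q) - (N : ℝ) / (Nat.totient q : ℝ)|

/-- `max_{y ≤ N} max_a |∑_{n ≤ y, n ≡ a (q)} λ(n)|` (used for `q ≥ 1`, when both suprema are over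
finite nonempty sets). -/
def lambdaError (N q : ℕ) : ℝ :=
  ⨆ y : Fin (N + 1), ⨆ a : ZMod q, |lambdaAP (y : ℕ) q a|

/-- `ϑ` is an admissible level of distribution of the primes: for all `ε, A > 0` the sum over
`q ≤ N^(ϑ-ε)` of the errors is `O(N / (log N)^A)`, with a constant depending on `ε` and `A`. -/
def PrimesHaveLevel (ϑ : ℝ) : Prop :=
  ∀ ε : ℝ, 0 < ε → ∀ A : ℝ, 0 < A →
    (fun N : ℕ => ∑ q ∈ Finset.Icc 1 ⌊(N : ℝ) ^ (ϑ - ε)⌋₊, primeError N q)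
      =O[atTop] (fun N : ℕ => (N : ℝ) / Real.log N ^ A)

/-- `ϑ` is an admissible level of distribution of the Liouville function. -/
def LambdaHasLevel (ϑ : ℝ) : Prop :=
  ∀ ε : ℝ, 0 < ε → ∀ A : ℝ, 0 < A →
    (fun N : ℕ => ∑ q ∈ Finset.Icc 1 ⌊(N : ℝ) ^ (ϑ - ε)⌋₊, lambdaError N q)
      =O[atTop] (fun N : ℕ => (N : ℝ) / Real.log N ^ A)

end

/-! Suppose every large `n` fails both alternatives. Then at most one of the numbers `n + h` is
prime, and if one is, then `λ(n + r) = 1`. Hence for `n ∈ (N, 2N]` and `L = log N + 2` the sum of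
`log (n + h)` over the primes among the `n + h` is at most `(L / 2)(1 + λ(n + r))`; this is
`sum_prime_log_le`. A bound that knows only that at most one `n + h` is prime would have `L` on the
right. The factor `1/2` is what the Liouville function gains.

Multiply by a Goldston–Pintz–Yıldırım weight, the square of a Selberg sum over squarefree `d ≤ R`,
`R = ⌊N^θ⌋` with `2θ < min(1, ϑ)`, and sum over `n`. The level of distribution of `λ` makes its
contribution negligible, so that up to errors `k V₂ ≤ (L / 2) V₁`, where `V₁` is `mainForm` and `V₂`
is `primeForm`. If `V₂ ≥ μ log R · V₁` with `kμθ > 1/2`, this is absurd for large `N`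
(`sieve_inequality_absurd`). The four cases of the theorem are four choices of `(a, μ, θ)`.

The comparison of `V₁` and `V₂` (`eventually_mul_mainForm_le`) is elementary. The weights are
prescribed through their diagonal variables `y_s = 1 + a log(R/s) / log R`, so `V₁` is exactly `∑
h(s) y_s²`, and `V₂` is exactly `∑ g(r) Y_r²` with `Y_r` a weighted sum of the `y_s` over the
multiples `s` of `r`. Only a lower bound for `V₂` is needed. An explicit quadratic polynomial `Q_r`
in `log(R/r)` satisfies `0 ≤ Q_r ≤ Y_r` (`quadratic_le_prod_mul_sum_primeSets`), so `Y_r² ≥ Y_r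
Q_r`. Opening the remaining `Y_r` gives a sum over splittings `s = r · (s/r)` whose local factors
add up to `h(p)`. Everything is then compared with `S₀ = ∑_{s ≤ R} h(s)`, and only limits of ratios
to `S₀` are needed. They come from recursions based on `log s = ∑_{p ∣ s} log p` and Mertens'
theorem (`tendsto_powerSum`, `tendsto_mixedSum`).

The errors are the distribution errors weighted by `(4k)^{ω(q)}` over squarefree `q ≤ R²`. Cauchy's
inequality and trivial bounds remove these weights (`tendsto_sum_error_div`), and the sieve weights
themselves cost only a power of `log N`. -/

/-- The Selberg weights attached to a density `ρ`, its dual `h` and the diagonal variables `y`. -/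
noncomputable def selbergWeight {α : Type*} [DecidableEq α] (F : Finset (Finset α)) (ρ h : α → ℝ)
    (y : Finset α → ℝ) (d : Finset α) : ℝ :=
  (-1) ^ d.card * (∏ p ∈ d, (ρ p)⁻¹) * ∑ s ∈ F with d ⊆ s, (∏ p ∈ s, h p) * y s

/-! ### Diagonalisation of Selberg's quadratic forms, over arbitrary finite sets -/

section SelbergAlgebra

variable {α : Type*} [DecidableEq α]

/-- This is `σ([d,e]) = σ(d) σ(e) / σ((d,e))` with `1/σ` expanded over the divisors of `(d,e)`. The
relation between `σ` and `g` is asked only where `σ p ≠ 0`, because the density for primes vanishes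
at any `p` where the tuple occupies a single class; both sides are then `0`. -/
lemma prod_union_eq_sum_powerset_inter {σ g : α → ℝ} {d e : Finset α}
    (hσ : ∀ p ∈ d ∪ e, σ p ≠ 0 → (σ p)⁻¹ = 1 + (g p)⁻¹) :
    ∏ p ∈ d ∪ e, σ p =
      (∏ p ∈ d, σ p) * (∏ p ∈ e, σ p) * ∑ r ∈ (d ∩ e).powerset, ∏ p ∈ r, (g p)⁻¹ := by
  rw [← Finset.prod_union_inter]
  by_cases h0 : ∃ p ∈ d ∪ e, σ p = 0
  · obtain ⟨p, hp, h0⟩ := h0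
    rw [Finset.prod_eq_zero hp h0]
    simp
  · push Not at h0
    have h1 : ∑ r ∈ (d ∩ e).powerset, ∏ p ∈ r, (g p)⁻¹ = ∏ p ∈ d ∩ e, (σ p)⁻¹ := by
      rw [← Finset.prod_one_add]
      refine Finset.prod_congr rfl fun p hp => ?_
      have hp' : p ∈ d ∪ e := Finset.mem_union_left _ (Finset.mem_inter.1 hp).1
      rw [hσ p hp' (h0 p hp')]
    have h2 : ∏ p ∈ d ∩ e, σ p * (σ p)⁻¹ = 1 := Finset.prod_eq_one fun p hp =>
      mul_inv_cancel₀ (h0 p (Finset.mem_union_left _ (Finset.mem_inter.1 hp).1))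
    rw [h1, mul_assoc, ← Finset.prod_mul_distrib, h2, mul_one]

lemma quadraticForm_eq_sum_sq {F : Finset (Finset α)} (hF : ∀ s ∈ F, ∀ t ⊆ s, t ∈ F)
    {σ g : α → ℝ} (hσ : ∀ s ∈ F, ∀ p ∈ s, σ p ≠ 0 → (σ p)⁻¹ = 1 + (g p)⁻¹)
    (lam : Finset α → ℝ) :
    ∑ d ∈ F, ∑ e ∈ F, lam d * lam e * ∏ p ∈ d ∪ e, σ p =
      ∑ r ∈ F, (∏ p ∈ r, (g p)⁻¹) * (∑ d ∈ F with r ⊆ d, lam d * ∏ p ∈ d, σ p) ^ 2 := by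
  have h1 : ∀ d ∈ F, ∀ e ∈ F, lam d * lam e * ∏ p ∈ d ∪ e, σ p =
      ∑ r ∈ F, if r ⊆ d ∧ r ⊆ e then
        (∏ p ∈ r, (g p)⁻¹) * ((lam d * ∏ p ∈ d, σ p) * (lam e * ∏ p ∈ e, σ p)) else 0 := by
    intro d hd e he
    rw [prod_union_eq_sum_powerset_inter (g := g), ← Finset.sum_filter, ← Finset.sum_mul]
    · have : F.filter (fun r => r ⊆ d ∧ r ⊆ e) = (d ∩ e).powerset := by
        ext r
        simp only [Finset.mem_filter, Finset.mem_powerset, Finset.subset_inter_iff]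
        exact ⟨fun h => h.2, fun h => ⟨hF d hd r h.1, h⟩⟩
      rw [this]; ring
    · intro p hp
      rcases Finset.mem_union.1 hp with hp | hp
      · exact hσ d hd p hp
      · exact hσ e he p hp
  rw [Finset.sum_congr rfl fun d hd => Finset.sum_congr rfl (h1 d hd)]
  have h2 : ∀ d ∈ F, ∑ e ∈ F, ∑ r ∈ F, (if r ⊆ d ∧ r ⊆ e then
        (∏ p ∈ r, (g p)⁻¹) * ((lam d * ∏ p ∈ d, σ p) * (lam e * ∏ p ∈ e, σ p)) else 0) =
      ∑ r ∈ F, ∑ e ∈ F, (if r ⊆ d ∧ r ⊆ e then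
        (∏ p ∈ r, (g p)⁻¹) * ((lam d * ∏ p ∈ d, σ p) * (lam e * ∏ p ∈ e, σ p)) else 0) :=
    fun d _ => Finset.sum_comm
  rw [Finset.sum_congr rfl h2, Finset.sum_comm]
  refine Finset.sum_congr rfl fun r _ => ?_
  rw [pow_two, Finset.sum_mul_sum, Finset.mul_sum, Finset.sum_filter]
  refine Finset.sum_congr rfl fun d _ => ?_
  by_cases hd : r ⊆ d
  · simp [hd, Finset.sum_filter, Finset.mul_sum]
  · simp [hd]

lemma sum_between_neg_one_pow_mul_prod {r s : Finset α} (hrs : r ⊆ s) (f : α → ℝ) :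
    ∑ d ∈ s.powerset with r ⊆ d, (-1) ^ d.card * ∏ p ∈ d, f p =
      (-1) ^ r.card * (∏ p ∈ r, f p) * ∏ p ∈ s \ r, (1 - f p) := by
  have h1 : ∏ p ∈ s \ r, (1 - f p) = ∑ t ∈ (s \ r).powerset, ∏ p ∈ t, (-f p) := by
    rw [← Finset.prod_one_add]
    simp [sub_eq_add_neg]
  rw [h1, Finset.mul_sum]
  refine Finset.sum_bij' (fun d _ => d \ r) (fun t _ => r ∪ t) ?_ ?_ ?_ ?_ ?_
  · intro d hd
    simp only [Finset.mem_filter, Finset.mem_powerset] at hd ⊢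
    exact Finset.sdiff_subset_sdiff hd.1 subset_rfl
  · intro t ht
    simp only [Finset.mem_filter, Finset.mem_powerset] at ht ⊢
    exact ⟨Finset.union_subset hrs (ht.trans Finset.sdiff_subset), Finset.subset_union_left⟩
  · intro d hd
    simp only [Finset.mem_filter, Finset.mem_powerset] at hd
    exact Finset.union_sdiff_of_subset hd.2
  · intro t ht
    simp only [Finset.mem_powerset] at ht
    rw [Finset.union_sdiff_cancel_left]
    exact (Finset.disjoint_of_subset_left ht Finset.sdiff_disjoint).symm
  · intro d hd
    simp only [Finset.mem_filter, Finset.mem_powerset] at hd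
    rw [Finset.prod_neg, ← Finset.prod_sdiff hd.2, ← Finset.card_sdiff_add_card_eq_card hd.2]
    ring

/-- After the sums over `d` and `s` are exchanged, the sum over `r ⊆ d ⊆ s` factors into `-σ/ρ` at
the primes of `r` and `1 - σ/ρ` at those of `s \ r`. For `σ = ρ` only `s = r` survives, which is
Möbius inversion; for other `σ` the second factor measures how far the two forms are from being
diagonal together. -/
lemma sum_selbergWeight_mul {F : Finset (Finset α)} (hF : ∀ s ∈ F, ∀ t ⊆ s, t ∈ F)
    (ρ h σ : α → ℝ) (y : Finset α → ℝ) (r : Finset α) :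
    ∑ d ∈ F with r ⊆ d, selbergWeight F ρ h y d * ∏ p ∈ d, σ p =
      (-1) ^ r.card * ∑ s ∈ F with r ⊆ s, y s * (∏ p ∈ r, σ p * (ρ p)⁻¹ * h p) *
        ∏ p ∈ s \ r, (h p * (1 - σ p * (ρ p)⁻¹)) := by
  have h1 : ∀ d, selbergWeight F ρ h y d * ∏ p ∈ d, σ p =
      ∑ s ∈ F, if d ⊆ s then
        ((∏ p ∈ s, h p) * y s) * ((-1) ^ d.card * ∏ p ∈ d, (σ p * (ρ p)⁻¹)) else 0 := by
    intro d
    rw [selbergWeight, ← Finset.sum_filter, ← Finset.sum_mul, Finset.prod_mul_distrib]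
    ring
  simp_rw [h1]
  rw [Finset.sum_comm, Finset.sum_filter, Finset.mul_sum]
  refine Finset.sum_congr rfl fun s hs => ?_
  rw [← Finset.sum_filter, Finset.filter_filter, ← Finset.mul_sum]
  have h2 : F.filter (fun d => r ⊆ d ∧ d ⊆ s) = s.powerset.filter (fun d => r ⊆ d) := by
    ext d
    simp only [Finset.mem_filter, Finset.mem_powerset]
    exact ⟨fun h => ⟨h.2.2, h.2.1⟩, fun h => ⟨hF s hs d h.1, h.2, h.1⟩⟩
  rw [h2]
  split_ifs with hrs
  · rw [sum_between_neg_one_pow_mul_prod hrs, ← Finset.prod_sdiff hrs]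
    simp only [Finset.prod_mul_distrib]
    ring
  · rw [Finset.sum_eq_zero, mul_zero, mul_zero]
    intro d hd
    simp only [Finset.mem_filter, Finset.mem_powerset] at hd
    exact absurd (hd.2.trans hd.1) hrs

/-- Selberg's diagonalisation of the form attached to the density `ρ` itself. -/
lemma quadraticForm_selbergWeight_self {F : Finset (Finset α)} (hF : ∀ s ∈ F, ∀ t ⊆ s, t ∈ F)
    {ρ h : α → ℝ} (hρ : ∀ s ∈ F, ∀ p ∈ s, ρ p ≠ 0) (hh : ∀ s ∈ F, ∀ p ∈ s, h p ≠ 0)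
    (hρh : ∀ s ∈ F, ∀ p ∈ s, (ρ p)⁻¹ = 1 + (h p)⁻¹) (y : Finset α → ℝ) :
    ∑ d ∈ F, ∑ e ∈ F, selbergWeight F ρ h y d * selbergWeight F ρ h y e * ∏ p ∈ d ∪ e, ρ p =
      ∑ s ∈ F, (∏ p ∈ s, h p) * y s ^ 2 := by
  rw [quadraticForm_eq_sum_sq hF (g := h) fun s hs p hp _ => hρh s hs p hp]
  refine Finset.sum_congr rfl fun r hr => ?_
  rw [sum_selbergWeight_mul hF, Finset.sum_eq_single_of_mem r (by simp [hr])]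
  · have h1 : ∏ p ∈ r, ρ p * (ρ p)⁻¹ * h p = ∏ p ∈ r, h p :=
      Finset.prod_congr rfl fun p hp => by rw [mul_inv_cancel₀ (hρ r hr p hp), one_mul]
    have h2 : ∏ p ∈ r, h p ≠ 0 := Finset.prod_ne_zero_iff.2 (hh r hr)
    have h3 : ((-1 : ℝ) ^ r.card) ^ 2 = 1 := by rw [← pow_mul, mul_comm, pow_mul]; simp
    rw [h1, mul_pow, h3, Finset.prod_inv_distrib]
    simp only [Finset.sdiff_self, Finset.prod_empty]
    field_simp
  · intro s hs hsr
    simp only [Finset.mem_filter] at hs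
    obtain ⟨p, hp, hpr⟩ := Finset.exists_of_ssubset (hs.2.ssubset_of_ne (Ne.symm hsr))
    rw [Finset.prod_eq_zero (i := p) (Finset.mem_sdiff.2 ⟨hp, hpr⟩), mul_zero]
    rw [mul_inv_cancel₀ (hρ s hs.1 p hp), sub_self, mul_zero]

/-- Diagonalisation of the form attached to a second density `σ`. -/
lemma quadraticForm_selbergWeight {F : Finset (Finset α)} (hF : ∀ s ∈ F, ∀ t ⊆ s, t ∈ F)
    {ρ h σ g c b : α → ℝ}
    (hσ : ∀ s ∈ F, ∀ p ∈ s, σ p ≠ 0 → (σ p)⁻¹ = 1 + (g p)⁻¹)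
    (hc : ∀ s ∈ F, ∀ p ∈ s, σ p * (ρ p)⁻¹ * h p = g p * c p)
    (hb : ∀ s ∈ F, ∀ p ∈ s, h p * (1 - σ p * (ρ p)⁻¹) = b p) (y : Finset α → ℝ) :
    ∑ d ∈ F, ∑ e ∈ F, selbergWeight F ρ h y d * selbergWeight F ρ h y e * ∏ p ∈ d ∪ e, σ p =
      ∑ r ∈ F, (∏ p ∈ r, g p) *
        ((∏ p ∈ r, c p) * ∑ s ∈ F with r ⊆ s, y s * ∏ p ∈ s \ r, b p) ^ 2 := by
  rw [quadraticForm_eq_sum_sq hF hσ]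
  refine Finset.sum_congr rfl fun r hr => ?_
  have h1 : ∑ s ∈ F with r ⊆ s, y s * (∏ p ∈ r, σ p * (ρ p)⁻¹ * h p) *
        ∏ p ∈ s \ r, (h p * (1 - σ p * (ρ p)⁻¹)) =
      (∏ p ∈ r, g p) * ((∏ p ∈ r, c p) * ∑ s ∈ F with r ⊆ s, y s * ∏ p ∈ s \ r, b p) := by
    rw [← mul_assoc, ← Finset.prod_mul_distrib, Finset.mul_sum]
    refine Finset.sum_congr rfl fun s hs => ?_
    simp only [Finset.mem_filter] at hs
    rw [Finset.prod_congr rfl (hc r hr),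
      Finset.prod_congr rfl fun p hp => hb s hs.1 p (Finset.mem_sdiff.1 hp).1]
    ring
  rw [sum_selbergWeight_mul hF, h1, mul_pow, mul_pow]
  have h3 : ((-1 : ℝ) ^ r.card) ^ 2 = 1 := by rw [← pow_mul, mul_comm, pow_mul]; simp
  rw [h3, one_mul, ← mul_assoc, Finset.prod_inv_distrib]
  congr 1
  -- Where `g` vanishes on `r` both sides are `0`, since `0⁻¹ = 0`.
  by_cases h0 : ∏ p ∈ r, g p = 0
  · simp [h0]
  · field_simp

end SelbergAlgebra

/-! ### Mertens' theorem and partial summation -/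

section Mertens

lemma log_factorial_eq_sum_primesLE (n : ℕ) :
    Real.log (n.factorial : ℝ) =
      ∑ p ∈ n.primesLE, (n.factorial.factorization p : ℝ) * Real.log p := by
  have h0 : n.factorial ≠ 0 := n.factorial_ne_zero
  conv_lhs => rw [← Nat.prod_factorization_pow_eq_self h0]
  rw [Finsupp.prod_of_support_subset (s := n.primesLE)]
  · push_cast
    rw [Real.log_prod]
    · simp [Real.log_pow]
    · intro p hp
      have := (Nat.mem_primesLE.1 hp).2.pos
      positivity
  · intro p hp
    rw [Nat.support_factorization, Nat.mem_primeFactors] at hp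
    exact Nat.mem_primesLE.2 ⟨(hp.1.dvd_factorial).1 hp.2.1, hp.1⟩
  · simp

lemma sum_log_div_le (n : ℕ) (hn : 1 ≤ n) :
    ∑ p ∈ n.primesLE, Real.log p / p ≤ Real.log n + Real.log 4 := by
  have hn0 : (0 : ℝ) < n := by exact_mod_cast hn
  have h1 : Real.log (n.factorial : ℝ) ≤ n * Real.log n := by
    rw [← Real.log_pow]
    exact Real.log_le_log (by positivity) (by exact_mod_cast Nat.factorial_le_pow n)
  rw [log_factorial_eq_sum_primesLE] at h1
  have h2 : ∀ p ∈ n.primesLE, n * (Real.log p / p) - Real.log p ≤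
      (n.factorial.factorization p : ℝ) * Real.log p := by
    intro p hp
    obtain ⟨hpn, hp⟩ := Nat.mem_primesLE.1 hp
    -- Only the first term of Legendre's formula is kept; the rounding loss `∑ log p` is absorbed by
    -- Chebyshev's bound.
    have h3 : n / p ≤ n.factorial.factorization p := by
      rw [Nat.factorization_factorial hp (b := Nat.log p n + 2) (by omega)]
      have : n / p = n / p ^ 1 := by rw [pow_one]
      rw [this]
      exact Finset.single_le_sum (f := fun i => n / p ^ i) (fun i _ => Nat.zero_le _) (by simp)
    have h4 : (n : ℝ) / p - 1 ≤ n.factorial.factorization p := by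
      have h5 : (n : ℝ) / p < (n / p : ℕ) + 1 := by
        have := Nat.lt_floor_add_one ((n : ℝ) / p)
        rwa [Nat.floor_div_eq_div] at this
      have h6 : ((n / p : ℕ) : ℝ) ≤ n.factorial.factorization p := by exact_mod_cast h3
      linarith
    have h7 : 0 ≤ Real.log p := Real.log_natCast_nonneg p
    calc n * (Real.log p / p) - Real.log p = ((n : ℝ) / p - 1) * Real.log p := by ring
      _ ≤ _ := mul_le_mul_of_nonneg_right h4 h7
  have h3 := Finset.sum_le_sum h2
  rw [Finset.sum_sub_distrib, ← Finset.mul_sum, ← Chebyshev.theta_eq_sum_primesLE_log] at h3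
  have h4 := Chebyshev.theta_le_log4_mul_x hn0.le
  have h5 : n * ∑ p ∈ n.primesLE, Real.log p / p ≤ n * (Real.log n + Real.log 4) := by
    rw [mul_add]; linarith
  exact le_of_mul_le_mul_left h5 hn0

lemma le_sum_log_div_sub_one (n : ℕ) (hn : 1 ≤ n) :
    Real.log n - 1 ≤ ∑ p ∈ n.primesLE, Real.log p / ((p : ℝ) - 1) := by
  have hn0 : (0 : ℝ) < n := by exact_mod_cast hn
  have h1 : n * Real.log n - n ≤ Real.log (n.factorial : ℝ) := by
    have h := Stirling.le_log_factorial_stirling (n := n) (by omega)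
    have h2 : 0 ≤ Real.log n := Real.log_natCast_nonneg n
    have h3 : 0 ≤ Real.log (2 * Real.pi) := Real.log_nonneg (by
      have := Real.pi_gt_three; linarith)
    linarith
  rw [log_factorial_eq_sum_primesLE] at h1
  have h2 : ∀ p ∈ n.primesLE, (n.factorial.factorization p : ℝ) * Real.log p ≤
      n * (Real.log p / ((p : ℝ) - 1)) := by
    intro p hp
    obtain ⟨hpn, hp⟩ := Nat.mem_primesLE.1 hp
    have : Fact p.Prime := ⟨hp⟩
    have h3 := sub_one_mul_padicValNat_factorial (p := p) n
    rw [← Nat.factorization_def _ hp] at h3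
    -- By Legendre, `(p - 1) v_p(n!)` is `n` minus the sum of its base `p` digits.
    have h4 : (p - 1) * n.factorial.factorization p ≤ n := h3 ▸ Nat.sub_le _ _
    have h5 : ((p : ℝ) - 1) * n.factorial.factorization p ≤ n := by
      have : ((p - 1 : ℕ) : ℝ) = (p : ℝ) - 1 := by push_cast [hp.one_le]; ring
      rw [← this]; exact_mod_cast h4
    have h6 : (0 : ℝ) < (p : ℝ) - 1 := by
      have : (1 : ℝ) < p := by exact_mod_cast hp.one_lt
      linarith
    have h7 : (n.factorial.factorization p : ℝ) ≤ n / ((p : ℝ) - 1) := by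
      rw [le_div_iff₀ h6]; linarith
    calc _ ≤ n / ((p : ℝ) - 1) * Real.log p :=
          mul_le_mul_of_nonneg_right h7 (Real.log_natCast_nonneg p)
      _ = _ := by ring
  have h3 := Finset.sum_le_sum h2
  rw [← Finset.mul_sum] at h3
  have h5 : n * (Real.log n - 1) ≤ n * ∑ p ∈ n.primesLE, Real.log p / ((p : ℝ) - 1) := by
    rw [mul_sub]; linarith
  exact le_of_mul_le_mul_left h5 hn0

lemma exists_sum_log_div_sq_le :
    ∃ K : ℝ, 0 ≤ K ∧ ∀ s : Finset ℕ, ∑ p ∈ s, Real.log p / (p : ℝ) ^ 2 ≤ K := by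
  have h1 : Summable fun n : ℕ => 2 * ((n : ℝ) ^ (3 / 2 : ℝ))⁻¹ :=
    (Real.summable_nat_rpow_inv.2 (by norm_num)).mul_left 2
  have h2 : ∀ n : ℕ, Real.log n / (n : ℝ) ^ 2 ≤ 2 * ((n : ℝ) ^ (3 / 2 : ℝ))⁻¹ := by
    intro n
    rcases Nat.eq_zero_or_pos n with rfl | hn
    · simp
    have hn0 : (0 : ℝ) < n := by exact_mod_cast hn
    have h3 := Real.log_le_rpow_div hn0.le (ε := 1 / 2) (by norm_num)
    have h4 : (n : ℝ) ^ 2 = (n : ℝ) ^ (1 / 2 : ℝ) * (n : ℝ) ^ (3 / 2 : ℝ) := by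
      rw [← Real.rpow_add hn0]; norm_num
    rw [h4, div_le_iff₀ (by positivity)]
    have : 2 * ((n : ℝ) ^ (3 / 2 : ℝ))⁻¹ * ((n : ℝ) ^ (1 / 2 : ℝ) * (n : ℝ) ^ (3 / 2 : ℝ)) =
        (n : ℝ) ^ (1 / 2 : ℝ) / (1 / 2) := by
      have : (n : ℝ) ^ (3 / 2 : ℝ) ≠ 0 := by positivity
      field_simp
    rw [this]; exact h3
  refine ⟨∑' n : ℕ, 2 * ((n : ℝ) ^ (3 / 2 : ℝ))⁻¹, tsum_nonneg fun n => by positivity, fun s => ?_⟩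
  exact (Finset.sum_le_sum fun n _ => h2 n).trans (h1.sum_le_tsum s fun n _ => by positivity)

/-- A form of Mertens' theorem: `∑_{log p ≤ v} c(p) = κ v + O(1)` if `c(p)` is close to
`κ log p / p`. -/
lemma exists_abs_sum_sub_le {c : ℕ → ℝ} {κ C : ℝ} (hκ : 0 ≤ κ) (hC : 0 ≤ C)
    (hc : ∀ p : ℕ, p.Prime → |c p - κ * (Real.log p / p)| ≤ C * (Real.log p / (p : ℝ) ^ 2)) :
    ∃ B : ℝ, 0 ≤ B ∧ ∀ R : ℕ, 1 ≤ R → ∀ v : ℝ, 0 ≤ v → v ≤ Real.log R →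
      |∑ p ∈ R.primesLE.filter (fun p : ℕ => Real.log p ≤ v), c p - κ * v| ≤ B := by
  obtain ⟨K, hK0, hK⟩ := exists_sum_log_div_sq_le
  have hl4 := Real.log_nonneg (show (1 : ℝ) ≤ 4 by norm_num)
  have hl2 := Real.log_nonneg (show (1 : ℝ) ≤ 2 by norm_num)
  refine ⟨κ * (Real.log 4 + 1 + Real.log 2 + 2 * K) + C * K, by positivity,
    fun R hR v hv hvR => ?_⟩
  set n := ⌊Real.exp v⌋₊ with hn
  have hexp : 1 ≤ Real.exp v := Real.one_le_exp hv
  have hn1 : 1 ≤ n := Nat.le_floor (by simpa using hexp)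
  have hn0 : (0 : ℝ) < n := by exact_mod_cast hn1
  have hR0 : (0 : ℝ) < R := by exact_mod_cast hR
  -- The cut-off `log p ≤ v` is `p ≤ ⌊exp v⌋`. The bound `v ≤ log R` makes the range `p ≤ R`
  -- irrelevant, and the floor costs at most `log 2`.
  have hfilter : R.primesLE.filter (fun p : ℕ => Real.log p ≤ v) = n.primesLE := by
    ext p
    simp only [Finset.mem_filter, Nat.mem_primesLE]
    constructor
    · rintro ⟨⟨hpR, hp⟩, hpv⟩
      refine ⟨Nat.le_floor ?_, hp⟩
      rwa [← Real.log_le_iff_le_exp (by exact_mod_cast hp.pos)]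
    · rintro ⟨hpn, hp⟩
      have hpv : Real.log p ≤ v := by
        rw [Real.log_le_iff_le_exp (by exact_mod_cast hp.pos)]
        exact (Nat.le_floor_iff (by positivity)).1 hpn
      refine ⟨⟨?_, hp⟩, hpv⟩
      exact_mod_cast (Real.log_le_log_iff (by exact_mod_cast hp.pos) hR0).1 (hpv.trans hvR)
  rw [hfilter]
  have hnv : Real.log n ≤ v := by
    rw [Real.log_le_iff_le_exp hn0]; exact Nat.floor_le (by positivity)
  have hvn : v ≤ Real.log n + Real.log 2 := by
    rw [← Real.log_mul hn0.ne' two_ne_zero, Real.le_log_iff_exp_le (by positivity)]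
    have h1 := Nat.lt_floor_add_one (Real.exp v)
    have h2 : (1 : ℝ) ≤ n := by exact_mod_cast hn1
    rw [← hn] at h1
    linarith
  have hup := sum_log_div_le n hn1
  have hlow : Real.log n - 1 - 2 * K ≤ ∑ p ∈ n.primesLE, Real.log p / p := by
    have h1 := le_sum_log_div_sub_one n hn1
    have h2 : ∑ p ∈ n.primesLE, Real.log p / ((p : ℝ) - 1) ≤
        ∑ p ∈ n.primesLE, (Real.log p / p + 2 * (Real.log p / (p : ℝ) ^ 2)) := by
      refine Finset.sum_le_sum fun p hp => ?_
      have h3 : (2 : ℝ) ≤ p := by exact_mod_cast (Nat.prime_of_mem_primesLE hp).two_le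
      have h4 : 1 / ((p : ℝ) - 1) ≤ 1 / p + 2 * (1 / (p : ℝ) ^ 2) := by
        have h6 : 1 / (p : ℝ) + 2 * (1 / (p : ℝ) ^ 2) - 1 / ((p : ℝ) - 1) =
            (p - 2) / (p ^ 2 * (p - 1)) := by
          have : (p : ℝ) - 1 ≠ 0 := by linarith
          have : (p : ℝ) ≠ 0 := by linarith
          field_simp
          ring
        have h5 : 0 ≤ ((p : ℝ) - 2) / (p ^ 2 * (p - 1)) :=
          div_nonneg (by linarith) (mul_nonneg (by positivity) (by linarith))
        linarith
      have h5 := mul_le_mul_of_nonneg_left h4 (Real.log_natCast_nonneg p)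
      calc _ = Real.log p * (1 / ((p : ℝ) - 1)) := by ring
        _ ≤ _ := h5
        _ = _ := by ring
    rw [Finset.sum_add_distrib, ← Finset.mul_sum] at h2
    linarith [hK n.primesLE]
  have hdiff : |∑ p ∈ n.primesLE, c p - κ * ∑ p ∈ n.primesLE, Real.log p / p| ≤ C * K := by
    rw [Finset.mul_sum, ← Finset.sum_sub_distrib]
    refine (Finset.abs_sum_le_sum_abs _ _).trans ?_
    refine (Finset.sum_le_sum fun p hp => hc p (Nat.prime_of_mem_primesLE hp)).trans ?_
    rw [← Finset.mul_sum]
    exact mul_le_mul_of_nonneg_left (hK _) hC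
  have h1 : |∑ p ∈ n.primesLE, Real.log p / p - v| ≤ Real.log 4 + 1 + Real.log 2 + 2 * K := by
    rw [abs_le]; constructor <;> linarith
  calc |∑ p ∈ n.primesLE, c p - κ * v|
      = |(∑ p ∈ n.primesLE, c p - κ * ∑ p ∈ n.primesLE, Real.log p / p) +
          κ * (∑ p ∈ n.primesLE, Real.log p / p - v)| := by congr 1; ring
    _ ≤ C * K + κ * (Real.log 4 + 1 + Real.log 2 + 2 * K) := by
        refine (abs_add_le _ _).trans (add_le_add hdiff ?_)
        rw [abs_mul, abs_of_nonneg hκ]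
        exact mul_le_mul_of_nonneg_left h1 hκ
    _ = _ := by ring

/-- Partial summation against a power: if the counting function of the weights `c` is
`κ v + O(B)` on `[0, b]`, then `∑ c (b - ℓ)^j = κ b^(j+1)/(j+1) + O(B b^j)`. -/
lemma abs_sum_mul_sub_pow_le {ι : Type*} (P : Finset ι) (c ℓ : ι → ℝ) {κ B b : ℝ} (hb : 0 ≤ b)
    (hℓ : ∀ p ∈ P, 0 ≤ ℓ p)
    (hB : ∀ v, 0 ≤ v → v ≤ b → |∑ p ∈ P with ℓ p ≤ v, c p - κ * v| ≤ B) (j : ℕ) :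
    |∑ p ∈ P with ℓ p ≤ b, c p * (b - ℓ p) ^ j - κ * b ^ (j + 1) / (j + 1)| ≤ B * b ^ j := by
  rcases j with _ | j
  · simpa using hB b hb le_rfl
  have hB0 : 0 ≤ B := (abs_nonneg _).trans (hB 0 le_rfl hb)
  have hint : ∀ x : ℝ, ∫ v in x..b, ((j : ℝ) + 1) * (b - v) ^ j = (b - x) ^ (j + 1) := by
    intro x
    rw [intervalIntegral.integral_const_mul,
      intervalIntegral.integral_comp_sub_left (fun v => v ^ j) b, integral_pow]
    simp
    field_simp
  -- Abel summation in integral form: `(b - ℓ)^(j+1)` is the integral of `f` over `[ℓ, b]`, so the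
  -- weighted sum is the integral of the counting function against `f ≥ 0`.
  set f : ℝ → ℝ := fun v => ((j : ℝ) + 1) * (b - v) ^ j with hf
  have hfc : Continuous f := by fun_prop
  have hfi : MeasureTheory.IntegrableOn f (Set.Icc 0 b) := hfc.integrableOn_Icc
  have hset : ∀ x, 0 ≤ x → x ≤ b → ∫ v in Set.Icc 0 b, (Set.Ici x).indicator f v =
      (b - x) ^ (j + 1) := by
    intro x hx hxb
    have hinter : Set.Icc 0 b ∩ Set.Ici x = Set.Icc x b := by
      ext v
      simp only [Set.mem_inter_iff, Set.mem_Icc, Set.mem_Ici]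
      exact ⟨fun h => ⟨h.2, h.1.2⟩, fun h => ⟨⟨hx.trans h.1, h.2⟩, h.1⟩⟩
    rw [MeasureTheory.setIntegral_indicator measurableSet_Ici, hinter, MeasureTheory.integral_Icc_eq_integral_Ioc,
      ← intervalIntegral.integral_of_le hxb, hint]
  have hlin : ∫ v in Set.Icc 0 b, v * f v = b ^ (j + 2) / (j + 2) := by
    have h1 : ∀ v, v * f v = b * f v - ((j : ℝ) + 1) * (b - v) ^ (j + 1) := by
      intro v; simp only [hf]; ring
    simp_rw [h1]
    rw [MeasureTheory.integral_sub (hfi.const_mul b)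
      (Continuous.integrableOn_Icc (by fun_prop)),
      MeasureTheory.integral_const_mul b,
      MeasureTheory.integral_const_mul ((j : ℝ) + 1) (fun v => (b - v) ^ (j + 1)),
      MeasureTheory.integral_Icc_eq_integral_Ioc, MeasureTheory.integral_Icc_eq_integral_Ioc,
      ← intervalIntegral.integral_of_le hb, ← intervalIntegral.integral_of_le hb, hint,
      intervalIntegral.integral_comp_sub_left (fun v => v ^ (j + 1)) b, integral_pow]
    simp only [sub_zero, sub_self]
    push_cast
    field_simp
    ring
  have hmain : ∑ p ∈ P with ℓ p ≤ b, c p * (b - ℓ p) ^ (j + 1) -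
      κ * b ^ (j + 1 + 1) / ((j + 1 : ℕ) + 1) =
      ∫ v in Set.Icc 0 b, (∑ p ∈ P with ℓ p ≤ v, c p - κ * v) * f v := by
    -- The condition `ℓ p ≤ v` is moved into an indicator so that the index set no longer depends on
    -- `v` and sum and integral can be exchanged.
    have h1 : ∫ v in Set.Icc 0 b, (∑ p ∈ P with ℓ p ≤ v, c p - κ * v) * f v =
        ∫ v in Set.Icc 0 b, (∑ p ∈ P with ℓ p ≤ b, c p * (Set.Ici (ℓ p)).indicator f v -
          κ * (v * f v)) := by
      refine MeasureTheory.setIntegral_congr_fun measurableSet_Icc fun v hv => ?_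
      simp only [sub_mul, Finset.sum_mul, Set.indicator_apply, Set.mem_Ici]
      congr 1
      · rw [Finset.sum_filter, Finset.sum_filter]
        refine Finset.sum_congr rfl fun p _ => ?_
        by_cases h : ℓ p ≤ v
        · simp [h, h.trans hv.2]
        · simp [h]
      · ring
    have h2 : ∀ p, MeasureTheory.IntegrableOn
        (fun v => c p * (Set.Ici (ℓ p)).indicator f v) (Set.Icc 0 b) := fun p =>
      (hfi.indicator measurableSet_Ici).const_mul (c p)
    have hvf : MeasureTheory.IntegrableOn (fun v => v * f v) (Set.Icc 0 b) :=
      Continuous.integrableOn_Icc (by fun_prop)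
    rw [h1, MeasureTheory.integral_sub (MeasureTheory.integrable_finsetSum _ fun p _ => h2 p)
      (hvf.const_mul κ),
      MeasureTheory.integral_finsetSum _ fun p _ => h2 p, MeasureTheory.integral_const_mul, hlin]
    congr 1
    · refine Finset.sum_congr rfl fun p hp => ?_
      simp only [Finset.mem_filter] at hp
      rw [MeasureTheory.integral_const_mul, hset _ (hℓ p hp.1) hp.2]
    · push_cast; ring
  rw [hmain, ← Real.norm_eq_abs]
  have hbound : ∀ᵐ v ∂(MeasureTheory.volume.restrict (Set.Icc 0 b)),
      ‖(∑ p ∈ P with ℓ p ≤ v, c p - κ * v) * f v‖ ≤ B * f v := by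
    filter_upwards [MeasureTheory.ae_restrict_mem measurableSet_Icc] with v hv
    have hf0 : 0 ≤ f v := mul_nonneg (by positivity) (pow_nonneg (by linarith [hv.2]) _)
    rw [norm_mul, Real.norm_eq_abs, Real.norm_eq_abs, abs_of_nonneg hf0]
    exact mul_le_mul_of_nonneg_right (hB v hv.1 hv.2) hf0
  refine (MeasureTheory.norm_integral_le_of_norm_le (hfi.const_mul B) hbound).trans_eq ?_
  rw [MeasureTheory.integral_const_mul, MeasureTheory.integral_Icc_eq_integral_Ioc,
    ← intervalIntegral.integral_of_le hb, hint, sub_zero]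

end Mertens

/-! ### Squarefree numbers as sets of primes, and the basic recursion -/

/-- The finite sets of primes with product at most `R`, i.e. the squarefree numbers up to `R`. -/
def primeSets (R : ℕ) : Finset (Finset ℕ) :=
  R.primesLE.powerset.filter fun s => ∏ p ∈ s, p ≤ R

/-- The logarithm of the product of a set of primes. -/
noncomputable def logSum (s : Finset ℕ) : ℝ := ∑ p ∈ s, Real.log p

section PrimeSets

lemma prime_of_mem_primeSets {R : ℕ} {s : Finset ℕ} (hs : s ∈ primeSets R) {p : ℕ} (hp : p ∈ s) :
    p.Prime :=
  Nat.prime_of_mem_primesLE (Finset.mem_powerset.1 (Finset.mem_filter.1 hs).1 hp)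

lemma prod_pos_of_forall_prime {s : Finset ℕ} (hs : ∀ p ∈ s, p.Prime) : 0 < ∏ p ∈ s, p :=
  Finset.prod_pos fun p hp => (hs p hp).pos

lemma mem_primeSets {R : ℕ} {s : Finset ℕ} :
    s ∈ primeSets R ↔ (∀ p ∈ s, p.Prime) ∧ ∏ p ∈ s, p ≤ R := by
  constructor
  · intro h
    exact ⟨fun p hp => prime_of_mem_primeSets h hp, (Finset.mem_filter.1 h).2⟩
  · rintro ⟨h1, h2⟩
    refine Finset.mem_filter.2 ⟨Finset.mem_powerset.2 fun p hp => ?_, h2⟩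
    exact Nat.mem_primesLE.2 ⟨(Nat.le_of_dvd (prod_pos_of_forall_prime h1)
      (Finset.dvd_prod_of_mem _ hp)).trans h2, h1 p hp⟩

lemma prod_le_prod_of_subset_primes {s t : Finset ℕ} (hs : ∀ p ∈ s, p.Prime) (h : t ⊆ s) :
    ∏ p ∈ t, p ≤ ∏ p ∈ s, p :=
  Nat.le_of_dvd (prod_pos_of_forall_prime hs) (Finset.prod_dvd_prod_of_subset _ _ _ h)

lemma primeSets_down {R : ℕ} : ∀ s ∈ primeSets R, ∀ t ⊆ s, t ∈ primeSets R := by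
  intro s hs t ht
  rw [mem_primeSets] at hs ⊢
  exact ⟨fun p hp => hs.1 p (ht hp), (prod_le_prod_of_subset_primes hs.1 ht).trans hs.2⟩

lemma logSum_eq_log_prod {s : Finset ℕ} (hs : ∀ p ∈ s, p.Prime) :
    logSum s = Real.log (∏ p ∈ s, p : ℕ) := by
  rw [logSum]
  push_cast
  rw [Real.log_prod]
  intro p hp
  exact_mod_cast (hs p hp).ne_zero

lemma logSum_nonneg (s : Finset ℕ) : 0 ≤ logSum s :=
  Finset.sum_nonneg fun p _ => Real.log_natCast_nonneg p

lemma logSum_insert {s : Finset ℕ} {p : ℕ} (hp : p ∉ s) :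
    logSum (insert p s) = Real.log p + logSum s := Finset.sum_insert hp

lemma logSum_sdiff {s r : Finset ℕ} (h : r ⊆ s) : logSum (s \ r) = logSum s - logSum r := by
  rw [logSum, logSum, logSum, ← Finset.sum_sdiff h]; ring

lemma mem_primeSets_iff_logSum {R : ℕ} (hR : 1 ≤ R) {s : Finset ℕ} :
    s ∈ primeSets R ↔ (∀ p ∈ s, p.Prime) ∧ logSum s ≤ Real.log R := by
  rw [mem_primeSets]
  refine and_congr_right fun hs => ?_
  rw [logSum_eq_log_prod hs, Real.log_le_log_iff (by exact_mod_cast prod_pos_of_forall_prime hs)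
    (by exact_mod_cast hR)]
  norm_cast

lemma logSum_le_log {R : ℕ} {s : Finset ℕ} (hs : s ∈ primeSets R) : logSum s ≤ Real.log R := by
  have h := mem_primeSets.1 hs
  have : 1 ≤ R := (Nat.succ_le_of_lt (prod_pos_of_forall_prime h.1)).trans h.2
  exact ((mem_primeSets_iff_logSum this).1 hs).2

lemma empty_mem_primeSets {R : ℕ} (hR : 1 ≤ R) : ∅ ∈ primeSets R := by
  rw [mem_primeSets]; simpa using hR

/-- Summing over a prime of `s` is the same as summing over a prime that can be added to `s`. -/
lemma sum_primeSets_erase {R : ℕ} (hR : 1 ≤ R) (Φ : ℕ → Finset ℕ → ℝ) :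
    ∑ s ∈ primeSets R, ∑ p ∈ s, Φ p (s.erase p) =
      ∑ s ∈ primeSets R,
        ∑ p ∈ (R.primesLE.filter fun p : ℕ => Real.log p ≤ Real.log R - logSum s) with p ∉ s,
          Φ p s := by
  rw [Finset.sum_sigma', Finset.sum_sigma']
  refine Finset.sum_bij' (fun x _ => ⟨x.1.erase x.2, x.2⟩) (fun x _ => ⟨insert x.2 x.1, x.2⟩)
    ?_ ?_ ?_ ?_ ?_
  · rintro ⟨s, p⟩ hx
    simp only [Finset.mem_sigma, Finset.mem_filter] at hx ⊢
    have h1 := (mem_primeSets_iff_logSum hR).1 hx.1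
    have h2 : logSum s = Real.log p + logSum (s.erase p) := by
      rw [← logSum_insert (Finset.notMem_erase p s), Finset.insert_erase hx.2]
    refine ⟨primeSets_down s hx.1 _ (Finset.erase_subset _ _), ⟨?_, ?_⟩, Finset.notMem_erase _ _⟩
    · exact Finset.mem_powerset.1 (Finset.mem_filter.1 hx.1).1 hx.2
    · linarith [h1.2]
  · rintro ⟨s, p⟩ hx
    simp only [Finset.mem_sigma, Finset.mem_filter] at hx ⊢
    have h1 := (mem_primeSets_iff_logSum hR).1 hx.1
    refine ⟨(mem_primeSets_iff_logSum hR).2 ⟨?_, ?_⟩, Finset.mem_insert_self _ _⟩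
    · intro q hq
      rcases Finset.mem_insert.1 hq with rfl | hq
      · exact Nat.prime_of_mem_primesLE hx.2.1.1
      · exact h1.1 q hq
    · rw [logSum_insert hx.2.2]; linarith [hx.2.1.2]
  · rintro ⟨s, p⟩ hx
    simp only [Finset.mem_sigma] at hx
    simp [Finset.insert_erase hx.2]
  · rintro ⟨s, p⟩ hx
    simp only [Finset.mem_sigma, Finset.mem_filter] at hx
    simp [Finset.erase_insert hx.2.2]
  · rintro ⟨s, p⟩ hx
    rfl

/-- The sums `∑ h(s) (log R - log s)^j` over the squarefree numbers `s ≤ R`. -/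
noncomputable def powerSum (h : ℕ → ℝ) (R j : ℕ) : ℝ :=
  ∑ s ∈ primeSets R, (∏ p ∈ s, h p) * (Real.log R - logSum s) ^ j

/-- Removing `p` from `s` leaves a set counted in `powerSum`, and restoring the factor `log p` only
enlarges the power. This bounds the error made when a prime `p` added to `s` is not required to be
new. -/
lemma sum_weight_erase_le {R : ℕ} (hR : 1 ≤ R) {h c : ℕ → ℝ} {K : ℝ}
    (hh : ∀ p, p.Prime → 0 ≤ h p) (hc : ∀ p, p.Prime → 0 ≤ c p)
    (hK : ∑ p ∈ R.primesLE, h p * c p ≤ K) (j : ℕ) :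
    ∑ s ∈ primeSets R, (∏ p ∈ s, h p) * ∑ p ∈ s, c p * (Real.log R - logSum s) ^ j ≤
      K * powerSum h R j := by
  have h1 : ∑ s ∈ primeSets R, (∏ p ∈ s, h p) * ∑ p ∈ s, c p * (Real.log R - logSum s) ^ j =
      ∑ s ∈ primeSets R,
        ∑ p ∈ (R.primesLE.filter fun p : ℕ => Real.log p ≤ Real.log R - logSum s) with p ∉ s,
          h p * c p * (∏ q ∈ s, h q) * (Real.log R - logSum s - Real.log p) ^ j := by
    refine Eq.trans ?_ (sum_primeSets_erase hR fun p t => h p * c p * (∏ q ∈ t, h q) *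
      (Real.log R - logSum t - Real.log p) ^ j)
    refine Finset.sum_congr rfl fun s hs => ?_
    rw [Finset.mul_sum]
    refine Finset.sum_congr rfl fun p hp => ?_
    have h2 : logSum s = Real.log p + logSum (s.erase p) := by
      rw [← logSum_insert (Finset.notMem_erase p s), Finset.insert_erase hp]
    have h3 : ∏ q ∈ s, h q = h p * ∏ q ∈ s.erase p, h q := (Finset.mul_prod_erase s h hp).symm
    rw [h2, h3, sub_add_eq_sub_sub_swap]
    ring
  rw [h1, powerSum, Finset.mul_sum]
  refine Finset.sum_le_sum fun s hs => ?_
  have hs0 : 0 ≤ ∏ q ∈ s, h q := Finset.prod_nonneg fun q hq => hh q (prime_of_mem_primeSets hs hq)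
  have hb : 0 ≤ Real.log R - logSum s := sub_nonneg.2 (logSum_le_log hs)
  have h4 : ∀ p ∈ (R.primesLE.filter fun p : ℕ => Real.log p ≤ Real.log R - logSum s).filter
      (fun p => p ∉ s), h p * c p * (∏ q ∈ s, h q) * (Real.log R - logSum s - Real.log p) ^ j ≤
      h p * c p * ((∏ q ∈ s, h q) * (Real.log R - logSum s) ^ j) := by
    intro p hp
    simp only [Finset.mem_filter] at hp
    have hpp := Nat.prime_of_mem_primesLE hp.1.1
    rw [mul_assoc]
    refine mul_le_mul_of_nonneg_left (mul_le_mul_of_nonneg_left ?_ hs0)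
      (mul_nonneg (hh p hpp) (hc p hpp))
    refine pow_le_pow_left₀ (by linarith [hp.1.2]) ?_ _
    linarith [Real.log_natCast_nonneg p]
  refine (Finset.sum_le_sum h4).trans ?_
  rw [← Finset.sum_mul]
  refine mul_le_mul_of_nonneg_right (le_trans ?_ hK) (by positivity)
  refine Finset.sum_le_sum_of_subset_of_nonneg
    ((Finset.filter_subset _ _).trans (Finset.filter_subset _ _)) fun p hp _ => ?_
  have hpp := Nat.prime_of_mem_primesLE hp
  exact mul_nonneg (hh p hpp) (hc p hpp)

/-- The recursion obtained by writing `log s` as a sum over the primes of `s`. -/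
lemma abs_sum_weight_erase_sub_le {R : ℕ} (hR : 1 ≤ R) {h c : ℕ → ℝ} {W : Finset ℕ → ℝ}
    {κ B K M : ℝ} (hh : ∀ p, p.Prime → 0 ≤ h p) (hc : ∀ p, p.Prime → 0 ≤ c p)
    (hK : ∑ p ∈ R.primesLE, h p * c p ≤ K) (hM : 0 ≤ M)
    (hB : ∀ v, 0 ≤ v → v ≤ Real.log R →
      |∑ p ∈ R.primesLE.filter (fun p : ℕ => Real.log p ≤ v), c p - κ * v| ≤ B)
    (hW0 : ∀ s ∈ primeSets R, 0 ≤ W s) (hW : ∀ s ∈ primeSets R, W s ≤ M * ∏ p ∈ s, h p) (j : ℕ) :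
    |∑ s ∈ primeSets R, ∑ p ∈ s, c p * W (s.erase p) * (Real.log R - logSum s) ^ j -
      κ / (j + 1) * ∑ s ∈ primeSets R, W s * (Real.log R - logSum s) ^ (j + 1)| ≤
      M * (B + K) * powerSum h R j := by
  have hB0 : 0 ≤ B :=
    (abs_nonneg _).trans (hB 0 le_rfl (Real.log_natCast_nonneg R))
  have h1 : ∑ s ∈ primeSets R, ∑ p ∈ s, c p * W (s.erase p) * (Real.log R - logSum s) ^ j =
      ∑ s ∈ primeSets R,
        ∑ p ∈ (R.primesLE.filter fun p : ℕ => Real.log p ≤ Real.log R - logSum s) with p ∉ s,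
          c p * W s * (Real.log R - logSum s - Real.log p) ^ j := by
    refine Eq.trans ?_ (sum_primeSets_erase hR fun p t => c p * W t *
      (Real.log R - logSum t - Real.log p) ^ j)
    refine Finset.sum_congr rfl fun s hs => Finset.sum_congr rfl fun p hp => ?_
    have h2 : logSum s = Real.log p + logSum (s.erase p) := by
      rw [← logSum_insert (Finset.notMem_erase p s), Finset.insert_erase hp]
    rw [h2, sub_add_eq_sub_sub_swap]
  rw [h1, Finset.mul_sum, ← Finset.sum_sub_distrib]
  have h2 : ∀ s ∈ primeSets R,
      |∑ p ∈ (R.primesLE.filter fun p : ℕ => Real.log p ≤ Real.log R - logSum s) with p ∉ s,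
        c p * W s * (Real.log R - logSum s - Real.log p) ^ j -
        κ / (j + 1) * (W s * (Real.log R - logSum s) ^ (j + 1))| ≤
      M * (B * ((∏ p ∈ s, h p) * (Real.log R - logSum s) ^ j)) +
        M * ((∏ p ∈ s, h p) * ∑ p ∈ s, c p * (Real.log R - logSum s) ^ j) := by
    intro s hs
    set b := Real.log R - logSum s with hb
    have hb0 : 0 ≤ b := sub_nonneg.2 (logSum_le_log hs)
    have hbR : b ≤ Real.log R := by linarith [logSum_nonneg s]
    have hpar := abs_sum_mul_sub_pow_le R.primesLE c (fun p : ℕ => Real.log p) (κ := κ) (B := B) hb0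
      (fun p _ => Real.log_natCast_nonneg p) (fun v hv hvb => hB v hv (hvb.trans hbR)) j
    -- Partial summation needs all primes with `log p ≤ b`, while the recursion only adds `p ∉ s`.
    -- The excess `X` over `p ∈ s` goes into the `K` part of the error.
    have hsplit := Finset.sum_filter_add_sum_filter_not
      (R.primesLE.filter fun p : ℕ => Real.log p ≤ b) (fun p => p ∈ s)
      (fun p => c p * (b - Real.log p) ^ j)
    set X := ∑ p ∈ (R.primesLE.filter fun p : ℕ => Real.log p ≤ b) with p ∈ s,
      c p * (b - Real.log p) ^ j with hX
    have hX0 : 0 ≤ X := by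
      refine Finset.sum_nonneg fun p hp => ?_
      simp only [Finset.mem_filter] at hp
      exact mul_nonneg (hc p (Nat.prime_of_mem_primesLE hp.1.1))
        (pow_nonneg (by linarith [hp.1.2]) _)
    have hXle : X ≤ ∑ p ∈ s, c p * b ^ j := by
      have h3 : X ≤ ∑ p ∈ (R.primesLE.filter fun p : ℕ => Real.log p ≤ b) with p ∈ s,
          c p * b ^ j := by
        refine Finset.sum_le_sum fun p hp => ?_
        simp only [Finset.mem_filter] at hp
        refine mul_le_mul_of_nonneg_left ?_ (hc p (Nat.prime_of_mem_primesLE hp.1.1))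
        exact pow_le_pow_left₀ (by linarith [hp.1.2]) (by linarith [Real.log_natCast_nonneg p]) _
      refine h3.trans (Finset.sum_le_sum_of_subset_of_nonneg ?_ fun p hp _ => ?_)
      · intro p hp
        exact (Finset.mem_filter.1 hp).2
      · exact mul_nonneg (hc p (prime_of_mem_primeSets hs hp)) (by positivity)
    have h4 : ∑ p ∈ (R.primesLE.filter fun p : ℕ => Real.log p ≤ b) with p ∉ s,
        c p * W s * (b - Real.log p) ^ j - κ / (j + 1) * (W s * b ^ (j + 1)) =
        W s * ((∑ p ∈ R.primesLE.filter (fun p : ℕ => Real.log p ≤ b), c p * (b - Real.log p) ^ j -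
          κ * b ^ (j + 1) / (j + 1)) - X) := by
      have h5 : ∑ p ∈ (R.primesLE.filter fun p : ℕ => Real.log p ≤ b) with p ∉ s,
        c p * W s * (b - Real.log p) ^ j = W s *
          ∑ p ∈ (R.primesLE.filter fun p : ℕ => Real.log p ≤ b) with p ∉ s,
            c p * (b - Real.log p) ^ j := by
        rw [Finset.mul_sum]
        exact Finset.sum_congr rfl fun p _ => by ring
      rw [h5, ← hsplit]
      ring
    have hh0 : 0 ≤ ∏ p ∈ s, h p := Finset.prod_nonneg fun q hq => hh q (prime_of_mem_primeSets hs hq)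
    rw [h4, abs_mul, abs_of_nonneg (hW0 s hs)]
    have h6 : |(∑ p ∈ R.primesLE.filter (fun p : ℕ => Real.log p ≤ b), c p * (b - Real.log p) ^ j -
          κ * b ^ (j + 1) / (j + 1)) - X| ≤ B * b ^ j + ∑ p ∈ s, c p * b ^ j := by
      refine (abs_sub _ _).trans (add_le_add hpar ?_)
      rwa [abs_of_nonneg hX0]
    refine (mul_le_mul (hW s hs) h6 (abs_nonneg _) (by positivity)).trans_eq ?_
    ring
  refine (Finset.abs_sum_le_sum_abs _ _).trans ((Finset.sum_le_sum h2).trans ?_)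
  rw [Finset.sum_add_distrib, ← Finset.mul_sum, ← Finset.mul_sum, ← Finset.mul_sum]
  have h3 := sum_weight_erase_le hR hh hc hK j
  have h4 : ∑ s ∈ primeSets R, (∏ p ∈ s, h p) * (Real.log R - logSum s) ^ j = powerSum h R j := rfl
  rw [h4]
  nlinarith [mul_le_mul_of_nonneg_left h3 hM]

end PrimeSets

/-! ### Limits of the normalised power sums -/

section MainTermAsymptotics

/-- The sum over the splittings `s = r ∪ (s \ r)` weighted by `α(r) β(s \ r) (log R - log r)^i`. -/
noncomputable def splitSum (α β : ℕ → ℝ) (R i : ℕ) (s : Finset ℕ) : ℝ :=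
  ∑ r ∈ s.powerset, (∏ p ∈ r, α p) * (∏ p ∈ s \ r, β p) * (Real.log R - logSum r) ^ i

/-- The two-variable analogue of `powerSum`. -/
noncomputable def mixedSum (α β : ℕ → ℝ) (R i j : ℕ) : ℝ :=
  ∑ s ∈ primeSets R, splitSum α β R i s * (Real.log R - logSum s) ^ j

lemma splitSum_zero {α β h : ℕ → ℝ} {R : ℕ} {s : Finset ℕ} (hs : ∀ p ∈ s, α p + β p = h p) :
    splitSum α β R 0 s = ∏ p ∈ s, h p := by
  rw [splitSum, ← Finset.prod_congr rfl hs, Finset.prod_add]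
  simp

lemma splitSum_nonneg {α β : ℕ → ℝ} {R : ℕ} (hα : ∀ p, p.Prime → 0 ≤ α p)
    (hβ : ∀ p, p.Prime → 0 ≤ β p) (i : ℕ) {s : Finset ℕ} (hs : s ∈ primeSets R) :
    0 ≤ splitSum α β R i s := by
  refine Finset.sum_nonneg fun r hr => ?_
  have hr' := Finset.mem_powerset.1 hr
  refine mul_nonneg (mul_nonneg (Finset.prod_nonneg fun p hp => ?_)
    (Finset.prod_nonneg fun p hp => ?_)) (pow_nonneg ?_ _)
  · exact hα p (prime_of_mem_primeSets hs (hr' hp))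
  · exact hβ p (prime_of_mem_primeSets hs (Finset.mem_sdiff.1 hp).1)
  · exact sub_nonneg.2 (logSum_le_log (primeSets_down s hs r hr'))

lemma splitSum_le {α β h : ℕ → ℝ} {R : ℕ} (hα : ∀ p, p.Prime → 0 ≤ α p)
    (hβ : ∀ p, p.Prime → 0 ≤ β p) (hαβ : ∀ p, p.Prime → α p + β p = h p)
    (i : ℕ) {s : Finset ℕ} (hs : s ∈ primeSets R) :
    splitSum α β R i s ≤ Real.log R ^ i * ∏ p ∈ s, h p := by
  rw [← splitSum_zero (R := R) fun p hp => hαβ p (prime_of_mem_primeSets hs hp), splitSum,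
    splitSum, Finset.mul_sum]
  refine Finset.sum_le_sum fun r hr => ?_
  have hr' := Finset.mem_powerset.1 hr
  have h1 : 0 ≤ (∏ p ∈ r, α p) * ∏ p ∈ s \ r, β p :=
    mul_nonneg (Finset.prod_nonneg fun p hp => hα p (prime_of_mem_primeSets hs (hr' hp)))
      (Finset.prod_nonneg fun p hp => hβ p (prime_of_mem_primeSets hs (Finset.mem_sdiff.1 hp).1))
  rw [pow_zero, mul_one, mul_comm]
  refine mul_le_mul_of_nonneg_right (pow_le_pow_left₀ ?_ ?_ _) h1
  · exact sub_nonneg.2 (logSum_le_log (primeSets_down s hs r hr'))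
  · linarith [logSum_nonneg r]

lemma mixedSum_zero {α β h : ℕ → ℝ} (hαβ : ∀ p, p.Prime → α p + β p = h p) (R j : ℕ) :
    mixedSum α β R 0 j = powerSum h R j :=
  Finset.sum_congr rfl fun s hs => by
    rw [splitSum_zero fun p hp => hαβ p (prime_of_mem_primeSets hs hp)]

/-- Adding a prime to the second part of a splitting produces the weight `log (s/r) = log(R/r) -
log(R/s)`. The first term raises the exponent `i`; the second raises the outer exponent `j`. -/
lemma sum_splitSum_erase (α β : ℕ → ℝ) (R i : ℕ) (s : Finset ℕ) :
    ∑ p ∈ s, β p * Real.log p * splitSum α β R i (s.erase p) =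
      splitSum α β R (i + 1) s - splitSum α β R i s * (Real.log R - logSum s) := by
  have h1 : ∑ p ∈ s, β p * Real.log p * splitSum α β R i (s.erase p) =
      ∑ r ∈ s.powerset, ∑ p ∈ s \ r, Real.log p *
        ((∏ p ∈ r, α p) * (∏ p ∈ s \ r, β p) * (Real.log R - logSum r) ^ i) := by
    simp_rw [splitSum, Finset.mul_sum]
    rw [Finset.sum_comm' (t' := s.powerset) (s' := fun r => s \ r)]
    · refine Finset.sum_congr rfl fun r _ => Finset.sum_congr rfl fun p hp => ?_
      have h2 : s.erase p \ r = (s \ r).erase p := by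
        ext q; simp only [Finset.mem_sdiff, Finset.mem_erase]; tauto
      rw [h2, ← Finset.mul_prod_erase _ _ hp]
      ring
    · intro p r
      simp only [Finset.mem_powerset, Finset.mem_sdiff, Finset.subset_erase]
      tauto
  rw [h1, splitSum, splitSum, Finset.sum_mul, ← Finset.sum_sub_distrib]
  refine Finset.sum_congr rfl fun r hr => ?_
  rw [← Finset.sum_mul]
  have h3 : ∑ p ∈ s \ r, Real.log p = logSum s - logSum r :=
    logSum_sdiff (Finset.mem_powerset.1 hr)
  rw [h3]
  ring

lemma powerSum_recursion {R : ℕ} (hR : 1 ≤ R) {h : ℕ → ℝ} {κ B K : ℝ}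
    (hh : ∀ p, p.Prime → 0 ≤ h p)
    (hK : ∑ p ∈ R.primesLE, h p * (h p * Real.log p) ≤ K)
    (hB : ∀ v, 0 ≤ v → v ≤ Real.log R →
      |∑ p ∈ R.primesLE.filter (fun p : ℕ => Real.log p ≤ v), h p * Real.log p - κ * v| ≤ B)
    (j : ℕ) :
    |Real.log R * powerSum h R j - powerSum h R (j + 1) - κ / (j + 1) * powerSum h R (j + 1)| ≤
      (B + K) * powerSum h R j := by
  have key := abs_sum_weight_erase_sub_le hR (c := fun p => h p * Real.log p)
    (W := fun s => ∏ p ∈ s, h p) (κ := κ) (B := B) (K := K) (M := 1) hh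
    (fun p hp => mul_nonneg (hh p hp) (Real.log_natCast_nonneg p)) hK zero_le_one hB
    (fun s hs => Finset.prod_nonneg fun q hq => hh q (prime_of_mem_primeSets hs hq))
    (fun s _ => by rw [one_mul]) j
  rw [one_mul] at key
  -- The sum is `∑ h(s) log s · (log R - log s)^j`, with `log s` written as `log R - (log R - log
  -- s)`.
  have h1 : ∑ s ∈ primeSets R, ∑ p ∈ s, h p * Real.log p * (∏ q ∈ s.erase p, h q) *
      (Real.log R - logSum s) ^ j = Real.log R * powerSum h R j - powerSum h R (j + 1) := by
    rw [powerSum, powerSum, Finset.mul_sum, ← Finset.sum_sub_distrib]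
    refine Finset.sum_congr rfl fun s _ => ?_
    have h2 : ∑ p ∈ s, h p * Real.log p * (∏ q ∈ s.erase p, h q) * (Real.log R - logSum s) ^ j =
        ∑ p ∈ s, Real.log p * ((∏ q ∈ s, h q) * (Real.log R - logSum s) ^ j) :=
      Finset.sum_congr rfl fun p hp => by rw [← Finset.mul_prod_erase _ _ hp]; ring
    rw [h2, ← Finset.sum_mul, ← logSum]
    ring
  rw [h1] at key
  exact key

lemma mixedSum_recursion {R : ℕ} (hR : 1 ≤ R) {h α β : ℕ → ℝ} {B K : ℝ}
    (hα : ∀ p, p.Prime → 0 ≤ α p) (hβ : ∀ p, p.Prime → 0 ≤ β p)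
    (hαβ : ∀ p, p.Prime → α p + β p = h p)
    (hK : ∑ p ∈ R.primesLE, h p * (β p * Real.log p) ≤ K)
    (hB : ∀ v, 0 ≤ v → v ≤ Real.log R →
      |∑ p ∈ R.primesLE.filter (fun p : ℕ => Real.log p ≤ v), β p * Real.log p - 1 * v| ≤ B)
    (i j : ℕ) :
    |mixedSum α β R (i + 1) j - mixedSum α β R i (j + 1) -
      1 / (j + 1) * mixedSum α β R i (j + 1)| ≤
      Real.log R ^ i * (B + K) * powerSum h R j := by
  have key := abs_sum_weight_erase_sub_le hR (h := h) (c := fun p => β p * Real.log p)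
    (W := splitSum α β R i) (κ := 1) (B := B) (K := K) (M := Real.log R ^ i)
    (fun p hp => by rw [← hαβ p hp]; exact add_nonneg (hα p hp) (hβ p hp))
    (fun p hp => mul_nonneg (hβ p hp) (Real.log_natCast_nonneg p)) hK
    (pow_nonneg (Real.log_natCast_nonneg R) _) hB
    (fun s hs => splitSum_nonneg hα hβ i hs)
    (fun s hs => splitSum_le hα hβ hαβ i hs) j
  have h1 : ∑ s ∈ primeSets R, ∑ p ∈ s, β p * Real.log p * splitSum α β R i (s.erase p) *
      (Real.log R - logSum s) ^ j = mixedSum α β R (i + 1) j - mixedSum α β R i (j + 1) := by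
    rw [mixedSum, mixedSum, ← Finset.sum_sub_distrib]
    refine Finset.sum_congr rfl fun s _ => ?_
    rw [← Finset.sum_mul, sum_splitSum_erase]
    ring
  rw [h1] at key
  exact key

/-- A family of local factors `h = α + β` of dimension `κ`, with `β` of dimension `1`. -/
structure SieveDensity (h α β : ℕ → ℝ) (κ C : ℝ) : Prop where
  dim_nonneg : 0 ≤ κ
  const_nonneg : 0 ≤ C
  left_nonneg : ∀ p, p.Prime → 0 ≤ α p
  right_nonneg : ∀ p, p.Prime → 0 ≤ β p
  add_eq : ∀ p, p.Prime → α p + β p = h p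
  abs_sub_le : ∀ p : ℕ, p.Prime → |h p - κ / p| ≤ C / (p : ℝ) ^ 2
  abs_right_sub_le : ∀ p : ℕ, p.Prime → |β p - 1 / p| ≤ C / (p : ℝ) ^ 2

namespace SieveDensity

variable {h α β : ℕ → ℝ} {κ C : ℝ}

lemma nonneg (D : SieveDensity h α β κ C) (p : ℕ) (hp : p.Prime) : 0 ≤ h p := by
  rw [← D.add_eq p hp]; exact add_nonneg (D.left_nonneg p hp) (D.right_nonneg p hp)

lemma le_div (D : SieveDensity h α β κ C) (p : ℕ) (hp : p.Prime) : h p ≤ (κ + C) / p := by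
  have h1 := (abs_le.1 (D.abs_sub_le p hp)).2
  have hp1 : (1 : ℝ) ≤ p := by exact_mod_cast hp.one_le
  have h2 : C / (p : ℝ) ^ 2 ≤ C / p :=
    div_le_div_of_nonneg_left D.const_nonneg (by linarith) (by nlinarith)
  rw [add_div]; linarith

lemma right_le (D : SieveDensity h α β κ C) (p : ℕ) (hp : p.Prime) : β p ≤ h p := by
  linarith [D.add_eq p hp, D.left_nonneg p hp]

/-- Uniform error constants for the two recursions. -/
lemma exists_recursion_bounds (D : SieveDensity h α β κ C) :
    ∃ E : ℝ, 0 ≤ E ∧ ∀ R : ℕ, 1 ≤ R → ∀ i j : ℕ,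
      |Real.log R * powerSum h R j - powerSum h R (j + 1) - κ / (j + 1) * powerSum h R (j + 1)| ≤
        E * powerSum h R j ∧
      |mixedSum α β R (i + 1) j - mixedSum α β R i (j + 1) -
        1 / (j + 1) * mixedSum α β R i (j + 1)| ≤ Real.log R ^ i * E * powerSum h R j := by
  have hlog : ∀ f : ℕ → ℝ, ∀ c : ℝ, (∀ p : ℕ, p.Prime → |f p - c / p| ≤ C / (p : ℝ) ^ 2) →
      ∀ p : ℕ, p.Prime → |f p * Real.log p - c * (Real.log p / p)| ≤
        C * (Real.log p / (p : ℝ) ^ 2) := by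
    intro f c hf p hp
    have h1 := mul_le_mul_of_nonneg_right (hf p hp) (Real.log_natCast_nonneg p)
    have h2 : f p * Real.log p - c * (Real.log p / p) = (f p - c / p) * Real.log p := by ring
    rw [h2, abs_mul, abs_of_nonneg (Real.log_natCast_nonneg p)]
    refine h1.trans_eq ?_
    ring
  obtain ⟨B₁, hB₁0, hB₁⟩ := exists_abs_sum_sub_le D.dim_nonneg D.const_nonneg
    (hlog h κ D.abs_sub_le)
  obtain ⟨B₂, hB₂0, hB₂⟩ := exists_abs_sum_sub_le zero_le_one D.const_nonneg
    (hlog β 1 D.abs_right_sub_le)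
  obtain ⟨K, hK0, hK⟩ := exists_sum_log_div_sq_le
  have hC0 : 0 ≤ κ + C := add_nonneg D.dim_nonneg D.const_nonneg
  have hKh : ∀ R : ℕ, ∑ p ∈ R.primesLE, h p * (h p * Real.log p) ≤ (κ + C) ^ 2 * K := by
    intro R
    refine le_trans ?_ (mul_le_mul_of_nonneg_left (hK R.primesLE) (sq_nonneg _))
    rw [Finset.mul_sum]
    refine Finset.sum_le_sum fun p hp => ?_
    have hpp := Nat.prime_of_mem_primesLE hp
    have h1 : h p * h p ≤ ((κ + C) / p) * ((κ + C) / p) :=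
      mul_le_mul (D.le_div p hpp) (D.le_div p hpp) (D.nonneg p hpp)
        (div_nonneg hC0 (Nat.cast_nonneg p))
    calc h p * (h p * Real.log p) = h p * h p * Real.log p := by ring
      _ ≤ ((κ + C) / p) * ((κ + C) / p) * Real.log p :=
        mul_le_mul_of_nonneg_right h1 (Real.log_natCast_nonneg p)
      _ = _ := by ring
  have hKβ : ∀ R : ℕ, ∑ p ∈ R.primesLE, h p * (β p * Real.log p) ≤ (κ + C) ^ 2 * K := by
    intro R
    refine le_trans (Finset.sum_le_sum fun p hp => ?_) (hKh R)
    have hpp := Nat.prime_of_mem_primesLE hp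
    exact mul_le_mul_of_nonneg_left
      (mul_le_mul_of_nonneg_right (D.right_le p hpp) (Real.log_natCast_nonneg p)) (D.nonneg p hpp)
  refine ⟨B₁ + B₂ + (κ + C) ^ 2 * K, by positivity, fun R hR i j => ⟨?_, ?_⟩⟩
  · refine (powerSum_recursion hR D.nonneg (hKh R) (hB₁ R hR) j).trans ?_
    refine mul_le_mul_of_nonneg_right (by linarith) ?_
    exact Finset.sum_nonneg fun s hs => mul_nonneg
      (Finset.prod_nonneg fun q hq => D.nonneg q (prime_of_mem_primeSets hs hq))
      (pow_nonneg (sub_nonneg.2 (logSum_le_log hs)) _)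
  · refine (mixedSum_recursion hR D.left_nonneg D.right_nonneg D.add_eq (hKβ R)
      (hB₂ R hR) i j).trans ?_
    refine mul_le_mul_of_nonneg_right (mul_le_mul_of_nonneg_left (by linarith)
      (pow_nonneg (Real.log_natCast_nonneg R) _)) ?_
    exact Finset.sum_nonneg fun s hs => mul_nonneg
      (Finset.prod_nonneg fun q hq => D.nonneg q (prime_of_mem_primeSets hs hq))
      (pow_nonneg (sub_nonneg.2 (logSum_le_log hs)) _)

lemma one_le_powerSum_zero (D : SieveDensity h α β κ C) {R : ℕ} (hR : 1 ≤ R) :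
    1 ≤ powerSum h R 0 := by
  have h1 := Finset.single_le_sum (f := fun s => (∏ p ∈ s, h p) * (Real.log R - logSum s) ^ 0)
    (fun s hs => mul_nonneg
      (Finset.prod_nonneg fun q hq => D.nonneg q (prime_of_mem_primeSets hs hq)) (by simp))
    (empty_mem_primeSets hR)
  simpa [powerSum] using h1

/-- The normalised power sums converge. -/
lemma tendsto_powerSum (D : SieveDensity h α β κ C) (j : ℕ) :
    Tendsto (fun R : ℕ => powerSum h R j / (Real.log R ^ j * powerSum h R 0)) atTop
      (nhds (∏ i ∈ Finset.range j, ((i : ℝ) + 1) / (i + 1 + κ))) := by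
  obtain ⟨E, hE0, hE⟩ := D.exists_recursion_bounds
  have hlog : Tendsto (fun R : ℕ => Real.log R) atTop atTop :=
    Real.tendsto_log_atTop.comp tendsto_natCast_atTop_atTop
  induction j with
  | zero =>
    simp only [pow_zero, one_mul, Finset.range_zero, Finset.prod_empty]
    refine tendsto_const_nhds.congr' ?_
    filter_upwards [eventually_ge_atTop 1] with R hR
    have := D.one_le_powerSum_zero hR
    rw [div_self (by linarith)]
  | succ j ih =>
    have hκ := D.dim_nonneg
    have hz : Tendsto (fun R : ℕ => powerSum h R j / (Real.log R ^ j * powerSum h R 0) -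
        (1 + κ / (j + 1)) * (powerSum h R (j + 1) / (Real.log R ^ (j + 1) * powerSum h R 0)))
        atTop (nhds 0) := by
      have hbd : Tendsto (fun R : ℕ => E * (powerSum h R j / (Real.log R ^ j * powerSum h R 0)) *
          (Real.log R)⁻¹) atTop (nhds 0) := by
        have := (ih.const_mul E).mul (tendsto_inv_atTop_zero.comp hlog)
        rw [mul_zero] at this
        exact this
      refine squeeze_zero_norm' ?_ hbd
      filter_upwards [eventually_ge_atTop 1, hlog.eventually_gt_atTop 0] with R hR hL
      have hS := D.one_le_powerSum_zero hR
      have hS0 : 0 < powerSum h R 0 := by linarith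
      have h1 := (hE R hR 0 j).1
      have h2 : powerSum h R j / (Real.log R ^ j * powerSum h R 0) -
        (1 + κ / (j + 1)) * (powerSum h R (j + 1) / (Real.log R ^ (j + 1) * powerSum h R 0)) =
          (Real.log R * powerSum h R j - powerSum h R (j + 1) -
            κ / (j + 1) * powerSum h R (j + 1)) / (Real.log R ^ (j + 1) * powerSum h R 0) := by
        field_simp
        ring
      rw [h2, norm_div, Real.norm_eq_abs, Real.norm_eq_abs,
        abs_of_pos (show 0 < Real.log R ^ (j + 1) * powerSum h R 0 by positivity)]
      refine (div_le_div_of_nonneg_right h1 (by positivity)).trans_eq ?_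
      field_simp
      ring
    -- The recursion reads `(1 + κ/(j+1)) S_{j+1} = S_j + o(1)` for the normalised sums `S_j`, so
    -- each step contributes `(j+1)/(j+1+κ)`.
    have h3 := (ih.sub hz).mul_const (((j : ℝ) + 1) / (j + 1 + κ))
    rw [sub_zero, ← Finset.prod_range_succ] at h3
    refine h3.congr fun R => ?_
    have : (j : ℝ) + 1 + κ ≠ 0 := by positivity
    field_simp
    ring

/-- The exponent `i` is traded for `j`: up to lower order the `(i+1, j)` sum is `(j+2)/(j+1)` times
the `(i, j+1)` sum. These factors telescope to `(i+j+1)/(j+1)`, and at `i = 0` the splitting sum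
collapses to `powerSum` because `α + β = h`. -/
lemma tendsto_mixedSum (D : SieveDensity h α β κ C) (i : ℕ) : ∀ j : ℕ,
    Tendsto (fun R : ℕ => mixedSum α β R i j / (Real.log R ^ (i + j) * powerSum h R 0)) atTop
      (nhds (((i : ℝ) + j + 1) / (j + 1) *
        ∏ l ∈ Finset.range (i + j), ((l : ℝ) + 1) / (l + 1 + κ))) := by
  obtain ⟨E, hE0, hE⟩ := D.exists_recursion_bounds
  have hlog : Tendsto (fun R : ℕ => Real.log R) atTop atTop :=
    Real.tendsto_log_atTop.comp tendsto_natCast_atTop_atTop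
  induction i with
  | zero =>
    intro j
    have h1 := D.tendsto_powerSum j
    have h2 : ((0 : ℕ) : ℝ) + j + 1 = j + 1 := by push_cast; ring
    rw [h2, div_self (by positivity), one_mul, zero_add]
    simpa only [mixedSum_zero D.add_eq] using h1
  | succ i ih =>
    intro j
    have hz : Tendsto (fun R : ℕ =>
        mixedSum α β R (i + 1) j / (Real.log R ^ (i + 1 + j) * powerSum h R 0) -
        (1 + 1 / ((j : ℝ) + 1)) *
          (mixedSum α β R i (j + 1) / (Real.log R ^ (i + (j + 1)) * powerSum h R 0)))
        atTop (nhds 0) := by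
      have hbd : Tendsto (fun R : ℕ => E * (powerSum h R j / (Real.log R ^ j * powerSum h R 0)) *
          (Real.log R)⁻¹) atTop (nhds 0) := by
        have := ((D.tendsto_powerSum j).const_mul E).mul (tendsto_inv_atTop_zero.comp hlog)
        rw [mul_zero] at this
        exact this
      refine squeeze_zero_norm' ?_ hbd
      filter_upwards [eventually_ge_atTop 1, hlog.eventually_gt_atTop 0] with R hR hL
      have hS := D.one_le_powerSum_zero hR
      have hS0 : 0 < powerSum h R 0 := by linarith
      have h1 := (hE R hR i j).2
      have hexp : i + 1 + j = i + (j + 1) := by ring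
      rw [hexp]
      have h2 : mixedSum α β R (i + 1) j / (Real.log R ^ (i + (j + 1)) * powerSum h R 0) -
        (1 + 1 / ((j : ℝ) + 1)) *
          (mixedSum α β R i (j + 1) / (Real.log R ^ (i + (j + 1)) * powerSum h R 0)) =
          (mixedSum α β R (i + 1) j - mixedSum α β R i (j + 1) -
            1 / (j + 1) * mixedSum α β R i (j + 1)) /
              (Real.log R ^ (i + (j + 1)) * powerSum h R 0) := by
        ring
      rw [h2, norm_div, Real.norm_eq_abs, Real.norm_eq_abs,
        abs_of_pos (show 0 < Real.log R ^ (i + (j + 1)) * powerSum h R 0 by positivity)]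
      refine (div_le_div_of_nonneg_right h1 (by positivity)).trans_eq ?_
      rw [pow_add, pow_succ]
      field_simp
    have h3 := hz.add ((ih (j + 1)).const_mul (1 + 1 / ((j : ℝ) + 1)))
    simp only [sub_add_cancel] at h3
    have hexp : i + (j + 1) = i + 1 + j := by ring
    rw [hexp] at h3
    convert h3 using 2
    push_cast
    rw [zero_add, ← mul_assoc]
    congr 1
    have : (j : ℝ) + 1 + 1 ≠ 0 := by positivity
    field_simp
    ring

end SieveDensity

end MainTermAsymptotics

/-! ### An elementary lower bound for sums with weight `1/φ` -/

section LowerBound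

lemma sum_inv_le_prod_of_mem_factoredNumbers {s T : Finset ℕ} (hs : ∀ p ∈ s, p.Prime)
    (hT : ∀ n ∈ T, n ∈ Nat.factoredNumbers s) :
    ∑ n ∈ T, (n : ℝ)⁻¹ ≤ ∏ p ∈ s, (1 - (p : ℝ)⁻¹)⁻¹ := by
  let f : ℕ →* ℝ := ⟨⟨fun n => (n : ℝ)⁻¹, by simp⟩, fun m n => by simp [mul_comm]⟩
  have hf : ∀ {p : ℕ}, p.Prime → ‖f p‖ < 1 := by
    intro p hp
    have h1 : (1 : ℝ) < p := by exact_mod_cast hp.one_lt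
    change ‖(p : ℝ)⁻¹‖ < 1
    rw [norm_inv, Real.norm_natCast]
    exact inv_lt_one_of_one_lt₀ h1
  have h1 := (EulerProduct.summable_and_hasSum_factoredNumbers_prod_filter_prime_geometric hf s).2
  rw [Finset.filter_true_of_mem hs] at h1
  have h2 := sum_le_hasSum (T.subtype (· ∈ Nat.factoredNumbers s))
    (fun n _ => inv_nonneg.2 (Nat.cast_nonneg (n : ℕ))) h1
  refine le_trans (le_of_eq ?_) h2
  exact (Finset.sum_subtype_of_mem (fun n : ℕ => (n : ℝ)⁻¹) hT).symm

/-- Compare with the integral of `b - log t` against `dt/t`: with `u = b - log n` and `δ = log(n+1)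
- log n ≤ 1/n`, the drop of `u²/2` is at most `uδ ≤ u/n`. At `n = X` the remaining `u²/2` is covered
since `u ≤ 1/X`. -/
lemma sq_half_le_sum_sub_log_div {X : ℕ} (hX : 1 ≤ X) {b : ℝ} (hXb : Real.log X ≤ b)
    (hbX : b ≤ Real.log (X + 1)) :
    b ^ 2 / 2 ≤ ∑ n ∈ Finset.Icc 1 X, (b - Real.log n) / n := by
  have hlog : ∀ n : ℕ, 1 ≤ n → Real.log (n + 1) - Real.log n ≤ 1 / n := by
    intro n hn
    have hn0 : (0 : ℝ) < n := by exact_mod_cast hn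
    rw [← Real.log_div (by positivity) hn0.ne']
    refine (Real.log_le_sub_one_of_pos (by positivity)).trans_eq ?_
    field_simp
    ring
  obtain ⟨Y, rfl⟩ : ∃ Y, X = Y + 1 := ⟨X - 1, by omega⟩
  have htel : ∀ M : ℕ, M ≤ Y → b ^ 2 / 2 - (b - Real.log (M + 1 : ℕ)) ^ 2 / 2 ≤
      ∑ n ∈ Finset.Icc 1 M, (b - Real.log n) / n := by
    intro M
    induction M with
    | zero => simp
    | succ M ih =>
      intro hM
      rw [Finset.sum_Icc_succ_top (by omega)]
      have h1 := ih (by omega)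
      have h2 := hlog (M + 1) (by omega)
      have h0 : (0 : ℝ) < (M + 1 : ℕ) := by positivity
      have hd : 0 ≤ Real.log (((M + 1 : ℕ) : ℝ) + 1) - Real.log (M + 1 : ℕ) :=
        sub_nonneg.2 (Real.log_le_log h0 (by linarith))
      have hu : 0 ≤ b - Real.log (M + 1 : ℕ) := by
        have : Real.log (M + 1 : ℕ) ≤ Real.log (Y + 1 : ℕ) :=
          Real.log_le_log h0 (by exact_mod_cast (by omega : M + 1 ≤ Y + 1))
        linarith
      have h3 : (((M + 1 + 1 : ℕ)) : ℝ) = ((M + 1 : ℕ) : ℝ) + 1 := by push_cast; ring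
      rw [h3]
      set δ := Real.log (((M + 1 : ℕ) : ℝ) + 1) - Real.log (M + 1 : ℕ) with hδ
      set u := b - Real.log (M + 1 : ℕ) with hu'
      have h4 : b - Real.log (((M + 1 : ℕ) : ℝ) + 1) = u - δ := by rw [hδ, hu']; ring
      rw [h4]
      have h5 : u * δ ≤ u / (M + 1 : ℕ) := by
        rw [div_eq_mul_one_div]; exact mul_le_mul_of_nonneg_left h2 hu
      nlinarith [sq_nonneg δ]
  rw [Finset.sum_Icc_succ_top (by omega)]
  have h1 := htel Y le_rfl
  have h2 := hlog (Y + 1) (by omega)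
  have hu : 0 ≤ b - Real.log (Y + 1 : ℕ) := by linarith
  have h5 : (b - Real.log (Y + 1 : ℕ)) * (b - Real.log (Y + 1 : ℕ)) ≤
      (b - Real.log (Y + 1 : ℕ)) / (Y + 1 : ℕ) := by
    rw [div_eq_mul_one_div (b - Real.log (Y + 1 : ℕ))]
    exact mul_le_mul_of_nonneg_left (by linarith) hu
  nlinarith

lemma le_sum_Icc_inv {X : ℕ} {b : ℝ} (hbX : b ≤ Real.log (X + 1)) :
    b ≤ ∑ n ∈ Finset.Icc 1 X, (n : ℝ)⁻¹ := by
  have h := log_add_one_le_harmonic X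
  rw [harmonic_eq_sum_Icc] at h
  push_cast at h
  linarith

/-- Writing each `m` with weight `1/φ(m)` as the kernel of integers `n` with weight `1/n`. -/
lemma sum_Icc_le_prod_mul_sum_primeSets {R : ℕ} {r : Finset ℕ} (hr : r ∈ primeSets R) {G : ℝ → ℝ}
    (hG : MonotoneOn G (Set.Ici 0)) (hG0 : 0 ≤ G 0) :
    ∑ n ∈ Finset.Icc 1 (R / ∏ p ∈ r, p), G (Real.log R - logSum r - Real.log n) * (n : ℝ)⁻¹ ≤
      (∏ p ∈ r, (p : ℝ) / (p - 1)) * ∑ s ∈ primeSets R with r ⊆ s,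
        G (Real.log R - logSum s) * ∏ p ∈ s \ r, ((p : ℝ) - 1)⁻¹ := by
  have hrp := (mem_primeSets.1 hr).1
  have hr0 := prod_pos_of_forall_prime hrp
  have hpf : ∀ n : ℕ, ∀ p ∈ r ∪ n.primeFactors, p.Prime := by
    intro n p hp
    rcases Finset.mem_union.1 hp with hp | hp
    · exact hrp p hp
    · exact Nat.prime_of_mem_primeFactors hp
  have hprod : ∀ n : ℕ, 1 ≤ n → ∏ p ∈ r ∪ n.primeFactors, p ≤ (∏ p ∈ r, p) * n := by
    intro n hn
    have h1 : ∏ p ∈ r ∪ n.primeFactors, p ≤ (∏ p ∈ r, p) * ∏ p ∈ n.primeFactors, p := by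
      rw [← Finset.prod_union_inter]
      refine Nat.le_mul_of_pos_right _ (prod_pos_of_forall_prime fun p hp => ?_)
      exact hrp p (Finset.mem_inter.1 hp).1
    exact h1.trans (Nat.mul_le_mul_left _ (Nat.le_of_dvd hn (Nat.prod_primeFactors_dvd n)))
  -- Each integer `n ≤ R/r` is sent to the squarefree kernel `s` of `rn`. Since `s ≤ rn`, the
  -- increasing `G` can only grow, and no coprimality condition between `n` and `r` is needed.
  have hmem : ∀ n ∈ Finset.Icc 1 (R / ∏ p ∈ r, p),
      r ∪ n.primeFactors ∈ (primeSets R).filter (fun s => r ⊆ s) := by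
    intro n hn
    rw [Finset.mem_Icc, Nat.le_div_iff_mul_le hr0] at hn
    refine Finset.mem_filter.2 ⟨mem_primeSets.2 ⟨hpf n, ?_⟩, Finset.subset_union_left⟩
    rw [mul_comm] at hn
    exact (hprod n hn.1).trans hn.2
  have hGn : ∀ n ∈ Finset.Icc 1 (R / ∏ p ∈ r, p),
      G (Real.log R - logSum r - Real.log n) * (n : ℝ)⁻¹ ≤
        G (Real.log R - logSum (r ∪ n.primeFactors)) * (n : ℝ)⁻¹ := by
    intro n hn
    have hn' := hn
    rw [Finset.mem_Icc, Nat.le_div_iff_mul_le hr0] at hn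
    have hn0 : (0 : ℝ) < n := by exact_mod_cast hn.1
    have hr0' : (0 : ℝ) < (∏ p ∈ r, p : ℕ) := by exact_mod_cast hr0
    have h1 : logSum r + Real.log n ≤ Real.log R := by
      rw [logSum_eq_log_prod hrp, ← Real.log_mul hr0'.ne' hn0.ne']
      refine Real.log_le_log (by positivity) ?_
      rw [mul_comm]; exact_mod_cast hn.2
    have h2 : logSum (r ∪ n.primeFactors) ≤ logSum r + Real.log n := by
      rw [logSum_eq_log_prod (hpf n), logSum_eq_log_prod hrp, ← Real.log_mul hr0'.ne' hn0.ne']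
      refine Real.log_le_log (by exact_mod_cast prod_pos_of_forall_prime (hpf n)) ?_
      exact_mod_cast hprod n hn.1
    refine mul_le_mul_of_nonneg_right (hG ?_ ?_ ?_) (by positivity)
    · simp only [Set.mem_Ici]; linarith
    · simp only [Set.mem_Ici]; linarith
    · linarith
  refine (Finset.sum_le_sum hGn).trans ?_
  rw [← Finset.sum_fiberwise_of_maps_to hmem, Finset.mul_sum]
  refine Finset.sum_le_sum fun s hs => ?_
  obtain ⟨hsF, hrs⟩ := Finset.mem_filter.1 hs
  have hsp := (mem_primeSets.1 hsF).1
  have hGs : 0 ≤ G (Real.log R - logSum s) := by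
    have h1 : 0 ≤ Real.log R - logSum s := sub_nonneg.2 (logSum_le_log hsF)
    exact hG0.trans (hG (Set.mem_Ici.2 le_rfl) (Set.mem_Ici.2 h1) h1)
  set T := (Finset.Icc 1 (R / ∏ p ∈ r, p)).filter (fun n => r ∪ n.primeFactors = s) with hT
  have h1 : ∑ n ∈ T, G (Real.log R - logSum (r ∪ n.primeFactors)) * (n : ℝ)⁻¹ =
      G (Real.log R - logSum s) * ∑ n ∈ T, (n : ℝ)⁻¹ := by
    rw [Finset.mul_sum]
    refine Finset.sum_congr rfl fun n hn => ?_
    rw [(Finset.mem_filter.1 hn).2]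
  rw [h1, mul_left_comm]
  refine mul_le_mul_of_nonneg_left ?_ hGs
  -- Every `n` over `s` is a multiple of `m`, with quotient composed of primes of `s`. Hence the
  -- fibre has `∑ 1/n ≤ m⁻¹ ∏_{p ∈ s} (1 - 1/p)⁻¹`, and this equals the weight of `s` on the
  -- right-hand side.
  set m := ∏ p ∈ s \ r, p with hm
  have hmp : ∀ p ∈ s \ r, p.Prime := fun p hp => hsp p (Finset.mem_sdiff.1 hp).1
  have hm0 : 0 < m := prod_pos_of_forall_prime hmp
  have hdvd : ∀ n ∈ T, m ∣ n := by
    intro n hn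
    have hns := (Finset.mem_filter.1 hn).2
    refine dvd_trans (Finset.prod_dvd_prod_of_subset _ _ _ ?_) (Nat.prod_primeFactors_dvd n)
    intro p hp
    rw [← hns, Finset.mem_sdiff, Finset.mem_union] at hp
    tauto
  have h2 : ∑ n ∈ T, (n : ℝ)⁻¹ = (m : ℝ)⁻¹ * ∑ n ∈ T.image (fun n => n / m), (n : ℝ)⁻¹ := by
    rw [Finset.sum_image, Finset.mul_sum]
    · refine Finset.sum_congr rfl fun n hn => ?_
      obtain ⟨c, rfl⟩ := hdvd n hn
      rw [Nat.mul_div_cancel_left _ hm0]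
      push_cast
      rw [mul_inv]
    · intro a ha b hb hab
      exact (Nat.div_left_inj (hdvd a ha) (hdvd b hb)).1 hab
  have h3 : ∑ n ∈ T.image (fun n => n / m), (n : ℝ)⁻¹ ≤ ∏ p ∈ s, (1 - (p : ℝ)⁻¹)⁻¹ := by
    refine sum_inv_le_prod_of_mem_factoredNumbers hsp fun n hn => ?_
    obtain ⟨a, ha, rfl⟩ := Finset.mem_image.1 hn
    have ha1 : 1 ≤ a := (Finset.mem_Icc.1 (Finset.mem_filter.1 ha).1).1
    have hadvd := hdvd a ha
    have hne : a / m ≠ 0 := by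
      have := Nat.div_pos (Nat.le_of_dvd ha1 hadvd) hm0
      omega
    refine Nat.mem_factoredNumbers_of_primeFactors_subset hne ?_
    rw [← (Finset.mem_filter.1 ha).2]
    exact (Nat.primeFactors_mono (Nat.div_dvd_of_dvd hadvd) (by omega)).trans
      Finset.subset_union_right
  rw [h2]
  refine (mul_le_mul_of_nonneg_left h3 (by positivity)).trans_eq ?_
  have hp0 : ∀ p ∈ s, (p : ℝ) ≠ 0 ∧ (p : ℝ) - 1 ≠ 0 := by
    intro p hp
    have : (1 : ℝ) < p := by exact_mod_cast (hsp p hp).one_lt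
    exact ⟨by linarith, by linarith⟩
  have h4 : ∏ p ∈ s, (1 - (p : ℝ)⁻¹)⁻¹ = ∏ p ∈ s, (p : ℝ) / (p - 1) := by
    refine Finset.prod_congr rfl fun p hp => ?_
    obtain ⟨h5, h6⟩ := hp0 p hp
    have : 1 - (p : ℝ)⁻¹ = (p - 1) / p := by field_simp
    rw [this, inv_div]
  rw [h4, ← Finset.prod_sdiff hrs, hm]
  push_cast
  rw [← Finset.prod_inv_distrib, ← mul_assoc, ← Finset.prod_mul_distrib, mul_comm]
  congr 1
  refine Finset.prod_congr rfl fun p hp => ?_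
  obtain ⟨h5, h6⟩ := hp0 p (Finset.mem_sdiff.1 hp).1
  field_simp

/-- The bounds `∑ 1/n ≥ b` and `∑ (b - log n)/n ≥ b²/2` over `n ≤ R/r`, with `b = log(R/r)`, are
transferred to squarefree numbers. The argument has no error term, so it is uniform in `r`. -/
lemma quadratic_le_prod_mul_sum_primeSets {R : ℕ} {r : Finset ℕ} (hr : r ∈ primeSets R) {a : ℝ}
    (ha : 0 ≤ a) :
    (Real.log R - logSum r) + a * (Real.log R - logSum r) ^ 2 / 2 ≤
      (∏ p ∈ r, (p : ℝ) / (p - 1)) * ∑ s ∈ primeSets R with r ⊆ s,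
        (1 + a * (Real.log R - logSum s)) * ∏ p ∈ s \ r, ((p : ℝ) - 1)⁻¹ := by
  have hr' := mem_primeSets.1 hr
  have hr0 := prod_pos_of_forall_prime hr'.1
  have hR : 1 ≤ R := (Nat.succ_le_of_lt hr0).trans hr'.2
  have hR0 : (0 : ℝ) < R := by exact_mod_cast hR
  have hr0' : (0 : ℝ) < (∏ p ∈ r, p : ℕ) := by exact_mod_cast hr0
  refine le_trans ?_ (sum_Icc_le_prod_mul_sum_primeSets hr (G := fun x => 1 + a * x) ?_ (by simp))
  · set X := R / ∏ p ∈ r, p with hX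
    have hX1 : 1 ≤ X := (Nat.le_div_iff_mul_le hr0).2 (by simpa using hr'.2)
    have hX0 : (0 : ℝ) < X := by exact_mod_cast hX1
    set b := Real.log R - logSum r with hb
    have hbeq : b = Real.log (R / (∏ p ∈ r, p : ℕ)) := by
      rw [Real.log_div hR0.ne' hr0'.ne', hb, logSum_eq_log_prod hr'.1]
    have hXb : Real.log X ≤ b := by
      rw [hbeq]
      exact Real.log_le_log hX0 Nat.cast_div_le
    have hbX : b ≤ Real.log (X + 1) := by
      rw [hbeq]
      refine Real.log_le_log (by positivity) ?_
      have := (Nat.lt_floor_add_one ((R : ℝ) / (∏ p ∈ r, p : ℕ))).le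
      rwa [Nat.floor_div_eq_div] at this
    have h1 := le_sum_Icc_inv hbX
    have h2 := mul_le_mul_of_nonneg_left (sq_half_le_sum_sub_log_div hX1 hXb hbX) ha
    have h3 : ∑ n ∈ Finset.Icc 1 X, (1 + a * (b - Real.log n)) * (n : ℝ)⁻¹ =
        ∑ n ∈ Finset.Icc 1 X, (n : ℝ)⁻¹ + a * ∑ n ∈ Finset.Icc 1 X, (b - Real.log n) / n := by
      rw [Finset.mul_sum, ← Finset.sum_add_distrib]
      exact Finset.sum_congr rfl fun n _ => by ring
    rw [h3]
    linarith
  · intro x _ y _ hxy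
    simp only
    linarith [mul_le_mul_of_nonneg_left hxy ha]

end LowerBound

/-! ### The local densities of the tuple and the comparison of the main terms -/

section LocalFactors

/-- The density of the integers lying in `ν p` residue classes modulo `p`. -/
noncomputable def localDensity (ν : ℕ → ℕ) (p : ℕ) : ℝ := (ν p : ℝ) / p

/-- The dual `ρ / (1 - ρ)` of the local density `ρ`. -/
noncomputable def localDual (ν : ℕ → ℕ) (p : ℕ) : ℝ := (ν p : ℝ) / (p - ν p)

/-- The density among reduced classes when one of the `ν p` classes is excluded. -/
noncomputable def reducedDensity (ν : ℕ → ℕ) (p : ℕ) : ℝ := ((ν p : ℝ) - 1) / (p - 1)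

/-- The dual of the reduced density. -/
noncomputable def reducedDual (ν : ℕ → ℕ) (p : ℕ) : ℝ := ((ν p : ℝ) - 1) / (p - ν p)

/-- The diagonal variables of the sieve. -/
noncomputable def diagonalVar (a : ℝ) (R : ℕ) (s : Finset ℕ) : ℝ :=
  1 + a / Real.log R * (Real.log R - logSum s)

/-- The sieve weights. -/
noncomputable def sieveWeight (ν : ℕ → ℕ) (a : ℝ) (R : ℕ) : Finset ℕ → ℝ :=
  selbergWeight (primeSets R) (localDensity ν) (localDual ν) (diagonalVar a R)

/-- The main term of the quadratic form for all integers. -/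
noncomputable def mainForm (ν : ℕ → ℕ) (a : ℝ) (R : ℕ) : ℝ :=
  ∑ d ∈ primeSets R, ∑ e ∈ primeSets R,
    sieveWeight ν a R d * sieveWeight ν a R e * ∏ p ∈ d ∪ e, localDensity ν p

/-- The main term of the quadratic form for primes. -/
noncomputable def primeForm (ν : ℕ → ℕ) (a : ℝ) (R : ℕ) : ℝ :=
  ∑ d ∈ primeSets R, ∑ e ∈ primeSets R,
    sieveWeight ν a R d * sieveWeight ν a R e * ∏ p ∈ d ∪ e, reducedDensity ν p

/-- `ν p` is the number of classes modulo `p` occupied by an admissible set of size `k`. -/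
structure AdmissibleCount (ν : ℕ → ℕ) (k P : ℕ) : Prop where
  pos : ∀ p, p.Prime → 1 ≤ ν p
  lt : ∀ p, p.Prime → ν p < p
  le : ∀ p, p.Prime → ν p ≤ k
  eq : ∀ p, p.Prime → P < p → ν p = k

namespace AdmissibleCount

variable {ν : ℕ → ℕ} {k P : ℕ}

lemma real_bounds (A : AdmissibleCount ν k P) {p : ℕ} (hp : p.Prime) :
    (1 : ℝ) ≤ ν p ∧ (ν p : ℝ) + 1 ≤ p ∧ (2 : ℝ) ≤ p := by
  refine ⟨by exact_mod_cast A.pos p hp, ?_, by exact_mod_cast hp.two_le⟩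
  exact_mod_cast A.lt p hp

lemma localDual_pos (A : AdmissibleCount ν k P) {p : ℕ} (hp : p.Prime) : 0 < localDual ν p := by
  obtain ⟨h1, h2, h3⟩ := A.real_bounds hp
  exact div_pos (by linarith) (by linarith)

lemma localDensity_pos (A : AdmissibleCount ν k P) {p : ℕ} (hp : p.Prime) :
    0 < localDensity ν p := by
  obtain ⟨h1, h2, h3⟩ := A.real_bounds hp
  exact div_pos (by linarith) (by linarith)

lemma sieveDensity (A : AdmissibleCount ν k P) :
    ∃ C : ℝ, SieveDensity (localDual ν) (fun p => reducedDual ν p * ((p : ℝ) / (p - 1)))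
      (fun p => ((p : ℝ) - 1)⁻¹) k C := by
  -- The terms cover, in order: primes `p > P + 2k`, where `ν p = k` and `p - k ≥ p/2`; smaller
  -- primes, where the difference is at most `k`; and `1/(p(p-1)) ≤ 2/p²` for the factor of
  -- dimension one.
  refine ⟨2 * k ^ 2 + k * ((P : ℝ) + 2 * k) ^ 2 + 2, ?_⟩
  refine ⟨Nat.cast_nonneg k, by positivity, fun p hp => ?_, fun p hp => ?_, fun p hp => ?_,
    fun p hp => ?_, fun p hp => ?_⟩
  · obtain ⟨h1, h2, h3⟩ := A.real_bounds hp
    exact mul_nonneg (div_nonneg (by linarith) (by linarith))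
      (div_nonneg (by linarith) (by linarith))
  · obtain ⟨h1, h2, h3⟩ := A.real_bounds hp
    exact inv_nonneg.2 (by linarith)
  · obtain ⟨h1, h2, h3⟩ := A.real_bounds hp
    have h4 : (p : ℝ) - 1 ≠ 0 := by linarith
    have h5 : (p : ℝ) - ν p ≠ 0 := by linarith
    rw [reducedDual, localDual]
    field_simp
    ring
  · obtain ⟨h1, h2, h3⟩ := A.real_bounds hp
    have hk0 : (0 : ℝ) ≤ k := Nat.cast_nonneg k
    have hP0 : (0 : ℝ) ≤ P := Nat.cast_nonneg P
    have hp2 : (0 : ℝ) < (p : ℝ) ^ 2 := by positivity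
    have hνk : (ν p : ℝ) ≤ k := by exact_mod_cast A.le p hp
    rw [localDual]
    by_cases hbig : (P : ℝ) + 2 * k < p
    · have hν : ν p = k := A.eq p hp (by
        have : (P : ℝ) < p := by linarith
        exact_mod_cast this)
      rw [hν]
      have h5 : (p : ℝ) - k ≠ 0 := by linarith
      have h6 : (k : ℝ) / (p - k) - k / p = k ^ 2 / (p * (p - k)) := by
        field_simp
        ring
      have h7 : (0 : ℝ) < p * (p - k) := mul_pos (by linarith) (by linarith)
      rw [h6, abs_of_nonneg (div_nonneg (sq_nonneg _) h7.le), div_le_div_iff₀ h7 hp2]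
      have h8 : (p : ℝ) ^ 2 ≤ 2 * (p * (p - k)) := by nlinarith
      have h9 : (0 : ℝ) ≤ k * ((P : ℝ) + 2 * k) ^ 2 + 2 := by positivity
      calc (k : ℝ) ^ 2 * (p : ℝ) ^ 2 ≤ k ^ 2 * (2 * (p * (p - k))) :=
            mul_le_mul_of_nonneg_left h8 (sq_nonneg _)
        _ = 2 * k ^ 2 * (p * (p - k)) := by ring
        _ ≤ _ := mul_le_mul_of_nonneg_right (by linarith) h7.le
    · push Not at hbig
      have h4 : (ν p : ℝ) / (p - ν p) ≤ k := by
        rw [div_le_iff₀ (by linarith)]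
        nlinarith
      have h5 : (0 : ℝ) ≤ (ν p : ℝ) / (p - ν p) := div_nonneg (by linarith) (by linarith)
      have h6 : (k : ℝ) / p ≤ k := div_le_self hk0 (by linarith)
      have h7 : (0 : ℝ) ≤ (k : ℝ) / p := by positivity
      have h8 : |(ν p : ℝ) / (p - ν p) - k / p| ≤ k := by
        rw [abs_le]; constructor <;> linarith
      refine h8.trans ?_
      rw [le_div_iff₀ hp2]
      have h9 : (p : ℝ) ^ 2 ≤ ((P : ℝ) + 2 * k) ^ 2 := pow_le_pow_left₀ (by linarith) hbig 2
      have h10 := mul_le_mul_of_nonneg_left h9 hk0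
      nlinarith
  · obtain ⟨h1, h2, h3⟩ := A.real_bounds hp
    have hp2 : (0 : ℝ) < (p : ℝ) ^ 2 := by positivity
    have h4 : (p : ℝ) - 1 ≠ 0 := by linarith
    have h6 : ((p : ℝ) - 1)⁻¹ - 1 / p = 1 / (p * (p - 1)) := by
      field_simp
      ring
    have h7 : (0 : ℝ) < p * (p - 1) := mul_pos (by linarith) (by linarith)
    rw [h6, abs_of_nonneg (by positivity), div_le_div_iff₀ h7 hp2]
    have h8 : (0 : ℝ) ≤ 2 * (k : ℝ) ^ 2 + k * ((P : ℝ) + 2 * k) ^ 2 := by positivity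
    nlinarith [mul_nonneg h8 h7.le]

lemma mainForm_eq (A : AdmissibleCount ν k P) (a : ℝ) (R : ℕ) :
    mainForm ν a R = ∑ s ∈ primeSets R, (∏ p ∈ s, localDual ν p) * diagonalVar a R s ^ 2 := by
  refine quadraticForm_selbergWeight_self primeSets_down
    (fun s hs p hp => (A.localDensity_pos (prime_of_mem_primeSets hs hp)).ne')
    (fun s hs p hp => (A.localDual_pos (prime_of_mem_primeSets hs hp)).ne')
    (fun s hs p hp => ?_) _
  obtain ⟨h1, h2, h3⟩ := A.real_bounds (prime_of_mem_primeSets hs hp)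
  rw [localDensity, localDual, inv_div, inv_div]
  have : (ν p : ℝ) ≠ 0 := by linarith
  field_simp
  ring

lemma primeForm_eq (A : AdmissibleCount ν k P) (a : ℝ) (R : ℕ) :
    primeForm ν a R = ∑ r ∈ primeSets R, (∏ p ∈ r, reducedDual ν p) *
      ((∏ p ∈ r, (p : ℝ) / (p - 1)) * ∑ s ∈ primeSets R with r ⊆ s,
        diagonalVar a R s * ∏ p ∈ s \ r, ((p : ℝ) - 1)⁻¹) ^ 2 := by
  refine quadraticForm_selbergWeight primeSets_down (fun s hs p hp hne => ?_)
    (fun s hs p hp => ?_) (fun s hs p hp => ?_) _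
  · obtain ⟨h1, h2, h3⟩ := A.real_bounds (prime_of_mem_primeSets hs hp)
    rw [reducedDensity] at hne ⊢
    rw [reducedDual, inv_div, inv_div]
    have h4 : (ν p : ℝ) - 1 ≠ 0 := fun h0 => hne (by rw [h0, zero_div])
    field_simp
    ring
  · obtain ⟨h1, h2, h3⟩ := A.real_bounds (prime_of_mem_primeSets hs hp)
    rw [reducedDensity, reducedDual, localDensity, localDual]
    have h4 : (ν p : ℝ) ≠ 0 := by linarith
    have h5 : (p : ℝ) - 1 ≠ 0 := by linarith
    have h6 : (p : ℝ) - ν p ≠ 0 := by linarith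
    have h7 : (p : ℝ) ≠ 0 := by linarith
    field_simp
  · obtain ⟨h1, h2, h3⟩ := A.real_bounds (prime_of_mem_primeSets hs hp)
    rw [reducedDensity, localDensity, localDual]
    have h4 : (ν p : ℝ) ≠ 0 := by linarith
    have h5 : (p : ℝ) - 1 ≠ 0 := by linarith
    have h6 : (p : ℝ) - ν p ≠ 0 := by linarith
    have h7 : (p : ℝ) ≠ 0 := by linarith
    field_simp
    ring

lemma mainForm_eq_powerSum (A : AdmissibleCount ν k P) (a : ℝ) (R : ℕ) :
    mainForm ν a R = powerSum (localDual ν) R 0 +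
      2 * (a / Real.log R) * powerSum (localDual ν) R 1 +
      (a / Real.log R) ^ 2 * powerSum (localDual ν) R 2 := by
  rw [A.mainForm_eq]
  simp only [powerSum, Finset.mul_sum, ← Finset.sum_add_distrib]
  refine Finset.sum_congr rfl fun s _ => ?_
  rw [diagonalVar]
  ring

/-- In `Y_r²` one factor is bounded below by `Q_r` and the other is opened as a sum over `s ⊇ r`.
Exchanging the sums leaves splittings of `s`, hence `mixedSum`; the four terms come from the product
of the linear `y_s` and the quadratic `Q_r`. -/
lemma le_primeForm (A : AdmissibleCount ν k P) {a : ℝ} (ha : 0 ≤ a) (R : ℕ) :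
    let α := fun p : ℕ => reducedDual ν p * ((p : ℝ) / (p - 1))
    let β := fun p : ℕ => ((p : ℝ) - 1)⁻¹
    mixedSum α β R 1 0 + a / Real.log R * (mixedSum α β R 1 1 + mixedSum α β R 2 0 / 2) +
      (a / Real.log R) ^ 2 * (mixedSum α β R 2 1 / 2) ≤ primeForm ν a R := by
  intro α β
  rw [A.primeForm_eq]
  set Y : Finset ℕ → ℝ := fun r => (∏ p ∈ r, (p : ℝ) / (p - 1)) *
    ∑ s ∈ primeSets R with r ⊆ s, diagonalVar a R s * ∏ p ∈ s \ r, ((p : ℝ) - 1)⁻¹ with hY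
  set Q : Finset ℕ → ℝ := fun r => (Real.log R - logSum r) +
    a / Real.log R * (Real.log R - logSum r) ^ 2 / 2 with hQ
  have ha' : 0 ≤ a / Real.log R := div_nonneg ha (Real.log_natCast_nonneg R)
  have h1 : ∑ r ∈ primeSets R, (∏ p ∈ r, reducedDual ν p) * (Y r * Q r) ≤
      ∑ r ∈ primeSets R, (∏ p ∈ r, reducedDual ν p) * Y r ^ 2 := by
    refine Finset.sum_le_sum fun r hr => mul_le_mul_of_nonneg_left ?_ ?_
    · have h2 : Q r ≤ Y r := quadratic_le_prod_mul_sum_primeSets hr ha'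
      have h3 : 0 ≤ Q r := by
        have := sub_nonneg.2 (logSum_le_log hr)
        positivity
      rw [pow_two]
      exact mul_le_mul_of_nonneg_left h2 (h3.trans h2)
    · refine Finset.prod_nonneg fun p hp => ?_
      obtain ⟨h1, h2, h3⟩ := A.real_bounds (prime_of_mem_primeSets hr hp)
      exact div_nonneg (by linarith) (by linarith)
  refine le_trans (le_of_eq ?_) h1
  have h2 : ∑ r ∈ primeSets R, (∏ p ∈ r, reducedDual ν p) * (Y r * Q r) =
      ∑ s ∈ primeSets R, ∑ r ∈ s.powerset, (∏ p ∈ r, α p) * (∏ p ∈ s \ r, β p) *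
        (diagonalVar a R s * Q r) := by
    have h3 : ∀ r ∈ primeSets R, (∏ p ∈ r, reducedDual ν p) * (Y r * Q r) =
        ∑ s ∈ primeSets R with r ⊆ s, (∏ p ∈ r, α p) * (∏ p ∈ s \ r, β p) *
          (diagonalVar a R s * Q r) := by
      intro r _
      simp only [hY, α, β, Finset.prod_mul_distrib]
      rw [mul_assoc, Finset.sum_mul, Finset.mul_sum, Finset.mul_sum]
      exact Finset.sum_congr rfl fun s _ => by ring
    rw [Finset.sum_congr rfl h3]
    refine Finset.sum_comm' fun r s => ?_
    simp only [Finset.mem_filter, Finset.mem_powerset]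
    exact ⟨fun h => ⟨h.2.2, h.2.1⟩, fun h => ⟨primeSets_down s h.2 r h.1, h.2, h.1⟩⟩
  rw [h2]
  simp only [mixedSum, splitSum, Finset.sum_mul, Finset.mul_sum, Finset.sum_div,
    ← Finset.sum_add_distrib]
  refine Finset.sum_congr rfl fun s _ => Finset.sum_congr rfl fun r _ => ?_
  simp only [hQ, diagonalVar]
  ring

lemma one_le_mainForm (A : AdmissibleCount ν k P) {a : ℝ} (ha : 0 ≤ a) {R : ℕ} (hR : 1 ≤ R) :
    1 ≤ mainForm ν a R := by
  rw [A.mainForm_eq]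
  have h1 := Finset.single_le_sum
    (f := fun s => (∏ p ∈ s, localDual ν p) * diagonalVar a R s ^ 2)
    (fun s hs => mul_nonneg (Finset.prod_nonneg fun q hq =>
      (A.localDual_pos (prime_of_mem_primeSets hs hq)).le) (sq_nonneg _))
    (empty_mem_primeSets hR)
  refine le_trans ?_ h1
  have h2 : 0 ≤ a / Real.log R * (Real.log R - logSum ∅) := by
    refine mul_nonneg (div_nonneg ha (Real.log_natCast_nonneg R)) ?_
    simpa [logSum] using Real.log_natCast_nonneg R
  simp only [Finset.prod_empty, one_mul, diagonalVar]
  nlinarith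

/-- The main terms compare as in the work of Goldston, Pintz and Yıldırım. -/
lemma eventually_mul_mainForm_le (A : AdmissibleCount ν k P) {a μ : ℝ} (ha : 0 ≤ a)
    (hμ : μ * (1 + 2 * a / (k + 1) + 2 * a ^ 2 / ((k + 1) * (k + 2))) <
      2 / (k + 1) + 6 * a / ((k + 1) * (k + 2)) + 6 * a ^ 2 / ((k + 1) * (k + 2) * (k + 3))) :
    ∀ᶠ R : ℕ in atTop, μ * (Real.log R * mainForm ν a R) ≤ primeForm ν a R := by
  obtain ⟨C, D⟩ := A.sieveDensity
  have hlog : Tendsto (fun R : ℕ => Real.log R) atTop atTop :=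
    Real.tendsto_log_atTop.comp tendsto_natCast_atTop_atTop
  have p1 := D.tendsto_powerSum 1
  have p2 := D.tendsto_powerSum 2
  have m10 := D.tendsto_mixedSum 1 0
  have m11 := D.tendsto_mixedSum 1 1
  have m20 := D.tendsto_mixedSum 2 0
  have m21 := D.tendsto_mixedSum 2 1
  simp only [Nat.reduceAdd, Finset.prod_range_succ, Finset.range_zero, Finset.prod_empty]
    at p1 p2 m10 m11 m20 m21
  set α := fun p : ℕ => reducedDual ν p * ((p : ℝ) / (p - 1)) with hα
  set β := fun p : ℕ => ((p : ℝ) - 1)⁻¹ with hβ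
  have hlow := ((m10.add ((m11.add (m20.div_const 2)).const_mul a)).add
    ((m21.div_const 2).const_mul (a ^ 2)))
  have hup := ((p1.const_mul (2 * a)).add (p2.const_mul (a ^ 2))).const_add 1
  -- Divided by `log R · S₀`, the inequality becomes one between limits, which `hμ` makes strict.
  have hlim := (hup.const_mul μ).sub hlow
  have hneg := hlim.eventually_lt_const (u := 0) (by
    rw [sub_neg]
    refine lt_of_eq_of_lt ?_ (lt_of_lt_of_eq hμ ?_)
    · push_cast
      field_simp
      ring
    · push_cast
      field_simp
      ring)
  filter_upwards [hneg, eventually_ge_atTop 1, hlog.eventually_gt_atTop 0] with R hR hR1 hL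
  have hS := D.one_le_powerSum_zero hR1
  have hS0 : 0 < powerSum (localDual ν) R 0 := by linarith
  refine le_trans ?_ (A.le_primeForm ha R)
  rw [A.mainForm_eq_powerSum]
  have hpos : 0 < Real.log R * powerSum (localDual ν) R 0 := by positivity
  have h1 := mul_neg_of_pos_of_neg hpos hR
  have h2 : Real.log R * powerSum (localDual ν) R 0 *
      (μ * (1 + (2 * a * (powerSum (localDual ν) R 1 /
          (Real.log R ^ 1 * powerSum (localDual ν) R 0)) +
        a ^ 2 * (powerSum (localDual ν) R 2 / (Real.log R ^ 2 * powerSum (localDual ν) R 0)))) -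
      (mixedSum α β R 1 0 / (Real.log R ^ 1 * powerSum (localDual ν) R 0) +
        a * (mixedSum α β R 1 1 / (Real.log R ^ 2 * powerSum (localDual ν) R 0) +
          mixedSum α β R 2 0 / (Real.log R ^ 2 * powerSum (localDual ν) R 0) / 2) +
        a ^ 2 * (mixedSum α β R 2 1 / (Real.log R ^ 3 * powerSum (localDual ν) R 0) / 2))) =
      μ * (Real.log R * (powerSum (localDual ν) R 0 +
        2 * (a / Real.log R) * powerSum (localDual ν) R 1 +
        (a / Real.log R) ^ 2 * powerSum (localDual ν) R 2)) -
      (mixedSum α β R 1 0 + a / Real.log R * (mixedSum α β R 1 1 + mixedSum α β R 2 0 / 2) +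
        (a / Real.log R) ^ 2 * (mixedSum α β R 2 1 / 2)) := by
    field_simp
    ring
  rw [h2] at h1
  linarith

end AdmissibleCount

end LocalFactors

/-! ### Counting in residue classes -/

section Counting

/-- Every prime of `u` divides some `n + h` with `h ∈ H`. -/
def Occupied (H u : Finset ℕ) (n : ℕ) : Prop := ∀ p ∈ u, ∃ h ∈ H, p ∣ n + h

/-- The number of residue classes modulo `p` that are occupied by `H`. -/
def classCount (H : Finset ℕ) (p : ℕ) : ℕ := (H.image fun h : ℕ => (h : ZMod p)).card

lemma card_filter_range_prod (u : Finset ℕ) (hu : ∀ p ∈ u, p.Prime)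
    (A : ∀ p : ℕ, Finset (ZMod p)) :
    ((Finset.range (∏ p ∈ u, p)).filter fun v : ℕ => ∀ p ∈ u, (v : ZMod p) ∈ A p).card =
      ∏ p ∈ u, (A p).card := by
  classical
  have hcop : Pairwise (Function.onFun Nat.Coprime fun i : u => (i : ℕ)) := by
    intro i j hij
    exact (Nat.coprime_primes (hu i i.2) (hu j j.2)).2 fun h => hij (Subtype.ext h)
  have hq : ∏ p ∈ u, p = ∏ i : u, (i : ℕ) := (Finset.prod_coe_sort u fun p => p).symm
  have hq0 : 0 < ∏ i : u, (i : ℕ) := hq ▸ prod_pos_of_forall_prime hu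
  have hne : NeZero (∏ i : u, (i : ℕ)) := ⟨hq0.ne'⟩
  rw [hq, ← Finset.prod_coe_sort u fun p => (A p).card,
    ← Fintype.card_piFinset fun i : u => A (i : ℕ)]
  let e := ZMod.prodEquivPi (fun i : u => (i : ℕ)) hcop
  have he : ∀ v : ℕ, e (v : ZMod (∏ i : u, (i : ℕ))) = fun i : u => (v : ZMod (i : ℕ)) := by
    intro v
    rw [map_natCast]
    rfl
  refine Finset.card_bij (fun v _ => fun i : u => (v : ZMod (i : ℕ))) ?_ ?_ ?_
  · intro v hv
    rw [Fintype.mem_piFinset]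
    intro i
    exact (Finset.mem_filter.1 hv).2 i i.2
  · intro v hv w hw hvw
    have h1 : (v : ZMod (∏ i : u, (i : ℕ))) = w := by
      apply e.injective
      rw [he, he]
      exact hvw
    rw [ZMod.natCast_eq_natCast_iff'] at h1
    rwa [Nat.mod_eq_of_lt (Finset.mem_range.1 (Finset.mem_filter.1 hv).1),
      Nat.mod_eq_of_lt (Finset.mem_range.1 (Finset.mem_filter.1 hw).1)] at h1
  · intro g hg
    rw [Fintype.mem_piFinset] at hg
    have h1 : (fun i : u => ((e.symm g).val : ZMod (i : ℕ))) = g := by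
      rw [← he, ZMod.natCast_zmod_val, RingEquiv.apply_symm_apply]
    refine ⟨(e.symm g).val, ?_, h1⟩
    rw [Finset.mem_filter, Finset.mem_range]
    refine ⟨ZMod.val_lt _, fun p hp => ?_⟩
    have h2 := congrFun h1 ⟨p, hp⟩
    simp only at h2
    rw [h2]
    exact hg ⟨p, hp⟩

lemma mem_image_neg_iff (H : Finset ℕ) (p v : ℕ) :
    (v : ZMod p) ∈ H.image (fun h : ℕ => -(h : ZMod p)) ↔ ∃ h ∈ H, p ∣ v + h := by
  simp only [Finset.mem_image]
  refine exists_congr fun h => and_congr_right fun _ => ?_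
  rw [← ZMod.natCast_eq_zero_iff, Nat.cast_add, eq_comm, eq_neg_iff_add_eq_zero]

lemma card_image_neg (H : Finset ℕ) (p : ℕ) :
    (H.image fun h : ℕ => -(h : ZMod p)).card = classCount H p := by
  classical
  have : H.image (fun h : ℕ => -(h : ZMod p)) =
      (H.image fun h : ℕ => (h : ZMod p)).image Neg.neg := by
    rw [Finset.image_image]; rfl
  rw [this, Finset.card_image_of_injective _ neg_injective, classCount]

open Classical in
lemma card_occupied (H u : Finset ℕ) (hu : ∀ p ∈ u, p.Prime) :
    ((Finset.range (∏ p ∈ u, p)).filter fun v => Occupied H u v).card =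
      ∏ p ∈ u, classCount H p := by
  rw [← Finset.prod_congr rfl fun p _ => card_image_neg H p,
    ← card_filter_range_prod u hu fun p => H.image fun h : ℕ => -(h : ZMod p)]
  congr 1
  ext v
  rw [Finset.mem_filter, Finset.mem_filter]
  simp only [mem_image_neg_iff, Occupied]

open Classical in
lemma card_occupied_coprime (H u : Finset ℕ) (hu : ∀ p ∈ u, p.Prime) {h₀ : ℕ} (hh : h₀ ∈ H) :
    ((Finset.range (∏ p ∈ u, p)).filter fun v =>
      Occupied H u v ∧ ∀ p ∈ u, ¬ p ∣ v + h₀).card = ∏ p ∈ u, (classCount H p - 1) := by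
  -- Coprimality to `n + h₀` excludes one of the occupied classes, that of `-h₀`; hence the `ν p -
  -- 1` in the reduced density.
  have h1 : ∀ p ∈ u, ((H.image fun h : ℕ => -(h : ZMod p)).erase (-(h₀ : ZMod p))).card =
      classCount H p - 1 := by
    intro p _
    rw [Finset.card_erase_of_mem (Finset.mem_image_of_mem _ hh), card_image_neg]
  rw [← Finset.prod_congr rfl h1, ← card_filter_range_prod u hu fun p =>
    (H.image fun h : ℕ => -(h : ZMod p)).erase (-(h₀ : ZMod p))]
  congr 1
  ext v
  rw [Finset.mem_filter, Finset.mem_filter]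
  simp only [Finset.mem_erase, mem_image_neg_iff, Occupied]
  refine and_congr_right fun _ => ?_
  have h2 : ∀ p, (v : ZMod p) ≠ -(h₀ : ZMod p) ↔ ¬ p ∣ v + h₀ := by
    intro p
    rw [← ZMod.natCast_eq_zero_iff, Nat.cast_add, ne_eq, eq_neg_iff_add_eq_zero]
  simp only [h2]
  exact ⟨fun h p hp => ⟨h.2 p hp, h.1 p hp⟩, fun h => ⟨fun p hp => (h p hp).2,
    fun p hp => (h p hp).1⟩⟩

lemma occupied_mod_iff (H u : Finset ℕ) (n : ℕ) :
    Occupied H u (n % ∏ p ∈ u, p) ↔ Occupied H u n := by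
  refine forall₂_congr fun p hp => exists_congr fun h => and_congr_right fun _ => ?_
  have h1 : p ∣ ∏ p ∈ u, p := Finset.dvd_prod_of_mem _ hp
  conv_rhs => rw [← Nat.mod_add_div n (∏ p ∈ u, p), add_right_comm]
  exact (Nat.dvd_add_left (h1.mul_right _)).symm

open Classical in
lemma sum_filter_occupied (H u : Finset ℕ) (hu : ∀ p ∈ u, p.Prime) (I : Finset ℕ) (f : ℕ → ℝ) :
    ∑ n ∈ I with Occupied H u n, f n =
      ∑ v ∈ (Finset.range (∏ p ∈ u, p)).filter (fun v => Occupied H u v),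
        ∑ n ∈ I.filter (fun n : ℕ => (n : ZMod (∏ p ∈ u, p)) = (v : ZMod (∏ p ∈ u, p))), f n := by
  have hq := prod_pos_of_forall_prime hu
  rw [← Finset.sum_fiberwise_of_maps_to (g := fun n => n % ∏ p ∈ u, p)
    (t := (Finset.range (∏ p ∈ u, p)).filter (fun v => Occupied H u v))]
  · refine Finset.sum_congr rfl fun v hv => Finset.sum_congr ?_ fun _ _ => rfl
    obtain ⟨hv1, hv2⟩ := Finset.mem_filter.1 hv
    ext n
    simp only [Finset.mem_filter, ZMod.natCast_eq_natCast_iff']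
    rw [Nat.mod_eq_of_lt (Finset.mem_range.1 hv1)]
    constructor
    · rintro ⟨⟨h1, h2⟩, h3⟩; exact ⟨h1, h3⟩
    · rintro ⟨h1, h3⟩
      refine ⟨⟨h1, ?_⟩, h3⟩
      rw [← occupied_mod_iff, h3]; exact hv2
  · intro n hn
    rw [Finset.mem_filter, Finset.mem_range]
    exact ⟨Nat.mod_lt _ hq, (occupied_mod_iff H u n).2 (Finset.mem_filter.1 hn).2⟩

lemma classCount_le (H : Finset ℕ) (p : ℕ) : classCount H p ≤ H.card := Finset.card_image_le

lemma prod_classCount_le (H u : Finset ℕ) : ∏ p ∈ u, classCount H p ≤ H.card ^ u.card :=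
  (Finset.prod_le_prod' fun p _ => classCount_le H p).trans_eq (by simp)

open Classical in
lemma card_filter_Ioc_sub_le (N q v : ℕ) (hq : 0 < q) :
    |(((Finset.Ioc N (2 * N)).filter fun n : ℕ => (n : ZMod q) = (v : ZMod q)).card : ℝ) -
      (N : ℝ) / q| ≤ 1 := by
  have h := Nat.Ioc_filter_modEq_card N (2 * N) hq v
  have h1 : ((Finset.Ioc N (2 * N)).filter fun n : ℕ => (n : ZMod q) = (v : ZMod q)) =
      (Finset.Ioc N (2 * N)).filter fun n : ℕ => n ≡ v [MOD q] :=
    Finset.filter_congr fun n _ => ZMod.natCast_eq_natCast_iff n v q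
  rw [h1]
  have hq0 : (0 : ℝ) < q := by exact_mod_cast hq
  have h2 : (((Finset.Ioc N (2 * N)).filter fun n : ℕ => n ≡ v [MOD q]).card : ℝ) =
      ((max (⌊(((2 * N : ℕ) : ℚ) - v) / q⌋ - ⌊((N : ℚ) - v) / q⌋) 0 : ℤ) : ℝ) := by
    rw [← h]; push_cast; rfl
  set x : ℚ := (((2 * N : ℕ) : ℚ) - v) / q with hx
  set y : ℚ := ((N : ℚ) - v) / q with hy
  have hxy : x - y = (N : ℚ) / q := by rw [hx, hy]; push_cast; ring
  have hxyR : (x : ℝ) - y = (N : ℝ) / q := by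
    have := congrArg (fun t : ℚ => (t : ℝ)) hxy
    push_cast at this
    exact this
  have hle : ⌊y⌋ ≤ ⌊x⌋ := Int.floor_mono (by
    have : (0 : ℚ) ≤ (N : ℚ) / q := by positivity
    linarith)
  rw [h2, max_eq_left (by linarith), ← hxyR]
  push_cast
  have a1 : ((⌊x⌋ : ℤ) : ℝ) ≤ x := by exact_mod_cast Int.floor_le x
  have a2 : (x : ℝ) < ((⌊x⌋ : ℤ) : ℝ) + 1 := by exact_mod_cast Int.lt_floor_add_one x
  have a3 : ((⌊y⌋ : ℤ) : ℝ) ≤ y := by exact_mod_cast Int.floor_le y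
  have a4 : (y : ℝ) < ((⌊y⌋ : ℤ) : ℝ) + 1 := by exact_mod_cast Int.lt_floor_add_one y
  rw [abs_le]
  constructor <;> linarith

open Classical in
/-- The number of `n ∈ (N, 2N]` for which every prime of `u` divides some `n + h`. -/
lemma abs_sum_occupied_one_sub_le (H u : Finset ℕ) (hu : ∀ p ∈ u, p.Prime) (N : ℕ) :
    |∑ n ∈ Finset.Ioc N (2 * N) with Occupied H u n, (1 : ℝ) -
      N * ∏ p ∈ u, localDensity (classCount H) p| ≤ (H.card : ℝ) ^ u.card := by
  have hq := prod_pos_of_forall_prime hu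
  rw [sum_filter_occupied H u hu]
  set V := (Finset.range (∏ p ∈ u, p)).filter (fun v => Occupied H u v) with hV
  have hcard : (V.card : ℝ) = ∏ p ∈ u, (classCount H p : ℝ) := by
    rw [hV, card_occupied H u hu]; push_cast; rfl
  have h1 : N * ∏ p ∈ u, localDensity (classCount H) p =
      ∑ v ∈ V, (N : ℝ) / (∏ p ∈ u, p : ℕ) := by
    rw [Finset.sum_const, nsmul_eq_mul, hcard]
    simp only [localDensity]
    rw [Finset.prod_div_distrib]
    push_cast
    ring
  rw [h1, ← Finset.sum_sub_distrib]
  refine (Finset.abs_sum_le_sum_abs _ _).trans ((Finset.sum_le_sum (g := fun _ => (1 : ℝ))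
    fun v _ => ?_).trans ?_)
  · simpa using card_filter_Ioc_sub_le N (∏ p ∈ u, p) v hq
  · rw [Finset.sum_const, nsmul_eq_mul, mul_one, hcard]
    exact_mod_cast prod_classCount_le H u

lemma totient_prod_primes {u : Finset ℕ} (hu : ∀ p ∈ u, p.Prime) :
    Nat.totient (∏ p ∈ u, p) = ∏ p ∈ u, (p - 1) := by
  induction u using Finset.induction_on with
  | empty => simp
  | insert p u hp ih =>
    rw [Finset.prod_insert hp, Finset.prod_insert hp, Nat.totient_mul,
      Nat.totient_prime (hu p (by simp)), ih fun q hq => hu q (by simp [hq])]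
    refine Nat.Coprime.prod_right fun q hq => ?_
    exact (Nat.coprime_primes (hu p (by simp)) (hu q (by simp [hq]))).2
      fun h => hp (h ▸ hq)

lemma abs_thetaAP_sub_le_primeError (N q : ℕ) [NeZero q] (a : (ZMod q)ˣ) :
    |thetaAP N q (a : ZMod q) - (N : ℝ) / (Nat.totient q : ℝ)| ≤ primeError N q :=
  le_ciSup (f := fun a : (ZMod q)ˣ => |thetaAP N q (a : ZMod q) - (N : ℝ) / (Nat.totient q : ℝ)|)
    (Set.finite_range _).bddAbove a

lemma abs_lambdaAP_le_lambdaError {N y : ℕ} (hy : y ≤ N) (q : ℕ) [NeZero q] (a : ZMod q) :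
    |lambdaAP y q a| ≤ lambdaError N q :=
  (le_ciSup (f := fun a : ZMod q => |lambdaAP y q a|) (Set.finite_range _).bddAbove a).trans
    (le_ciSup (f := fun y : Fin (N + 1) => ⨆ a : ZMod q, |lambdaAP (y : ℕ) q a|)
      (Set.finite_range _).bddAbove ⟨y, by omega⟩)

lemma primeError_nonneg (N q : ℕ) : 0 ≤ primeError N q := Real.iSup_nonneg fun _ => abs_nonneg _

lemma lambdaError_nonneg (N q : ℕ) : 0 ≤ lambdaError N q :=
  Real.iSup_nonneg fun _ => Real.iSup_nonneg fun _ => abs_nonneg _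

open Classical in
lemma sum_Ioc_shift (g : ℕ → ℝ) (N M h q : ℕ) (hNM : N ≤ M) (v : ℕ) :
    ∑ n ∈ (Finset.Ioc N M).filter (fun n : ℕ => (n : ZMod q) = (v : ZMod q)), g (n + h) =
      ∑ m ∈ (Finset.Icc 1 (M + h)).filter (fun m : ℕ => (m : ZMod q) = ((v + h : ℕ) : ZMod q)), g m -
        ∑ m ∈ (Finset.Icc 1 (N + h)).filter (fun m : ℕ => (m : ZMod q) = ((v + h : ℕ) : ZMod q)), g m := by
  have h1 : ∑ n ∈ (Finset.Ioc N M).filter (fun n : ℕ => (n : ZMod q) = (v : ZMod q)), g (n + h) =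
      ∑ m ∈ (Finset.Ioc (N + h) (M + h)).filter (fun m : ℕ => (m : ZMod q) = ((v + h : ℕ) : ZMod q)), g m := by
    refine Finset.sum_nbij' (fun n => n + h) (fun m => m - h) ?_ ?_ ?_ ?_ ?_
    · intro n hn
      simp only [Finset.mem_filter, Finset.mem_Ioc] at hn ⊢
      exact ⟨by omega, by push_cast; rw [hn.2]⟩
    · intro m hm
      simp only [Finset.mem_filter, Finset.mem_Ioc] at hm ⊢
      refine ⟨by omega, ?_⟩
      have h2 : m = m - h + h := by omega
      have h3 := hm.2
      rw [h2] at h3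
      push_cast at h3
      exact add_right_cancel h3
    · intro n _
      simp
    · intro m hm
      simp only [Finset.mem_filter, Finset.mem_Ioc] at hm
      omega
    · intro n _
      rfl
  rw [h1, eq_sub_iff_add_eq, add_comm, ← Finset.sum_union]
  · congr 1
    rw [← Finset.filter_union]
    congr 1
    ext m
    simp only [Finset.mem_union, Finset.mem_Icc, Finset.mem_Ioc]
    omega
  · refine Finset.disjoint_filter_filter (Finset.disjoint_left.2 fun m h1 h2 => ?_)
    simp only [Finset.mem_Icc, Finset.mem_Ioc] at h1 h2
    omega

-- The shifted interval is a difference of two initial segments. The second ends at `N + r` rather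
-- than `2N + r`, which is why the maximum over `y` is needed in the hypothesis on `λ`. There is no
-- main term.
open Classical in
lemma abs_sum_occupied_liouville_le (H u : Finset ℕ) (hu : ∀ p ∈ u, p.Prime) (N r : ℕ) :
    |∑ n ∈ Finset.Ioc N (2 * N) with Occupied H u n,
      (ArithmeticFunction.liouville (n + r) : ℝ)| ≤
      (H.card : ℝ) ^ u.card * (2 * lambdaError (2 * N + r) (∏ p ∈ u, p)) := by
  have hq := prod_pos_of_forall_prime hu
  have : NeZero (∏ p ∈ u, p) := ⟨hq.ne'⟩
  rw [sum_filter_occupied H u hu]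
  set V := (Finset.range (∏ p ∈ u, p)).filter (fun v => Occupied H u v) with hV
  have hcard : (V.card : ℝ) ≤ (H.card : ℝ) ^ u.card := by
    rw [hV, card_occupied H u hu]; exact_mod_cast prod_classCount_le H u
  refine (Finset.abs_sum_le_sum_abs _ _).trans ((Finset.sum_le_sum (g := fun _ =>
    2 * lambdaError (2 * N + r) (∏ p ∈ u, p)) fun v _ => ?_).trans ?_)
  · rw [sum_Ioc_shift (fun m => (ArithmeticFunction.liouville m : ℝ)) N (2 * N) r _ (by omega)]
    refine (abs_sub _ _).trans ?_
    rw [two_mul (lambdaError _ _)]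
    exact add_le_add
      (abs_lambdaAP_le_lambdaError le_rfl (∏ p ∈ u, p) ((v + r : ℕ) : ZMod (∏ p ∈ u, p)))
      (abs_lambdaAP_le_lambdaError (by omega) (∏ p ∈ u, p) ((v + r : ℕ) : ZMod (∏ p ∈ u, p)))
  · rw [Finset.sum_const, nsmul_eq_mul]
    exact mul_le_mul_of_nonneg_right hcard (mul_nonneg zero_le_two (lambdaError_nonneg _ _))

open Classical in
lemma sum_shift_prime_log_eq (N h q v : ℕ) :
    ∑ n ∈ (Finset.Ioc N (2 * N)).filter (fun n : ℕ => (n : ZMod q) = (v : ZMod q)),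
      (if (n + h).Prime then Real.log (n + h : ℕ) else 0) =
      thetaAP (2 * N + h) q ((v + h : ℕ) : ZMod q) - thetaAP (N + h) q ((v + h : ℕ) : ZMod q) := by
  rw [sum_Ioc_shift (fun m => if m.Prime then Real.log (m : ℕ) else 0) N (2 * N) h q (by omega)]
  simp only [thetaAP, ← Finset.sum_filter, Finset.filter_filter]
  congr 1 <;>
  · refine Finset.sum_congr (Finset.filter_congr fun m _ => and_comm) fun _ _ => rfl

open Classical in
/-- The primes `n + h` with `n ∈ (N, 2N]` and every prime of `u` dividing some `n + h'`. -/
lemma abs_sum_occupied_prime_sub_le (H u : Finset ℕ) (hu : ∀ p ∈ u, p.Prime) (N : ℕ)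
    (huN : ∀ p ∈ u, p ≤ N) {h₀ : ℕ} (hh : h₀ ∈ H) :
    |∑ n ∈ Finset.Ioc N (2 * N) with Occupied H u n,
      (if (n + h₀).Prime then Real.log (n + h₀ : ℕ) else 0) -
      N * ∏ p ∈ u, reducedDensity (classCount H) p| ≤
      (H.card : ℝ) ^ u.card * (primeError (2 * N + h₀) (∏ p ∈ u, p) +
        primeError (N + h₀) (∏ p ∈ u, p)) := by
  have hq := prod_pos_of_forall_prime hu
  set q := ∏ p ∈ u, p with hqdef
  have : NeZero q := ⟨hq.ne'⟩
  have hdvd : ∀ p ∈ u, p ∣ q := fun p hp => Finset.dvd_prod_of_mem _ hp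
  rw [sum_filter_occupied H u hu, ← hqdef]
  set V := (Finset.range q).filter (fun v => Occupied H u v ∧ ∀ p ∈ u, ¬ p ∣ v + h₀) with hV
  have hcard : (V.card : ℝ) = ∏ p ∈ u, ((classCount H p : ℝ) - 1) := by
    rw [hV, card_occupied_coprime H u hu hh]
    push_cast
    refine Finset.prod_congr rfl fun p _ => ?_
    rw [Nat.cast_sub, Nat.cast_one]
    exact Finset.card_pos.2 ⟨_, Finset.mem_image_of_mem _ hh⟩
  have hcard' : (V.card : ℝ) ≤ (H.card : ℝ) ^ u.card := by
    have h1 : V.card ≤ H.card ^ u.card := by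
      rw [hV, card_occupied_coprime H u hu hh]
      refine (Finset.prod_le_prod' fun p _ => ?_).trans_eq (Finset.prod_const H.card)
      exact (Nat.sub_le _ _).trans (classCount_le H p)
    exact_mod_cast h1
  -- A class with `p ∣ v + h₀` for some `p ∈ u` contains no prime `n + h₀`, since that prime would
  -- equal `p ≤ N < n + h₀`. Only reduced classes remain, as `primeError` requires.
  have hred : ∑ v ∈ (Finset.range q).filter (fun v => Occupied H u v),
      ∑ n ∈ (Finset.Ioc N (2 * N)).filter (fun n : ℕ => (n : ZMod q) = (v : ZMod q)),
        (if (n + h₀).Prime then Real.log (n + h₀ : ℕ) else 0) =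
      ∑ v ∈ V, ∑ n ∈ (Finset.Ioc N (2 * N)).filter (fun n : ℕ => (n : ZMod q) = (v : ZMod q)),
        (if (n + h₀).Prime then Real.log (n + h₀ : ℕ) else 0) := by
    rw [hV, ← Finset.filter_filter]
    symm
    refine Finset.sum_filter_of_ne fun v _ hne p hp hpv => hne ?_
    refine Finset.sum_eq_zero fun n hn => if_neg fun hprime => ?_
    obtain ⟨hnI, hnv⟩ := Finset.mem_filter.1 hn
    have h1 : p ∣ n + h₀ := by
      rw [← ZMod.natCast_eq_zero_iff] at hpv ⊢
      have h2 : (n : ZMod p) = v := by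
        rw [ZMod.natCast_eq_natCast_iff] at hnv ⊢
        exact hnv.of_dvd (hdvd p hp)
      push_cast at hpv ⊢
      rw [h2]; exact hpv
    have h3 := (Nat.prime_dvd_prime_iff_eq (hu p hp) hprime).1 h1
    have h4 := huN p hp
    have h5 := (Finset.mem_Ioc.1 hnI).1
    omega
  rw [hred]
  have htot : (Nat.totient q : ℝ) = ∏ p ∈ u, ((p : ℝ) - 1) := by
    have h1 : Nat.totient q = ∏ p ∈ u, (p - 1) := totient_prod_primes hu
    rw [h1]
    push_cast
    refine Finset.prod_congr rfl fun p hp => ?_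
    rw [Nat.cast_sub (hu p hp).one_le, Nat.cast_one]
  have hmain : N * ∏ p ∈ u, reducedDensity (classCount H) p =
      ∑ v ∈ V, (((2 * N + h₀ : ℕ) : ℝ) / Nat.totient q - ((N + h₀ : ℕ) : ℝ) / Nat.totient q) := by
    rw [Finset.sum_const, nsmul_eq_mul, hcard, htot]
    simp only [reducedDensity]
    rw [Finset.prod_div_distrib]
    push_cast
    ring
  rw [hmain, ← Finset.sum_sub_distrib]
  refine (Finset.abs_sum_le_sum_abs _ _).trans ((Finset.sum_le_sum (g := fun _ =>
    primeError (2 * N + h₀) q + primeError (N + h₀) q) fun v hv => ?_).trans ?_)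
  · rw [sum_shift_prime_log_eq]
    have hcop : Nat.Coprime (v + h₀) q := by
      refine Nat.Coprime.prod_right fun p hp => ?_
      exact ((Nat.Prime.coprime_iff_not_dvd (hu p hp)).2
        ((Finset.mem_filter.1 hv).2.2 p hp)).symm
    have h1 := abs_thetaAP_sub_le_primeError (2 * N + h₀) q (ZMod.unitOfCoprime _ hcop)
    have h2 := abs_thetaAP_sub_le_primeError (N + h₀) q (ZMod.unitOfCoprime _ hcop)
    rw [ZMod.coe_unitOfCoprime] at h1 h2
    rw [sub_sub_sub_comm]
    exact (abs_sub _ _).trans (add_le_add h1 h2)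
  · rw [Finset.sum_const, nsmul_eq_mul]
    exact mul_le_mul_of_nonneg_right hcard'
      (add_nonneg (primeError_nonneg _ _) (primeError_nonneg _ _))

end Counting

/-! ### Divisor-type sums, size of the weights, and expansion of the square -/

section ErrorTerms

lemma primeSets_zero : primeSets 0 = ∅ := by
  ext s
  rw [mem_primeSets]
  simp only [Finset.notMem_empty, iff_false, not_and]
  intro hs h
  have := prod_pos_of_forall_prime hs
  omega

lemma sum_primeSets_prod_le (M : ℕ) {g : ℕ → ℝ} (hg : ∀ q, 0 ≤ g q) :
    ∑ u ∈ primeSets M, g (∏ p ∈ u, p) ≤ ∑ q ∈ Finset.Icc 1 M, g q := by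
  rw [← Finset.sum_image (f := g) (g := fun u : Finset ℕ => ∏ p ∈ u, p)]
  · refine Finset.sum_le_sum_of_subset_of_nonneg ?_ fun q _ _ => hg q
    intro q hq
    obtain ⟨u, hu, rfl⟩ := Finset.mem_image.1 hq
    have h := mem_primeSets.1 hu
    exact Finset.mem_Icc.2 ⟨prod_pos_of_forall_prime h.1, h.2⟩
  · intro u hu v hv huv
    simp only at huv
    rw [← Nat.primeFactors_prod (mem_primeSets.1 hu).1, huv,
      Nat.primeFactors_prod (mem_primeSets.1 hv).1]

/-- Induction on `C` from `(C+1)^{|u|} = ∑_{d ⊆ u} C^{|d|}`: splitting `u` into `d` and `u \ d` and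
dropping disjointness gives a product of two sums, one of which is at most the harmonic sum. -/
lemma sum_pow_card_div_prod_le (M C : ℕ) :
    ∑ u ∈ primeSets M, (C : ℝ) ^ u.card / (∏ p ∈ u, p : ℕ) ≤ (1 + Real.log M) ^ C := by
  rcases Nat.eq_zero_or_pos M with rfl | hM
  · simp [primeSets_zero]
  have hlog : 0 ≤ Real.log M := Real.log_natCast_nonneg M
  induction C with
  | zero =>
    rw [pow_zero, Finset.sum_eq_single_of_mem ∅ (empty_mem_primeSets hM)]
    · simp
    · intro u _ hu
      have : u.card ≠ 0 := fun h => hu (Finset.card_eq_zero.1 h)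
      simp [this]
  | succ C ih =>
    have hone : ∑ u ∈ primeSets M, ((∏ p ∈ u, p : ℕ) : ℝ)⁻¹ ≤ 1 + Real.log M := by
      refine (sum_primeSets_prod_le M (g := fun q => (q : ℝ)⁻¹) fun q => by positivity).trans ?_
      have h := harmonic_le_one_add_log M
      rw [harmonic_eq_sum_Icc] at h
      push_cast at h
      exact h
    have hexp : ∀ u ∈ primeSets M, ((C + 1 : ℕ) : ℝ) ^ u.card / (∏ p ∈ u, p : ℕ) =
        ∑ d ∈ u.powerset, (C : ℝ) ^ d.card / (∏ p ∈ d, p : ℕ) * ((∏ p ∈ u \ d, p : ℕ) : ℝ)⁻¹ := by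
      intro u _
      have h1 : ((C + 1 : ℕ) : ℝ) ^ u.card = ∑ d ∈ u.powerset, (C : ℝ) ^ d.card := by
        push_cast
        rw [← Finset.sum_pow_mul_eq_add_pow]
        simp
      rw [h1, Finset.sum_div]
      refine Finset.sum_congr rfl fun d hd => ?_
      rw [← Finset.prod_sdiff (Finset.mem_powerset.1 hd)]
      push_cast
      rw [mul_comm (∏ p ∈ u \ d, (p : ℝ)), ← div_div, ← div_eq_mul_inv]
    rw [Finset.sum_congr rfl hexp, pow_succ]
    have hle : ∑ u ∈ primeSets M, ∑ d ∈ u.powerset,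
        (C : ℝ) ^ d.card / (∏ p ∈ d, p : ℕ) * ((∏ p ∈ u \ d, p : ℕ) : ℝ)⁻¹ ≤
        ∑ d ∈ primeSets M, ∑ e ∈ primeSets M,
          (C : ℝ) ^ d.card / (∏ p ∈ d, p : ℕ) * ((∏ p ∈ e, p : ℕ) : ℝ)⁻¹ := by
      rw [Finset.sum_sigma', ← Finset.sum_product']
      rw [← Finset.sum_image (s := (primeSets M).sigma fun u => u.powerset)
        (g := fun x => (x.2, x.1 \ x.2))
        (f := fun x : Finset ℕ × Finset ℕ =>
          (C : ℝ) ^ x.1.card / (∏ p ∈ x.1, p : ℕ) * ((∏ p ∈ x.2, p : ℕ) : ℝ)⁻¹)]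
      · refine Finset.sum_le_sum_of_subset_of_nonneg ?_ fun x _ _ => by positivity
        intro x hx
        obtain ⟨⟨u, d⟩, hud, rfl⟩ := Finset.mem_image.1 hx
        simp only [Finset.mem_sigma, Finset.mem_powerset] at hud
        exact Finset.mem_product.2 ⟨primeSets_down u hud.1 d hud.2,
          primeSets_down u hud.1 _ Finset.sdiff_subset⟩
      · rintro ⟨u, d⟩ hx ⟨v, e⟩ hy hxy
        simp only [Finset.coe_sigma, Set.mem_sigma_iff, Finset.mem_coe,
          Finset.mem_powerset] at hx hy
        simp only [Prod.mk.injEq] at hxy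
        obtain ⟨rfl, h2⟩ := hxy
        have : u = v := by
          rw [← Finset.sdiff_union_of_subset hx.2, h2, Finset.sdiff_union_of_subset hy.2]
        subst this
        rfl
    refine hle.trans ?_
    rw [← Finset.sum_mul_sum]
    exact mul_le_mul ih hone (Finset.sum_nonneg fun u _ => by positivity) (by positivity)

/-- A set `u` is the union of at most `4^{|u|}` pairs of its subsets, and `[d,e] ≤ R²`. -/
lemma sum_union_le {R : ℕ} {g : Finset ℕ → ℝ} (hg : ∀ u, 0 ≤ g u) :
    ∑ d ∈ primeSets R, ∑ e ∈ primeSets R, g (d ∪ e) ≤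
      ∑ u ∈ primeSets (R ^ 2), (4 : ℝ) ^ u.card * g u := by
  rw [← Finset.sum_product']
  have hmaps : ∀ x ∈ primeSets R ×ˢ primeSets R, x.1 ∪ x.2 ∈ primeSets (R ^ 2) := by
    rintro ⟨d, e⟩ hx
    obtain ⟨hd, he⟩ := Finset.mem_product.1 hx
    have hd' := mem_primeSets.1 hd
    have he' := mem_primeSets.1 he
    refine mem_primeSets.2 ⟨fun p hp => ?_, ?_⟩
    · rcases Finset.mem_union.1 hp with hp | hp
      · exact hd'.1 p hp
      · exact he'.1 p hp
    · calc ∏ p ∈ d ∪ e, p ≤ (∏ p ∈ d ∪ e, p) * ∏ p ∈ d ∩ e, p :=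
            Nat.le_mul_of_pos_right _ (prod_pos_of_forall_prime fun p hp =>
              hd'.1 p (Finset.mem_inter.1 hp).1)
        _ = (∏ p ∈ d, p) * ∏ p ∈ e, p := Finset.prod_union_inter
        _ ≤ R * R := Nat.mul_le_mul hd'.2 he'.2
        _ = R ^ 2 := (pow_two R).symm
  rw [← Finset.sum_fiberwise_of_maps_to hmaps]
  refine Finset.sum_le_sum fun u _ => ?_
  have h1 : ∑ x ∈ primeSets R ×ˢ primeSets R with x.1 ∪ x.2 = u, g (x.1 ∪ x.2) =
      ((primeSets R ×ˢ primeSets R).filter (fun x => x.1 ∪ x.2 = u)).card * g u := by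
    rw [← nsmul_eq_mul, ← Finset.sum_const]
    exact Finset.sum_congr rfl fun x hx => by rw [(Finset.mem_filter.1 hx).2]
  rw [h1]
  refine mul_le_mul_of_nonneg_right ?_ (hg u)
  have h2 : (primeSets R ×ˢ primeSets R).filter (fun x => x.1 ∪ x.2 = u) ⊆
      u.powerset ×ˢ u.powerset := by
    intro x hx
    have h3 := (Finset.mem_filter.1 hx).2
    rw [Finset.mem_product, Finset.mem_powerset, Finset.mem_powerset, ← h3]
    exact ⟨Finset.subset_union_left, Finset.subset_union_right⟩
  have h3 := Finset.card_le_card h2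
  rw [Finset.card_product, Finset.card_powerset, ← mul_pow] at h3
  exact_mod_cast h3

namespace AdmissibleCount

variable {ν : ℕ → ℕ} {k P : ℕ}

lemma exists_powerSum_zero_le (A : AdmissibleCount ν k P) :
    ∃ C : ℕ, ∀ R : ℕ, powerSum (localDual ν) R 0 ≤ (1 + Real.log R) ^ C := by
  obtain ⟨C, D⟩ := A.sieveDensity
  refine ⟨⌈(k : ℝ) + C⌉₊, fun R => le_trans ?_ (sum_pow_card_div_prod_le R _)⟩
  refine Finset.sum_le_sum fun u hu => ?_
  rw [pow_zero, mul_one]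
  push_cast
  rw [← Finset.prod_const, ← Finset.prod_div_distrib]
  refine Finset.prod_le_prod (fun p hp => (A.localDual_pos (prime_of_mem_primeSets hu hp)).le)
    fun p hp => (D.le_div p (prime_of_mem_primeSets hu hp)).trans ?_
  exact div_le_div_of_nonneg_right (Nat.le_ceil _) (Nat.cast_nonneg p)

lemma diagonalVar_mem {a : ℝ} (ha : 0 ≤ a) {R : ℕ} {s : Finset ℕ} (hs : s ∈ primeSets R) :
    0 ≤ diagonalVar a R s ∧ diagonalVar a R s ≤ 1 + a := by
  have h1 := sub_nonneg.2 (logSum_le_log hs)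
  have h2 := Real.log_natCast_nonneg R
  rw [diagonalVar]
  constructor
  · positivity
  · rcases h2.eq_or_lt with h0 | h0
    · rw [← h0]; simpa using ha
    · have h3 : a / Real.log R * (Real.log R - logSum s) ≤ a / Real.log R * Real.log R :=
        mul_le_mul_of_nonneg_left (by linarith [logSum_nonneg s]) (by positivity)
      rw [div_mul_cancel₀ _ h0.ne'] at h3
      linarith

/-- The tail over `s ⊇ d` is at most `(1 + a) h(d) S₀`, and `h(d)/ρ(d) = ∏ (1 + h(p)) = ∑_{t ⊆ d}
h(t) ≤ S₀`. With `S₀` bounded by a power of `log R`, this crude estimate suffices. -/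
lemma abs_sieveWeight_le (A : AdmissibleCount ν k P) {a : ℝ} (ha : 0 ≤ a) {R : ℕ} {d : Finset ℕ}
    (hd : d ∈ primeSets R) :
    |sieveWeight ν a R d| ≤ (1 + a) * powerSum (localDual ν) R 0 ^ 2 := by
  have hpos : ∀ s ∈ primeSets R, 0 ≤ ∏ p ∈ s, localDual ν p := fun s hs =>
    Finset.prod_nonneg fun p hp => (A.localDual_pos (prime_of_mem_primeSets hs hp)).le
  have hS : powerSum (localDual ν) R 0 = ∑ s ∈ primeSets R, ∏ p ∈ s, localDual ν p := by
    simp [powerSum]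
  have hρ0 : 0 ≤ ∏ p ∈ d, (localDensity ν p)⁻¹ := Finset.prod_nonneg fun p hp =>
    inv_nonneg.2 (A.localDensity_pos (prime_of_mem_primeSets hd hp)).le
  have h1 : ∑ s ∈ primeSets R with d ⊆ s, (∏ p ∈ s, localDual ν p) * diagonalVar a R s ≤
      (1 + a) * ((∏ p ∈ d, localDual ν p) * powerSum (localDual ν) R 0) := by
    have h2 : ∑ s ∈ primeSets R with d ⊆ s, (∏ p ∈ s, localDual ν p) * diagonalVar a R s ≤
        ∑ s ∈ primeSets R with d ⊆ s,
          (1 + a) * ((∏ p ∈ d, localDual ν p) * ∏ p ∈ s \ d, localDual ν p) := by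
      refine Finset.sum_le_sum fun s hs => ?_
      obtain ⟨hs, hds⟩ := Finset.mem_filter.1 hs
      rw [mul_comm (∏ p ∈ d, localDual ν p), Finset.prod_sdiff hds, mul_comm]
      exact mul_le_mul_of_nonneg_right (diagonalVar_mem ha hs).2 (hpos s hs)
    refine h2.trans ?_
    rw [← Finset.mul_sum, ← Finset.mul_sum]
    refine mul_le_mul_of_nonneg_left (mul_le_mul_of_nonneg_left ?_ (hpos d hd)) (by linarith)
    rw [hS, ← Finset.sum_image (s := (primeSets R).filter fun s => d ⊆ s) (g := fun s => s \ d)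
      (f := fun t => ∏ p ∈ t, localDual ν p)]
    · refine Finset.sum_le_sum_of_subset_of_nonneg ?_ fun t ht _ => hpos t ht
      intro t ht
      obtain ⟨s, hs, rfl⟩ := Finset.mem_image.1 ht
      exact primeSets_down s (Finset.mem_filter.1 hs).1 _ Finset.sdiff_subset
    · intro s hs t ht hst
      simp only [Finset.coe_filter, Set.mem_ofPred_eq] at hs ht
      simp only at hst
      rw [← Finset.sdiff_union_of_subset hs.2, hst, Finset.sdiff_union_of_subset ht.2]
  have h0 : 0 ≤ ∑ s ∈ primeSets R with d ⊆ s, (∏ p ∈ s, localDual ν p) * diagonalVar a R s :=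
    Finset.sum_nonneg fun s hs => mul_nonneg (hpos s (Finset.mem_filter.1 hs).1)
      (diagonalVar_mem ha (Finset.mem_filter.1 hs).1).1
  have h3 : (∏ p ∈ d, (localDensity ν p)⁻¹) * ∏ p ∈ d, localDual ν p ≤
      powerSum (localDual ν) R 0 := by
    rw [← Finset.prod_mul_distrib, hS]
    have h4 : ∏ p ∈ d, (localDensity ν p)⁻¹ * localDual ν p = ∏ p ∈ d, (1 + localDual ν p) := by
      refine Finset.prod_congr rfl fun p hp => ?_
      obtain ⟨h1, h2, h3⟩ := A.real_bounds (prime_of_mem_primeSets hd hp)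
      rw [localDensity, localDual]
      have h4 : (ν p : ℝ) ≠ 0 := by linarith
      have h5 : (p : ℝ) ≠ 0 := by linarith
      have h6 : (p : ℝ) - ν p ≠ 0 := by linarith
      field_simp
      ring
    rw [h4, Finset.prod_one_add]
    refine Finset.sum_le_sum_of_subset_of_nonneg (fun t ht => ?_) fun t ht _ => hpos t ht
    exact primeSets_down d hd t (Finset.mem_powerset.1 ht)
  have hS0 : 0 ≤ powerSum (localDual ν) R 0 := hS ▸ Finset.sum_nonneg hpos
  rw [sieveWeight, selbergWeight, abs_mul, abs_mul, abs_pow, abs_neg, abs_one, one_pow, one_mul,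
    abs_of_nonneg hρ0, abs_of_nonneg h0]
  calc _ ≤ (∏ p ∈ d, (localDensity ν p)⁻¹) *
        ((1 + a) * ((∏ p ∈ d, localDual ν p) * powerSum (localDual ν) R 0)) :=
        mul_le_mul_of_nonneg_left h1 hρ0
    _ = (1 + a) * (((∏ p ∈ d, (localDensity ν p)⁻¹) * ∏ p ∈ d, localDual ν p) *
        powerSum (localDual ν) R 0) := by ring
    _ ≤ (1 + a) * (powerSum (localDual ν) R 0 * powerSum (localDual ν) R 0) :=
        mul_le_mul_of_nonneg_left (mul_le_mul_of_nonneg_right h3 hS0) (by linarith)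
    _ = _ := by ring

end AdmissibleCount

open Classical in
/-- The square of the linear sieve sum at `n`. -/
noncomputable def sieveSquare (H : Finset ℕ) (R : ℕ) (lam : Finset ℕ → ℝ) (n : ℕ) : ℝ :=
  (∑ d ∈ primeSets R, if Occupied H d n then lam d else 0) ^ 2

-- The common bookkeeping for the weights `1`, `log` on primes, and `λ`: expand the square, note
-- that the conditions for `d` and `e` together are the one for `d ∪ e`, and group the errors by the
-- union.
open Classical in
lemma abs_sum_mul_sieveSquare_sub_le (H : Finset ℕ) (R : ℕ) {lam : Finset ℕ → ℝ} {Λ X : ℝ}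
    (I : Finset ℕ) (f : ℕ → ℝ) (g err : Finset ℕ → ℝ)
    (hlam : ∀ d ∈ primeSets R, |lam d| ≤ Λ) (herr0 : ∀ u, 0 ≤ err u)
    (herr : ∀ d ∈ primeSets R, ∀ e ∈ primeSets R,
      |∑ n ∈ I with Occupied H (d ∪ e) n, f n - X * g (d ∪ e)| ≤ err (d ∪ e)) :
    |∑ n ∈ I, f n * sieveSquare H R lam n -
      X * ∑ d ∈ primeSets R, ∑ e ∈ primeSets R, lam d * lam e * g (d ∪ e)| ≤
      Λ ^ 2 * ∑ u ∈ primeSets (R ^ 2), (4 : ℝ) ^ u.card * err u := by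
  have h1 : ∑ n ∈ I, f n * sieveSquare H R lam n =
      ∑ d ∈ primeSets R, ∑ e ∈ primeSets R,
        lam d * lam e * ∑ n ∈ I with Occupied H (d ∪ e) n, f n := by
    have h2 : ∀ n, f n * sieveSquare H R lam n = ∑ d ∈ primeSets R, ∑ e ∈ primeSets R,
        lam d * lam e * (if Occupied H (d ∪ e) n then f n else 0) := by
      intro n
      rw [sieveSquare, pow_two, Finset.sum_mul_sum, Finset.mul_sum]
      refine Finset.sum_congr rfl fun d _ => ?_
      rw [Finset.mul_sum]
      refine Finset.sum_congr rfl fun e _ => ?_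
      have h3 : Occupied H (d ∪ e) n ↔ Occupied H d n ∧ Occupied H e n := by
        simp only [Occupied, Finset.mem_union]
        exact ⟨fun h => ⟨fun p hp => h p (Or.inl hp), fun p hp => h p (Or.inr hp)⟩,
          fun h p hp => hp.elim (h.1 p) (h.2 p)⟩
      by_cases hd : Occupied H d n <;> by_cases he : Occupied H e n <;> simp [h3, hd, he]
      ring
    simp_rw [h2]
    rw [Finset.sum_comm]
    refine Finset.sum_congr rfl fun d _ => ?_
    rw [Finset.sum_comm]
    refine Finset.sum_congr rfl fun e _ => ?_
    rw [← Finset.mul_sum, Finset.sum_filter]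
  have h4 : ∑ n ∈ I, f n * sieveSquare H R lam n -
      X * ∑ d ∈ primeSets R, ∑ e ∈ primeSets R, lam d * lam e * g (d ∪ e) =
      ∑ d ∈ primeSets R, ∑ e ∈ primeSets R, lam d * lam e *
        (∑ n ∈ I with Occupied H (d ∪ e) n, f n - X * g (d ∪ e)) := by
    rw [h1, Finset.mul_sum, ← Finset.sum_sub_distrib]
    refine Finset.sum_congr rfl fun d _ => ?_
    rw [Finset.mul_sum, ← Finset.sum_sub_distrib]
    exact Finset.sum_congr rfl fun e _ => by ring
  rw [h4]
  refine le_trans ?_ (mul_le_mul_of_nonneg_left (sum_union_le (R := R) herr0) (sq_nonneg Λ))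
  rw [Finset.mul_sum]
  refine (Finset.abs_sum_le_sum_abs _ _).trans (Finset.sum_le_sum fun d hd => ?_)
  rw [Finset.mul_sum]
  refine (Finset.abs_sum_le_sum_abs _ _).trans (Finset.sum_le_sum fun e he => ?_)
  rw [abs_mul, abs_mul, pow_two]
  have hΛ : 0 ≤ Λ := (abs_nonneg _).trans (hlam d hd)
  exact mul_le_mul (mul_le_mul (hlam d hd) (hlam e he) (abs_nonneg _) hΛ) (herr d hd e he)
    (abs_nonneg _) (mul_nonneg hΛ hΛ)

/-- Cauchy's inequality removes the divisor function from the error terms. -/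
lemma sq_sum_pow_card_mul_le (M D : ℕ) {E : ℕ → ℝ} (hE : ∀ q, 0 ≤ E q) {T : ℝ} (hT : 0 ≤ T)
    (htriv : ∀ u ∈ primeSets M, E (∏ p ∈ u, p) ≤ T * 2 ^ u.card / (∏ p ∈ u, p : ℕ)) :
    (∑ u ∈ primeSets M, (D : ℝ) ^ u.card * E (∏ p ∈ u, p)) ^ 2 ≤
      T * (1 + Real.log M) ^ (2 * D ^ 2) * ∑ q ∈ Finset.Icc 1 M, E q := by
  have h1 := Finset.sum_sq_le_sum_mul_sum_of_sq_le_mul (primeSets M)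
    (r := fun u => (D : ℝ) ^ u.card * E (∏ p ∈ u, p))
    (f := fun u => ((D : ℝ) ^ 2) ^ u.card * E (∏ p ∈ u, p)) (g := fun u => E (∏ p ∈ u, p))
    (fun u _ => mul_nonneg (by positivity) (hE _)) (fun u _ => hE _)
    (fun u _ => le_of_eq (by ring))
  refine h1.trans (mul_le_mul ?_ (sum_primeSets_prod_le M hE)
    (Finset.sum_nonneg fun u _ => hE _)
    (mul_nonneg hT (pow_nonneg (by linarith [Real.log_natCast_nonneg M]) _)))
  refine le_trans ?_ (mul_le_mul_of_nonneg_left (sum_pow_card_div_prod_le M (2 * D ^ 2)) hT)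
  rw [Finset.mul_sum]
  refine Finset.sum_le_sum fun u hu => ?_
  refine (mul_le_mul_of_nonneg_left (htriv u hu) (by positivity)).trans_eq ?_
  push_cast
  rw [mul_pow]
  ring

end ErrorTerms

/-! ### The total error is smaller than any power of `log N` -/

section ErrorBounds

open Classical in
lemma card_filter_Icc_le (N q : ℕ) (hq : 0 < q) (a : ZMod q) :
    (((Finset.Icc 1 N).filter fun n : ℕ => (n : ZMod q) = a).card : ℝ) ≤ (N : ℝ) / q + 1 := by
  have : NeZero q := ⟨hq.ne'⟩
  have h := Nat.Ioc_filter_modEq_card 0 N hq a.val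
  have h1 : ((Finset.Icc 1 N).filter fun n : ℕ => (n : ZMod q) = a) =
      (Finset.Ioc 0 N).filter fun n : ℕ => n ≡ a.val [MOD q] := by
    have h2 : Finset.Icc 1 N = Finset.Ioc 0 N := by
      ext n; simp only [Finset.mem_Icc, Finset.mem_Ioc]; omega
    rw [h2]
    refine Finset.filter_congr fun n _ => ?_
    rw [← ZMod.natCast_eq_natCast_iff, ZMod.natCast_zmod_val]
  rw [h1]
  set x : ℚ := ((N : ℚ) - a.val) / q with hx
  set y : ℚ := (((0 : ℕ) : ℚ) - a.val) / q with hy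
  have h2 : (((Finset.Ioc 0 N).filter fun n : ℕ => n ≡ a.val [MOD q]).card : ℝ) =
      ((max (⌊x⌋ - ⌊y⌋) 0 : ℤ) : ℝ) := by
    rw [← h]; push_cast; rfl
  have hxy : x - y = (N : ℚ) / q := by rw [hx, hy]; push_cast; ring
  have hxyR : (x : ℝ) - y = (N : ℝ) / q := by
    have := congrArg (fun t : ℚ => (t : ℝ)) hxy
    push_cast at this
    exact this
  have hle : ⌊y⌋ ≤ ⌊x⌋ := Int.floor_mono (by
    have : (0 : ℚ) ≤ (N : ℚ) / q := by positivity
    linarith)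
  rw [h2, max_eq_left (by linarith), ← hxyR]
  push_cast
  have a1 : ((⌊x⌋ : ℤ) : ℝ) ≤ x := by exact_mod_cast Int.floor_le x
  have a4 : (y : ℝ) < ((⌊y⌋ : ℤ) : ℝ) + 1 := by exact_mod_cast Int.lt_floor_add_one y
  linarith

lemma card_bound_le {N q : ℕ} (hq : 0 < q) (hqN : q ≤ N) : (N : ℝ) / q + 1 ≤ 2 * (N / q) := by
  have hq0 : (0 : ℝ) < q := by exact_mod_cast hq
  have : (1 : ℝ) ≤ N / q := by rw [one_le_div hq0]; exact_mod_cast hqN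
  linarith

lemma thetaAP_nonneg (N q : ℕ) (a : ZMod q) : 0 ≤ thetaAP N q a :=
  Finset.sum_nonneg fun p _ => Real.log_natCast_nonneg p

lemma thetaAP_le {N q : ℕ} (hq : 0 < q) (hqN : q ≤ N) (a : ZMod q) :
    thetaAP N q a ≤ 2 * Real.log N * (N / q) := by
  classical
  have h1 : thetaAP N q a ≤
      ∑ p ∈ (Finset.Icc 1 N).filter (fun p : ℕ => p.Prime ∧ (p : ZMod q) = a), Real.log N := by
    rw [thetaAP]
    refine Finset.sum_le_sum fun p hp => ?_
    obtain ⟨h2, h3, -⟩ := Finset.mem_filter.1 hp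
    exact Real.log_le_log (by exact_mod_cast h3.pos) (by exact_mod_cast (Finset.mem_Icc.1 h2).2)
  refine h1.trans ?_
  rw [Finset.sum_const, nsmul_eq_mul]
  have h2 : (((Finset.Icc 1 N).filter (fun p : ℕ => p.Prime ∧ (p : ZMod q) = a)).card : ℝ) ≤
      ((Finset.Icc 1 N).filter fun n : ℕ => (n : ZMod q) = a).card := by
    refine Nat.cast_le.2 (Finset.card_le_card fun p hp => ?_)
    rw [Finset.mem_filter] at hp ⊢
    exact ⟨hp.1, hp.2.2⟩
  have h3 := (h2.trans (card_filter_Icc_le N q hq a)).trans (card_bound_le hq hqN)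
  exact (mul_le_mul_of_nonneg_right h3 (Real.log_natCast_nonneg N)).trans_eq (by ring)

lemma abs_lambdaAP_le {N y q : ℕ} (hq : 0 < q) (hqN : q ≤ N) (hy : y ≤ N) (a : ZMod q) :
    |lambdaAP y q a| ≤ 2 * (N / q) := by
  classical
  rw [lambdaAP]
  refine (Finset.abs_sum_le_sum_abs _ _).trans
    ((Finset.sum_le_sum (g := fun _ => (1 : ℝ)) fun n hn => ?_).trans ?_)
  · by_cases hn0 : n = 0
    · simp [hn0]
    · rw [ArithmeticFunction.liouville_apply hn0]
      simp
  · rw [Finset.sum_const, nsmul_eq_mul, mul_one]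
    refine le_trans ?_ (card_bound_le hq hqN)
    refine le_trans ?_ (card_filter_Icc_le N q hq a)
    have := Finset.card_le_card (Finset.filter_subset_filter (fun n : ℕ => (n : ZMod q) = a)
      (Finset.Icc_subset_Icc_right (a := 1) hy))
    exact_mod_cast this

lemma one_div_totient_le {u : Finset ℕ} (hu : ∀ p ∈ u, p.Prime) :
    1 / (Nat.totient (∏ p ∈ u, p) : ℝ) ≤ 2 ^ u.card / (∏ p ∈ u, p : ℕ) := by
  rw [totient_prod_primes hu]
  push_cast
  rw [← Finset.prod_const, ← Finset.prod_div_distrib, one_div, ← Finset.prod_inv_distrib]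
  refine Finset.prod_le_prod (fun p _ => by positivity) fun p hp => ?_
  have h2 : (2 : ℝ) ≤ p := by exact_mod_cast (hu p hp).two_le
  rw [Nat.cast_sub (hu p hp).one_le, Nat.cast_one, inv_eq_one_div,
    div_le_div_iff₀ (by linarith) (by linarith)]
  linarith

lemma primeError_le {N : ℕ} {u : Finset ℕ} (hu : ∀ p ∈ u, p.Prime) (huN : ∏ p ∈ u, p ≤ N) :
    primeError N (∏ p ∈ u, p) ≤
      2 * (1 + Real.log N) * N * 2 ^ u.card / (∏ p ∈ u, p : ℕ) := by
  have hq := prod_pos_of_forall_prime hu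
  have hq0 : (0 : ℝ) < (∏ p ∈ u, p : ℕ) := by exact_mod_cast hq
  have h2 : (1 : ℝ) ≤ 2 ^ u.card := one_le_pow₀ one_le_two
  have hl := Real.log_natCast_nonneg N
  refine Real.iSup_le (fun a => ?_) (by positivity)
  have h3 := thetaAP_le hq huN (a : ZMod (∏ p ∈ u, p))
  have h4 := mul_le_mul_of_nonneg_left (one_div_totient_le hu) (Nat.cast_nonneg (α := ℝ) N)
  rw [mul_one_div] at h4
  have h5 : 0 ≤ (N : ℝ) / (Nat.totient (∏ p ∈ u, p) : ℝ) := by positivity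
  have h6 : 2 * Real.log N * (N / (∏ p ∈ u, p : ℕ)) ≤
      2 * Real.log N * (N / (∏ p ∈ u, p : ℕ)) * 2 ^ u.card :=
    le_mul_of_one_le_right (by positivity) h2
  have h7 : 0 ≤ (N : ℝ) * (2 ^ u.card / (∏ p ∈ u, p : ℕ)) := by positivity
  calc _ ≤ 2 * Real.log N * (N / (∏ p ∈ u, p : ℕ)) * 2 ^ u.card +
        N * (2 ^ u.card / (∏ p ∈ u, p : ℕ)) := by
        rw [abs_le]
        have := thetaAP_nonneg N _ (a : ZMod (∏ p ∈ u, p))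
        constructor <;> nlinarith
    _ ≤ 2 * Real.log N * (N / (∏ p ∈ u, p : ℕ)) * 2 ^ u.card +
        2 * (N * (2 ^ u.card / (∏ p ∈ u, p : ℕ))) := by linarith
    _ = _ := by ring

lemma lambdaError_le {N : ℕ} {u : Finset ℕ} (hu : ∀ p ∈ u, p.Prime) (huN : ∏ p ∈ u, p ≤ N) :
    lambdaError N (∏ p ∈ u, p) ≤
      2 * (1 + Real.log N) * N * 2 ^ u.card / (∏ p ∈ u, p : ℕ) := by
  have hq := prod_pos_of_forall_prime hu
  have hq0 : (0 : ℝ) < (∏ p ∈ u, p : ℕ) := by exact_mod_cast hq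
  have h2 : (1 : ℝ) ≤ 2 ^ u.card := one_le_pow₀ one_le_two
  have hl := Real.log_natCast_nonneg N
  refine Real.iSup_le (fun y => Real.iSup_le (fun a => ?_) (by positivity)) (by positivity)
  refine (abs_lambdaAP_le hq huN (by omega) a).trans ?_
  have h3 : 1 ≤ (1 + Real.log N) * 2 ^ u.card := by nlinarith
  calc 2 * ((N : ℝ) / (∏ p ∈ u, p : ℕ)) ≤
        2 * (N / (∏ p ∈ u, p : ℕ)) * ((1 + Real.log N) * 2 ^ u.card) :=
        le_mul_of_one_le_right (by positivity) h3
    _ = _ := by ring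

/-- The sifting level `⌊N^θ⌋`. -/
noncomputable def siftLevel (θ : ℝ) (N : ℕ) : ℕ := ⌊(N : ℝ) ^ θ⌋₊

lemma siftLevel_sq_le (θ : ℝ) (N : ℕ) : ((siftLevel θ N ^ 2 : ℕ) : ℝ) ≤ (N : ℝ) ^ (2 * θ) := by
  push_cast
  have h1 : (siftLevel θ N : ℝ) ≤ (N : ℝ) ^ θ := Nat.floor_le (by positivity)
  calc (siftLevel θ N : ℝ) ^ 2 ≤ ((N : ℝ) ^ θ) ^ 2 := pow_le_pow_left₀ (Nat.cast_nonneg _) h1 2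
    _ = _ := by
      rw [← Real.rpow_natCast, ← Real.rpow_mul (Nat.cast_nonneg _)]
      congr 1
      push_cast
      ring

lemma log_siftLevel_sq_le {θ : ℝ} (hθ : 2 * θ ≤ 1) {N : ℕ} (hN : 1 ≤ N) :
    Real.log ((siftLevel θ N ^ 2 : ℕ) : ℝ) ≤ Real.log N := by
  rcases Nat.eq_zero_or_pos (siftLevel θ N ^ 2) with h0 | h0
  · rw [h0, Nat.cast_zero, Real.log_zero]
    exact Real.log_natCast_nonneg N
  · refine Real.log_le_log (by exact_mod_cast h0) ((siftLevel_sq_le θ N).trans ?_)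
    calc (N : ℝ) ^ (2 * θ) ≤ (N : ℝ) ^ (1 : ℝ) :=
          Real.rpow_le_rpow_of_exponent_le (by exact_mod_cast hN) hθ
      _ = N := Real.rpow_one _

lemma tendsto_log_natCast : Tendsto (fun N : ℕ => Real.log N) atTop atTop :=
  Real.tendsto_log_atTop.comp tendsto_natCast_atTop_atTop

/-- For the constant weight, each modulus costs only the number of its classes, so the error is
`N^{2θ}` times powers of `log N`; this is where `2θ < 1` enters. -/
lemma tendsto_sum_pow_card_div {θ : ℝ} (hθ : 2 * θ < 1) (B D : ℕ) :
    Tendsto (fun N : ℕ => (1 + Real.log N) ^ B *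
      (∑ u ∈ primeSets (siftLevel θ N ^ 2), (D : ℝ) ^ u.card) / N) atTop (nhds 0) := by
  have hlim : Tendsto (fun N : ℕ => 2 ^ (B + D) *
      (Real.log N ^ ((B + D : ℕ) : ℝ) / (N : ℝ) ^ (1 - 2 * θ))) atTop (nhds 0) := by
    have h1 := (isLittleO_log_rpow_rpow_atTop ((B + D : ℕ) : ℝ)
      (show 0 < 1 - 2 * θ by linarith)).tendsto_div_nhds_zero
    have h2 := (h1.comp tendsto_natCast_atTop_atTop).const_mul ((2 : ℝ) ^ (B + D))
    rw [mul_zero] at h2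
    exact h2
  refine squeeze_zero' ?_ ?_ hlim
  · filter_upwards with N
    have := Real.log_natCast_nonneg N
    positivity
  · filter_upwards [eventually_ge_atTop 1, tendsto_log_natCast.eventually_ge_atTop 1] with N hN hL
    have hN0 : (0 : ℝ) < N := by exact_mod_cast hN
    set M := siftLevel θ N ^ 2 with hM
    have h1 : ∑ u ∈ primeSets M, (D : ℝ) ^ u.card ≤ M * (1 + Real.log N) ^ D := by
      have h2 : ∑ u ∈ primeSets M, (D : ℝ) ^ u.card ≤
          M * ∑ u ∈ primeSets M, (D : ℝ) ^ u.card / (∏ p ∈ u, p : ℕ) := by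
        rw [Finset.mul_sum]
        refine Finset.sum_le_sum fun u hu => ?_
        have h3 := mem_primeSets.1 hu
        have h4 : (0 : ℝ) < (∏ p ∈ u, p : ℕ) := by
          exact_mod_cast prod_pos_of_forall_prime h3.1
        have h5 : ((∏ p ∈ u, p : ℕ) : ℝ) ≤ M := by exact_mod_cast h3.2
        rw [mul_div_assoc', le_div_iff₀ h4, mul_comm]
        exact mul_le_mul_of_nonneg_right h5 (by positivity)
      refine h2.trans (mul_le_mul_of_nonneg_left ?_ (Nat.cast_nonneg M))
      refine (sum_pow_card_div_prod_le M D).trans (pow_le_pow_left₀ ?_ ?_ _)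
      · linarith [Real.log_natCast_nonneg M]
      · linarith [log_siftLevel_sq_le hθ.le hN]
    have h2 : (1 + Real.log N) ^ B * (∑ u ∈ primeSets M, (D : ℝ) ^ u.card) / N ≤
        (1 + Real.log N) ^ B * ((N : ℝ) ^ (2 * θ) * (1 + Real.log N) ^ D) / N := by
      refine div_le_div_of_nonneg_right (mul_le_mul_of_nonneg_left (h1.trans ?_) (by positivity))
        hN0.le
      exact mul_le_mul_of_nonneg_right (siftLevel_sq_le θ N) (by positivity)
    refine h2.trans ?_
    have h3 : (N : ℝ) ^ (2 * θ) / N = 1 / (N : ℝ) ^ (1 - 2 * θ) := by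
      rw [Real.rpow_sub hN0, Real.rpow_one]
      field_simp
    have h4 : (1 + Real.log N) ^ (B + D) ≤ (2 * Real.log N) ^ (B + D) :=
      pow_le_pow_left₀ (by linarith) (by linarith) _
    rw [Real.rpow_natCast]
    calc _ = (1 + Real.log N) ^ (B + D) * ((N : ℝ) ^ (2 * θ) / N) := by rw [pow_add]; ring
      _ ≤ (2 * Real.log N) ^ (B + D) * ((N : ℝ) ^ (2 * θ) / N) :=
        mul_le_mul_of_nonneg_right h4 (by positivity)
      _ = _ := by rw [h3, mul_pow]; ring

/-- The total error is `o(N / (log N)^B)` for every `B` if `E` has level of distribution beyond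
the square of the sifting level. -/
lemma tendsto_sum_error_div {ϑ θ : ℝ} (hθ1 : 2 * θ < 1) (hθ : 2 * θ < ϑ) (hθ0 : 0 < θ)
    {E : ℕ → ℕ → ℝ}
    (hE0 : ∀ N q, 0 ≤ E N q)
    (hlevel : ∀ ε : ℝ, 0 < ε → ∀ A : ℝ, 0 < A →
      (fun N : ℕ => ∑ q ∈ Finset.Icc 1 ⌊(N : ℝ) ^ (ϑ - ε)⌋₊, E N q)
        =O[atTop] (fun N : ℕ => (N : ℝ) / Real.log N ^ A))
    (htriv : ∀ N : ℕ, ∀ u : Finset ℕ, (∀ p ∈ u, p.Prime) → ∏ p ∈ u, p ≤ N →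
      E N (∏ p ∈ u, p) ≤ 2 * (1 + Real.log N) * N * 2 ^ u.card / (∏ p ∈ u, p : ℕ))
    {m : ℕ → ℕ} (hm : ∀ᶠ N in atTop, N ≤ m N ∧ m N ≤ 3 * N) (B D : ℕ) :
    Tendsto (fun N : ℕ => (1 + Real.log N) ^ B *
      (∑ u ∈ primeSets (siftLevel θ N ^ 2), (D : ℝ) ^ u.card * E (m N) (∏ p ∈ u, p)) / N)
      atTop (nhds 0) := by
  have hmtop : Tendsto m atTop atTop :=
    tendsto_atTop_mono' atTop (hm.mono fun N h => h.1) tendsto_id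
  -- Cauchy's inequality turns `D^{|u|}` into `(D²)^{|u|}`, and the trivial bound adds `2^{|u|}`;
  -- hence `2D²`. The squared error carries `2B + K + 1` logarithms, so `A` is chosen to leave one
  -- to spare.
  set K := 2 * D ^ 2 with hK
  set A := 2 * B + K + 2 with hA
  -- With `ε = ϑ - 2θ` the moduli reach `x^{2θ}`, which covers `R²` because `x = m N ≥ N`.
  obtain ⟨C, hC0, hC⟩ := (hlevel (ϑ - 2 * θ) (by linarith) (A : ℝ)
    (by exact_mod_cast (by omega : 0 < A))).exists_nonneg
  have hlm := tendsto_log_natCast.comp hmtop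
  have hlim : Tendsto (fun N : ℕ => Real.sqrt (18 * C * 2 ^ A * (Real.log (m N))⁻¹))
      atTop (nhds 0) := by
    have h1 := (tendsto_inv_atTop_zero.comp hlm).const_mul (18 * C * 2 ^ A)
    rw [mul_zero] at h1
    have h2 := (Real.continuous_sqrt.tendsto 0).comp h1
    rw [Real.sqrt_zero] at h2
    exact h2
  refine squeeze_zero' ?_ ?_ hlim
  · filter_upwards with N
    have := Real.log_natCast_nonneg N
    have : 0 ≤ ∑ u ∈ primeSets (siftLevel θ N ^ 2), (D : ℝ) ^ u.card * E (m N) (∏ p ∈ u, p) :=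
      Finset.sum_nonneg fun u _ => mul_nonneg (by positivity) (hE0 _ _)
    positivity
  · filter_upwards [hm, hmtop.eventually hC.bound, hlm.eventually_ge_atTop 1,
      eventually_ge_atTop 1] with N hN hb hL hN1
    set x := m N with hx
    have hL' : 1 ≤ Real.log x := hL
    set S := ∑ u ∈ primeSets (siftLevel θ N ^ 2), (D : ℝ) ^ u.card * E x (∏ p ∈ u, p) with hS
    have hN0 : (0 : ℝ) < N := by exact_mod_cast hN1
    have hxN : (N : ℝ) ≤ x := by exact_mod_cast hN.1
    have hx3 : (x : ℝ) ≤ 3 * N := by exact_mod_cast hN.2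
    have hx0 : (0 : ℝ) < x := by linarith
    have hx1 : (1 : ℝ) ≤ x := by exact_mod_cast hN1.trans hN.1
    have hMx2 : ((siftLevel θ N ^ 2 : ℕ) : ℝ) ≤ (x : ℝ) ^ (2 * θ) :=
      (siftLevel_sq_le θ N).trans (Real.rpow_le_rpow hN0.le hxN (by linarith))
    have hMx : siftLevel θ N ^ 2 ≤ x := by
      have : ((siftLevel θ N ^ 2 : ℕ) : ℝ) ≤ x := by
        refine hMx2.trans ((Real.rpow_le_rpow_of_exponent_le hx1 hθ1.le).trans_eq ?_)
        exact Real.rpow_one _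
      exact_mod_cast this
    have hsum : ∑ q ∈ Finset.Icc 1 (siftLevel θ N ^ 2), E x q ≤ C * (x / Real.log x ^ A) := by
      rw [sub_sub_cancel, Real.norm_of_nonneg (Finset.sum_nonneg fun q _ => hE0 _ _),
        Real.rpow_natCast, Real.norm_of_nonneg (by positivity)] at hb
      refine le_trans (Finset.sum_le_sum_of_subset_of_nonneg ?_ fun q _ _ => hE0 _ _) hb
      exact Finset.Icc_subset_Icc_right (Nat.le_floor hMx2)
    have hlogN : Real.log N ≤ Real.log x := Real.log_le_log hN0 hxN
    have hlogM : Real.log ((siftLevel θ N ^ 2 : ℕ) : ℝ) ≤ Real.log x :=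
      (log_siftLevel_sq_le hθ1.le hN1).trans hlogN
    have hlogM0 := Real.log_natCast_nonneg (siftLevel θ N ^ 2)
    have hlogN0 := Real.log_natCast_nonneg N
    have hSsq : S ^ 2 ≤ 2 * (1 + Real.log x) * x * (1 + Real.log x) ^ K *
        (C * (x / Real.log x ^ A)) := by
      refine (sq_sum_pow_card_mul_le (siftLevel θ N ^ 2) D (hE0 x)
        (T := 2 * (1 + Real.log x) * x) (by positivity) fun u hu => ?_).trans ?_
      · have hu' := mem_primeSets.1 hu
        exact htriv x u hu'.1 (hu'.2.trans hMx)
      · refine mul_le_mul (mul_le_mul_of_nonneg_left ?_ (by positivity)) hsum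
          (Finset.sum_nonneg fun q _ => hE0 _ _) (by positivity)
        exact pow_le_pow_left₀ (by linarith) (by linarith) _
    refine Real.le_sqrt_of_sq_le ?_
    have hB : ((1 + Real.log N) ^ B) ^ 2 ≤ ((1 + Real.log x) ^ B) ^ 2 := by
      have := pow_le_pow_left₀ (by linarith) (show 1 + Real.log N ≤ 1 + Real.log x by linarith) B
      exact pow_le_pow_left₀ (by positivity) this 2
    have hpow : (1 + Real.log x) ^ (2 * B + K + 1) ≤ 2 ^ A * Real.log x ^ (2 * B + K + 1) := by
      calc (1 + Real.log x) ^ (2 * B + K + 1) ≤ (2 * Real.log x) ^ (2 * B + K + 1) :=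
            pow_le_pow_left₀ (by linarith) (by linarith) _
        _ = 2 ^ (2 * B + K + 1) * Real.log x ^ (2 * B + K + 1) := mul_pow _ _ _
        _ ≤ 2 ^ A * Real.log x ^ (2 * B + K + 1) :=
            mul_le_mul_of_nonneg_right (pow_le_pow_right₀ one_le_two (by omega)) (by positivity)
    have hx2 : (x : ℝ) ^ 2 ≤ 9 * (N : ℝ) ^ 2 := by nlinarith
    calc ((1 + Real.log N) ^ B * S / N) ^ 2 = ((1 + Real.log N) ^ B) ^ 2 * S ^ 2 / N ^ 2 := by ring
      _ ≤ ((1 + Real.log x) ^ B) ^ 2 * (2 * (1 + Real.log x) * x * (1 + Real.log x) ^ K *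
        (C * (x / Real.log x ^ A))) / N ^ 2 :=
          div_le_div_of_nonneg_right (mul_le_mul hB hSsq (sq_nonneg _) (sq_nonneg _)) (by positivity)
      _ = 2 * C * (x ^ 2 / N ^ 2) * ((1 + Real.log x) ^ (2 * B + K + 1) / Real.log x ^ A) := by
          rw [pow_succ _ (2 * B + K), pow_add _ (2 * B), pow_mul' _ 2 B]
          ring
      _ ≤ 2 * C * 9 * (2 ^ A * Real.log x ^ (2 * B + K + 1) / Real.log x ^ A) := by
          refine mul_le_mul (mul_le_mul_of_nonneg_left ?_ (by positivity))
            (div_le_div_of_nonneg_right hpow (by positivity)) (by positivity) (by positivity)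
          rw [div_le_iff₀ (by positivity)]
          exact hx2
      _ = 18 * C * 2 ^ A * (Real.log x)⁻¹ := by
          have h1 : Real.log x ^ A = Real.log x ^ (2 * B + K + 1) * Real.log x := by
            rw [hA, ← pow_succ]
          rw [h1]
          field_simp
          ring

end ErrorBounds

/-! ### The sieve inequality -/

section Conclusion

lemma admissibleCount_classCount {H : Finset ℕ} (hne : H.Nonempty)
    (hH : ∀ p : ℕ, p.Prime → ∃ a : ZMod p, ∀ h ∈ H, (h : ZMod p) ≠ a) :
    AdmissibleCount (classCount H) H.card (H.sup id) where
  pos p _ := Finset.card_pos.2 (hne.image _)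
  lt p hp := by
    have : NeZero p := ⟨hp.ne_zero⟩
    obtain ⟨a, ha⟩ := hH p hp
    have h1 : H.image (fun h : ℕ => (h : ZMod p)) ⊂ Finset.univ := by
      rw [Finset.ssubset_univ_iff]
      intro h
      have h2 : a ∈ H.image (fun h : ℕ => (h : ZMod p)) := h ▸ Finset.mem_univ a
      obtain ⟨x, hx, hxa⟩ := Finset.mem_image.1 h2
      exact ha x hx hxa
    have h2 := Finset.card_lt_card h1
    rwa [Finset.card_univ, ZMod.card] at h2
  le p _ := classCount_le H p
  eq p _ hp := by
    refine Finset.card_image_of_injOn fun x hx y hy hxy => ?_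
    have h1 : ∀ z ∈ H, z < p := fun z hz => (Finset.le_sup (f := id) hz).trans_lt hp
    have hxy : (x : ZMod p) = (y : ZMod p) := hxy
    rw [ZMod.natCast_eq_natCast_iff'] at hxy
    rwa [Nat.mod_eq_of_lt (h1 x hx), Nat.mod_eq_of_lt (h1 y hy)] at hxy

lemma siftLevel_le {θ : ℝ} (hθ : θ ≤ 1) {N : ℕ} (hN : 1 ≤ N) : siftLevel θ N ≤ N := by
  have h1 : (siftLevel θ N : ℝ) ≤ (N : ℝ) ^ θ := Nat.floor_le (by positivity)
  have h2 : (N : ℝ) ^ θ ≤ N := by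
    calc (N : ℝ) ^ θ ≤ (N : ℝ) ^ (1 : ℝ) :=
          Real.rpow_le_rpow_of_exponent_le (by exact_mod_cast hN) hθ
      _ = N := Real.rpow_one _
  exact_mod_cast h1.trans h2

lemma one_le_siftLevel {θ : ℝ} (hθ : 0 ≤ θ) {N : ℕ} (hN : 1 ≤ N) : 1 ≤ siftLevel θ N :=
  Nat.le_floor (by
    rw [Nat.cast_one]
    exact Real.one_le_rpow (by exact_mod_cast hN) hθ)

lemma le_log_siftLevel {θ : ℝ} (hθ : 0 ≤ θ) {N : ℕ} (hN : 1 ≤ N) :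
    θ * Real.log N - 1 ≤ Real.log (siftLevel θ N) := by
  have hN0 : (0 : ℝ) < N := by exact_mod_cast hN
  have h1 : (1 : ℝ) ≤ siftLevel θ N := by exact_mod_cast one_le_siftLevel hθ hN
  have h2 : (N : ℝ) ^ θ ≤ 2 * siftLevel θ N := by
    have := Nat.lt_floor_add_one ((N : ℝ) ^ θ)
    rw [siftLevel] at h1 ⊢
    linarith
  have h3 := Real.log_le_log (by positivity) h2
  rw [Real.log_rpow hN0, Real.log_mul two_ne_zero (by linarith)] at h3
  linarith [Real.log_two_lt_d9]

lemma tendsto_siftLevel {θ : ℝ} (hθ : 0 < θ) : Tendsto (siftLevel θ) atTop atTop :=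
  tendsto_nat_floor_atTop.comp ((tendsto_rpow_atTop hθ).comp tendsto_natCast_atTop_atTop)

/-- The pointwise inequality behind the theorem. If some `n + h` is prime it is the only one and
`λ(n + r) = 1`, so the right side is `L`; otherwise the left side is `0` and `λ ≥ -1` suffices. -/
lemma sum_prime_log_le {H : Finset ℕ} {n r : ℕ} {L : ℝ} (hL : ∀ h ∈ H, Real.log (n + h : ℕ) ≤ L)
    (hL0 : 0 ≤ L) (hnr : n + r ≠ 0)
    (h1 : ¬ ∃ h₁ ∈ H, ∃ h₂ ∈ H, h₁ ≠ h₂ ∧ (n + h₁).Prime ∧ (n + h₂).Prime)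
    (h2 : ¬ ((∃ h ∈ H, (n + h).Prime) ∧ ArithmeticFunction.liouville (n + r) = -1)) :
    ∑ h ∈ H, (if (n + h).Prime then Real.log (n + h : ℕ) else 0) ≤
      L / 2 * (1 + (ArithmeticFunction.liouville (n + r) : ℝ)) := by
  have hval : ArithmeticFunction.liouville (n + r) = 1 ∨
      ArithmeticFunction.liouville (n + r) = -1 := by
    rw [ArithmeticFunction.liouville_apply hnr]
    exact neg_one_pow_eq_or ℤ _
  by_cases hp : ∃ h ∈ H, (n + h).Prime
  · obtain ⟨h, hh, hhp⟩ := hp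
    have hlam : ArithmeticFunction.liouville (n + r) = 1 :=
      hval.resolve_right fun h3 => h2 ⟨⟨h, hh, hhp⟩, h3⟩
    rw [Finset.sum_eq_single_of_mem h hh, if_pos hhp, hlam]
    · have := hL h hh
      push_cast at this ⊢
      linarith
    · intro g hg hgh
      exact if_neg fun hgp => h1 ⟨g, hg, h, hh, hgh, hgp, hhp⟩
  · push Not at hp
    rw [Finset.sum_eq_zero fun h hh => if_neg (hp h hh)]
    rcases hval with h | h <;> rw [h] <;> push_cast <;> linarith

/-- The numerical comparison of the two sides of the sieve inequality; `V₁` and `V₂` are the main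
terms. -/
lemma sieve_inequality_absurd {k μ θ N l lR V₁ V₂ : ℝ} (hk0 : 0 ≤ k) (hμ0 : 0 ≤ μ) (hV1 : 1 ≤ V₁)
    (hN : 0 < N) (hl : 0 ≤ l) (hlR : θ * l - 1 ≤ lR) (hm : μ * (lR * V₁) ≤ V₂)
    (hf : k * μ + 3 + k < (k * μ * θ - 1 / 2) * l)
    (h : k * (N * V₂ - N / (1 + l)) ≤ (l + 2) / 2 * (N * V₁ + 2 * (N / (1 + l)))) : False := by
  have hl0 : 0 < 1 + l := by linarith
  have hdiv : k * (V₂ - 1 / (1 + l)) ≤ (l + 2) / 2 * (V₁ + 2 * (1 / (1 + l))) := by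
    have h4 : N * (k * (V₂ - 1 / (1 + l))) ≤ N * ((l + 2) / 2 * (V₁ + 2 * (1 / (1 + l)))) := by
      calc _ = k * (N * V₂ - N / (1 + l)) := by ring
        _ ≤ _ := h
        _ = _ := by ring
    exact le_of_mul_le_mul_left h4 hN
  have hinv1 : 1 / (1 + l) ≤ 1 := by
    rw [div_le_one hl0]; linarith
  have hinv2 : (l + 2) * (1 / (1 + l)) ≤ 2 := by
    rw [mul_one_div, div_le_iff₀ hl0]; linarith
  have h5 : k * V₂ ≤ (l + 2) / 2 * V₁ + 2 + k := by
    linarith [mul_le_mul_of_nonneg_left hinv1 hk0]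
  have h6 : k * (μ * (lR * V₁)) ≤ (l + 2) / 2 * V₁ + 2 + k :=
    (mul_le_mul_of_nonneg_left hm hk0).trans h5
  have h7 : (k * μ) * (θ * l - 1) * V₁ ≤ (k * μ) * lR * V₁ :=
    mul_le_mul_of_nonneg_right (mul_le_mul_of_nonneg_left hlR (mul_nonneg hk0 hμ0)) (by linarith)
  have h8 : 2 + k ≤ (2 + k) * V₁ := le_mul_of_one_le_right (by linarith) hV1
  -- The additive constant in `hf` collects all bounded losses, including the `-1` in `log R ≥ θ log
  -- N - 1`, the `2` in `L`, and the error terms.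
  have h9 : 0 < (k * μ) * (θ * l - 1) - (l + 2) / 2 - 2 - k := by linarith
  have h10 := mul_pos h9 (by linarith : 0 < V₁)
  linarith

/-- The sieve argument for sets of natural numbers, with parameters `a`, `μ` and `θ`. -/
theorem exists_two_primes_or_prime_and_liouville {ϑ : ℝ} (hprimes : PrimesHaveLevel ϑ)
    (hlambda : LambdaHasLevel ϑ) {H : Finset ℕ} (hne : H.Nonempty)
    (hH : ∀ p : ℕ, p.Prime → ∃ a : ZMod p, ∀ h ∈ H, (h : ZMod p) ≠ a) (r : ℕ) {a μ θ : ℝ}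
    (ha : 0 ≤ a) (hμ0 : 0 ≤ μ) (hθ0 : 0 < θ) (hθ1 : 2 * θ < 1) (hθ : 2 * θ < ϑ)
    (hμ : μ * (1 + 2 * a / (H.card + 1) + 2 * a ^ 2 / ((H.card + 1) * (H.card + 2))) <
      2 / (H.card + 1) + 6 * a / ((H.card + 1) * (H.card + 2)) +
        6 * a ^ 2 / ((H.card + 1) * (H.card + 2) * (H.card + 3)))
    (hμθ : 1 / 2 < H.card * μ * θ) (N₀ : ℕ) :
    ∃ n : ℕ, N₀ ≤ n ∧
      ((∃ h₁ ∈ H, ∃ h₂ ∈ H, h₁ ≠ h₂ ∧ (n + h₁).Prime ∧ (n + h₂).Prime) ∨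
        ((∃ h ∈ H, (n + h).Prime) ∧ ArithmeticFunction.liouville (n + r) = -1)) := by
  by_contra! hcon
  set k := H.card with hk
  set ν := classCount H with hν
  have AC : AdmissibleCount ν k (H.sup id) := admissibleCount_classCount hne hH
  obtain ⟨C, hC⟩ := AC.exists_powerSum_zero_le
  -- The weights satisfy `|λ_d| ≤ (1 + a)(1 + log N)^{2C}`, so two of them cost `4C` logarithms. One
  -- more makes each error at most `N/(1 + log N)`, small enough to survive multiplication by `L`.
  -- In `4k`, the `4` counts pairs `(d, e)` and the `k` counts classes per prime.
  have e1 := (tendsto_sum_pow_card_div hθ1 (4 * C + 1) (4 * k)).const_mul ((1 + a) ^ 2)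
  have e2 : ∀ h ∈ H, Tendsto (fun N : ℕ => (1 + a) ^ 2 * ((1 + Real.log N) ^ (4 * C + 1) *
      (∑ u ∈ primeSets (siftLevel θ N ^ 2), ((4 * k : ℕ) : ℝ) ^ u.card *
        primeError (2 * N + h) (∏ p ∈ u, p)) / N) + (1 + a) ^ 2 *
      ((1 + Real.log N) ^ (4 * C + 1) *
      (∑ u ∈ primeSets (siftLevel θ N ^ 2), ((4 * k : ℕ) : ℝ) ^ u.card *
        primeError (N + h) (∏ p ∈ u, p)) / N)) atTop (nhds 0) := by
    intro h _
    have h1 := (tendsto_sum_error_div hθ1 hθ hθ0 primeError_nonneg hprimes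
      (fun N u hu huN => primeError_le hu huN) (m := fun N => 2 * N + h)
      ((eventually_ge_atTop h).mono fun N hN => by omega) (4 * C + 1) (4 * k)).const_mul
        ((1 + a) ^ 2)
    have h2 := (tendsto_sum_error_div hθ1 hθ hθ0 primeError_nonneg hprimes
      (fun N u hu huN => primeError_le hu huN) (m := fun N => N + h)
      ((eventually_ge_atTop h).mono fun N hN => by omega) (4 * C + 1) (4 * k)).const_mul
        ((1 + a) ^ 2)
    have h3 := h1.add h2
    simp only [mul_zero, add_zero] at h3
    exact h3
  have e3 := (tendsto_sum_error_div hθ1 hθ hθ0 lambdaError_nonneg hlambda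
      (fun N u hu huN => lambdaError_le hu huN) (m := fun N => 2 * N + r)
      ((eventually_ge_atTop r).mono fun N hN => by omega) (4 * C + 1) (4 * k)).const_mul
        ((1 + a) ^ 2 * 2)
  rw [mul_zero] at e1 e3
  have hmain := (tendsto_siftLevel hθ0).eventually (AC.eventually_mul_mainForm_le ha hμ)
  have hfin : ∀ᶠ N : ℕ in atTop, k * μ + 3 + k < (k * μ * θ - 1 / 2) * Real.log N :=
    (tendsto_log_natCast.const_mul_atTop (by linarith)).eventually_gt_atTop _
  obtain ⟨N, hN0, hN1, hNH, hm, hf, h1, h3, h2⟩ := ((eventually_ge_atTop N₀).and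
    ((eventually_ge_atTop 1).and ((eventually_ge_atTop (H.sup id)).and (hmain.and (hfin.and
      ((e1.eventually_le_const zero_lt_one).and ((e3.eventually_le_const zero_lt_one).and
        ((Finset.eventually_all H).2 fun h hh =>
          (e2 h hh).eventually_le_const zero_lt_one)))))))).exists
  set R := siftLevel θ N with hR
  have hNpos : (0 : ℝ) < N := by exact_mod_cast hN1
  have hlogN := Real.log_natCast_nonneg N
  have hR1 : 1 ≤ R := one_le_siftLevel hθ0.le hN1
  have hRN : R ≤ N := siftLevel_le (by linarith) hN1
  have hlogR : Real.log R ≤ Real.log N :=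
    Real.log_le_log (by exact_mod_cast hR1) (by exact_mod_cast hRN)
  have hlogR0 := Real.log_natCast_nonneg R
  set lam := sieveWeight ν a R with hlam
  set Λ := (1 + a) * (1 + Real.log N) ^ (2 * C) with hΛ
  have hlamle : ∀ d ∈ primeSets R, |lam d| ≤ Λ := by
    intro d hd
    refine (AC.abs_sieveWeight_le ha hd).trans (mul_le_mul_of_nonneg_left ?_ (by linarith))
    rw [pow_mul' _ 2 C]
    refine pow_le_pow_left₀ ?_ ((hC R).trans (pow_le_pow_left₀ (by linarith) (by linarith) _)) 2
    have := AC.sieveDensity.choose_spec.one_le_powerSum_zero hR1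
    linarith
  have hΛsq : Λ ^ 2 * (1 + Real.log N) = (1 + a) ^ 2 * (1 + Real.log N) ^ (4 * C + 1) := by
    rw [hΛ, mul_pow, ← pow_mul, pow_succ]
    ring
  have hpr : ∀ d ∈ primeSets R, ∀ e ∈ primeSets R, ∀ p ∈ d ∪ e, p.Prime ∧ p ≤ N := by
    intro d hd e he p hp
    have hle : ∀ s ∈ primeSets R, p ∈ s → p.Prime ∧ p ≤ N := fun s hs hps =>
      ⟨prime_of_mem_primeSets hs hps, (Nat.le_of_mem_primesLE
        (Finset.mem_powerset.1 (Finset.mem_filter.1 hs).1 hps)).trans hRN⟩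
    exact (Finset.mem_union.1 hp).elim (hle d hd) (hle e he)
  set I := Finset.Ioc N (2 * N) with hI
  set w := sieveSquare H R lam with hw
  have hw0 : ∀ n, 0 ≤ w n := fun n => sq_nonneg _
  have c1 := abs_sum_mul_sieveSquare_sub_le H R (X := N) I (fun _ => (1 : ℝ))
    (fun u => ∏ p ∈ u, localDensity ν p) (fun u => (k : ℝ) ^ u.card) hlamle
    (fun u => by positivity) (fun d hd e he =>
      abs_sum_occupied_one_sub_le H (d ∪ e) (fun p hp => (hpr d hd e he p hp).1) N)
  have c2 : ∀ h ∈ H, _ := fun h hh => abs_sum_mul_sieveSquare_sub_le H R (X := N) I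
    (fun n => if (n + h).Prime then Real.log (n + h : ℕ) else 0)
    (fun u => ∏ p ∈ u, reducedDensity ν p) (fun u => (k : ℝ) ^ u.card *
      (primeError (2 * N + h) (∏ p ∈ u, p) + primeError (N + h) (∏ p ∈ u, p))) hlamle
    (fun u => mul_nonneg (by positivity) (add_nonneg (primeError_nonneg _ _)
      (primeError_nonneg _ _))) (fun d hd e he =>
      abs_sum_occupied_prime_sub_le H (d ∪ e) (fun p hp => (hpr d hd e he p hp).1) N
        (fun p hp => (hpr d hd e he p hp).2) hh)
  have c3 := abs_sum_mul_sieveSquare_sub_le H R (X := 0) I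
    (fun n => (ArithmeticFunction.liouville (n + r) : ℝ))
    (fun _ => 0) (fun u => (k : ℝ) ^ u.card * (2 * lambdaError (2 * N + r) (∏ p ∈ u, p))) hlamle
    (fun u => mul_nonneg (by positivity) (mul_nonneg zero_le_two (lambdaError_nonneg _ _)))
    (fun d hd e he => by
      rw [zero_mul, sub_zero]
      exact abs_sum_occupied_liouville_le H (d ∪ e) (fun p hp => (hpr d hd e he p hp).1) N r)
  rw [zero_mul, sub_zero] at c3
  have hV1 : ∑ d ∈ primeSets R, ∑ e ∈ primeSets R,
      lam d * lam e * ∏ p ∈ d ∪ e, localDensity ν p = mainForm ν a R := rfl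
  have hV2 : ∑ d ∈ primeSets R, ∑ e ∈ primeSets R,
      lam d * lam e * ∏ p ∈ d ∪ e, reducedDensity ν p = primeForm ν a R := rfl
  rw [hV1] at c1
  have hl1 : 1 ≤ 1 + Real.log N := by linarith
  have hl0 : 0 < 1 + Real.log N := by linarith
  -- the error terms are at most `N / (1 + log N)`
  have hconv : ∀ Z : ℝ, Λ ^ 2 * (1 + Real.log N) * Z / N ≤ 1 → Λ ^ 2 * Z ≤ N / (1 + Real.log N) := by
    intro Z hZ
    rw [div_le_one hNpos] at hZ
    rw [le_div_iff₀ hl0]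
    linarith
  have d1 : |∑ n ∈ I, 1 * w n - N * mainForm ν a R| ≤ N / (1 + Real.log N) := by
    refine c1.trans (hconv _ ?_)
    rw [hΛsq]
    refine le_trans (le_of_eq ?_) h1
    have : ∑ u ∈ primeSets (R ^ 2), (4 : ℝ) ^ u.card * (k : ℝ) ^ u.card =
        ∑ u ∈ primeSets (R ^ 2), ((4 * k : ℕ) : ℝ) ^ u.card :=
      Finset.sum_congr rfl fun u _ => by push_cast; rw [mul_pow]
    rw [this]
    ring
  have d2 : ∀ h ∈ H, |∑ n ∈ I, (if (n + h).Prime then Real.log (n + h : ℕ) else 0) * w n -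
      N * primeForm ν a R| ≤ N / (1 + Real.log N) := by
    intro h hh
    have c := c2 h hh
    rw [hV2] at c
    refine c.trans (hconv _ ?_)
    rw [hΛsq]
    refine le_trans (le_of_eq ?_) (h2 h hh)
    have : ∑ u ∈ primeSets (R ^ 2), (4 : ℝ) ^ u.card * ((k : ℝ) ^ u.card *
        (primeError (2 * N + h) (∏ p ∈ u, p) + primeError (N + h) (∏ p ∈ u, p))) =
        ∑ u ∈ primeSets (R ^ 2), ((4 * k : ℕ) : ℝ) ^ u.card *
          primeError (2 * N + h) (∏ p ∈ u, p) +
        ∑ u ∈ primeSets (R ^ 2), ((4 * k : ℕ) : ℝ) ^ u.card *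
          primeError (N + h) (∏ p ∈ u, p) := by
      rw [← Finset.sum_add_distrib]
      exact Finset.sum_congr rfl fun u _ => by push_cast; rw [mul_pow]; ring
    rw [this]
    ring
  have d3 : |∑ n ∈ I, (ArithmeticFunction.liouville (n + r) : ℝ) * w n| ≤
      N / (1 + Real.log N) := by
    refine c3.trans (hconv _ ?_)
    rw [hΛsq]
    refine le_trans (le_of_eq ?_) h3
    have : ∑ u ∈ primeSets (R ^ 2), (4 : ℝ) ^ u.card * ((k : ℝ) ^ u.card *
        (2 * lambdaError (2 * N + r) (∏ p ∈ u, p))) =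
        2 * ∑ u ∈ primeSets (R ^ 2), ((4 * k : ℕ) : ℝ) ^ u.card *
          lambdaError (2 * N + r) (∏ p ∈ u, p) := by
      rw [Finset.mul_sum]
      exact Finset.sum_congr rfl fun u _ => by push_cast; rw [mul_pow]; ring
    rw [this]
    ring
  clear c1 c2 c3 e1 e2 e3 h1 h2 h3
  set L := Real.log N + 2 with hL
  have hlog3 : ∀ n ∈ I, ∀ h ∈ H, Real.log (n + h : ℕ) ≤ L := by
    intro n hn h hh
    have hn' := Finset.mem_Ioc.1 hn
    have hhN : h ≤ N := (Finset.le_sup (f := id) hh).trans hNH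
    -- Here `n + h ≤ 3N` and `3 ≤ e²`, whence the `2` in `L`.
    have h4 : ((n + h : ℕ) : ℝ) ≤ N * Real.exp 2 := by
      have h5 : ((n + h : ℕ) : ℝ) ≤ N * 3 := by exact_mod_cast (by omega : n + h ≤ N * 3)
      have h6 : (3 : ℝ) ≤ Real.exp 2 := by linarith [Real.add_one_le_exp (2 : ℝ)]
      exact h5.trans (mul_le_mul_of_nonneg_left h6 hNpos.le)
    have h7 := Real.log_le_log (by exact_mod_cast (by omega : 0 < n + h)) h4
    rwa [Real.log_mul hNpos.ne' (Real.exp_pos _).ne', Real.log_exp] at h7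
  have hpoint : ∀ n ∈ I,
      ∑ h ∈ H, (if (n + h).Prime then Real.log (n + h : ℕ) else 0) * w n ≤
      L / 2 * (1 * w n + (ArithmeticFunction.liouville (n + r) : ℝ) * w n) := by
    intro n hn
    have hn' := Finset.mem_Ioc.1 hn
    obtain ⟨hc1, hc2⟩ := hcon n (by omega)
    rw [← Finset.sum_mul]
    refine (mul_le_mul_of_nonneg_right (sum_prime_log_le (hlog3 n hn) (by linarith)
      (r := r) (by omega) ?_ ?_) (hw0 n)).trans_eq (by ring)
    · rintro ⟨h₁, hh₁, h₂, hh₂, hne, hp₁, hp₂⟩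
      exact hc1 h₁ hh₁ h₂ hh₂ hne hp₁ hp₂
    · rintro ⟨⟨h, hh, hp⟩, hl⟩
      exact hc2 ⟨h, hh, hp⟩ hl
  have htotal := Finset.sum_le_sum hpoint
  rw [Finset.sum_comm, ← Finset.mul_sum, Finset.sum_add_distrib] at htotal
  have hlow : k * (N * primeForm ν a R - N / (1 + Real.log N)) ≤
      ∑ h ∈ H, ∑ n ∈ I, (if (n + h).Prime then Real.log (n + h : ℕ) else 0) * w n := by
    rw [hk, ← nsmul_eq_mul, ← Finset.sum_const]
    refine Finset.sum_le_sum fun h hh => ?_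
    linarith [(abs_le.1 (d2 h hh)).1]
  have hV1one : 1 ≤ mainForm ν a R := AC.one_le_mainForm ha hR1
  have hup : L / 2 * (∑ n ∈ I, 1 * w n +
      ∑ n ∈ I, (ArithmeticFunction.liouville (n + r) : ℝ) * w n) ≤
      L / 2 * (N * mainForm ν a R + 2 * (N / (1 + Real.log N))) := by
    refine mul_le_mul_of_nonneg_left ?_ (by linarith)
    linarith [(abs_le.1 d1).2, (abs_le.1 d3).2]
  have hchain := (hlow.trans htotal).trans hup
  set V₁ := mainForm ν a R with hV₁
  set V₂ := primeForm ν a R with hV₂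
  exact sieve_inequality_absurd (Nat.cast_nonneg k) hμ0 hV1one hNpos hlogN
    (le_log_siftLevel hθ0.le hN1) hm hf hchain

end Conclusion

/-! ### Reduction to natural numbers and choice of the parameters -/

theorem theorem5 (ϑ : ℝ) (hprimes : PrimesHaveLevel ϑ) (hlambda : LambdaHasLevel ϑ) (k : ℕ)
    (hk : (0.729 ≤ ϑ ∧ k = 2) ∨ (0.616 ≤ ϑ ∧ k = 3) ∨ (0.554 ≤ ϑ ∧ k = 4) ∨ (0.515 ≤ ϑ ∧ k = 5))
    (H : Finset ℤ) (hcard : H.card = k) (hH : Admissible H)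
    (r : ℤ) (hr0 : r ≠ 0) (hrH : r ∉ H) :
    Set.Infinite {n : ℤ |
      (∃ h₁ ∈ H, ∃ h₂ ∈ H, h₁ ≠ h₂ ∧ IsPrimeInt (n + h₁) ∧ IsPrimeInt (n + h₂)) ∨
      ((∃ h ∈ H, IsPrimeInt (n + h)) ∧ liouvilleLambda (n + r) = -1)} := by
  -- Shifting `H` and `r` by the same large `c` makes them nonnegative without affecting
  -- admissibility; `n + c` is then the integer sought.
  obtain ⟨c, hc, hcr⟩ : ∃ c : ℕ, (∀ h ∈ H, 0 ≤ h + c) ∧ 0 ≤ r + c := by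
    refine ⟨∑ h ∈ H, h.natAbs + r.natAbs, fun h hh => ?_, ?_⟩
    · have : h.natAbs ≤ ∑ h ∈ H, h.natAbs :=
        Finset.single_le_sum (f := fun h : ℤ => h.natAbs) (fun _ _ => Nat.zero_le _) hh
      omega
    · omega
  set H' : Finset ℕ := H.image fun h : ℤ => (h + (c : ℤ)).toNat with hH'
  have hcast : ∀ h ∈ H, (((h + c).toNat : ℕ) : ℤ) = h + c := fun h hh =>
    Int.toNat_of_nonneg (hc h hh)
  have hcard' : H'.card = k := by
    rw [hH', Finset.card_image_of_injOn, hcard]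
    intro x hx y hy hxy
    have h1 := hcast x hx
    have h2 := hcast y hy
    have hxy : (x + (c : ℤ)).toNat = (y + (c : ℤ)).toNat := hxy
    omega
  have hadm : ∀ p : ℕ, p.Prime → ∃ a : ZMod p, ∀ h ∈ H', (h : ZMod p) ≠ a := by
    intro p hp
    obtain ⟨a, ha⟩ := hH p hp
    refine ⟨a + c, fun h' hh' => ?_⟩
    obtain ⟨h, hh, rfl⟩ := Finset.mem_image.1 hh'
    have h1 : (((h + c).toNat : ℕ) : ZMod p) = (h : ZMod p) + c := by
      have := congrArg (fun z : ℤ => (z : ZMod p)) (hcast h hh)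
      push_cast at this
      exact this
    rw [h1]
    exact fun h2 => ha h hh (add_right_cancel h2)
  have hkey : ∀ N₀ : ℕ, ∃ n : ℕ, N₀ ≤ n ∧
      ((∃ h₁ ∈ H', ∃ h₂ ∈ H', h₁ ≠ h₂ ∧ (n + h₁).Prime ∧ (n + h₂).Prime) ∨
        ((∃ h ∈ H', (n + h).Prime) ∧
          ArithmeticFunction.liouville (n + (r + c).toNat) = -1)) := by
    have hne : k ≠ 0 → H'.Nonempty := fun h0 => Finset.card_pos.1 (by omega)
    -- In each case `2θ` is `0.001` below the required level, `μ` is just under the ratio of main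
    -- terms given by the chosen `a`, and `kμθ` exceeds `1/2` only slightly (for `k = 2` it is
    -- `0.50232`).
    rcases hk with ⟨hϑ, rfl⟩ | ⟨hϑ, rfl⟩ | ⟨hϑ, rfl⟩ | ⟨hϑ, rfl⟩
    · refine exists_two_primes_or_prime_and_liouville hprimes hlambda (hne (by norm_num)) hadm _
        (a := 1) (μ := 0.69) (θ := 0.364) ?_ ?_ ?_ ?_ ?_ ?_ ?_ <;> (try rw [hcard']) <;>
        norm_num at hϑ ⊢
      linarith
    · refine exists_two_primes_or_prime_and_liouville hprimes hlambda (hne (by norm_num)) hadm _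
        (a := 3) (μ := 0.544) (θ := 0.3075) ?_ ?_ ?_ ?_ ?_ ?_ ?_ <;> (try rw [hcard']) <;>
        norm_num at hϑ ⊢
      linarith
    · refine exists_two_primes_or_prime_and_liouville hprimes hlambda (hne (by norm_num)) hadm _
        (a := 6) (μ := 0.4531) (θ := 0.2765) ?_ ?_ ?_ ?_ ?_ ?_ ?_ <;> (try rw [hcard']) <;>
        norm_num at hϑ ⊢
      linarith
    · refine exists_two_primes_or_prime_and_liouville hprimes hlambda (hne (by norm_num)) hadm _
        (a := 8) (μ := 0.39) (θ := 0.257) ?_ ?_ ?_ ?_ ?_ ?_ ?_ <;> (try rw [hcard']) <;>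
        norm_num at hϑ ⊢
      linarith
  refine Set.infinite_of_forall_exists_gt fun b => ?_
  obtain ⟨n, hn, hcases⟩ := hkey (b.toNat + 1)
  have hprime : ∀ h ∈ H, (n + (h + c).toNat).Prime → IsPrimeInt ((n : ℤ) + c + h) := by
    intro h hh hp
    refine ⟨_, hp, ?_⟩
    rw [Nat.cast_add, hcast h hh]
    ring
  refine ⟨(n : ℤ) + c, ?_, by omega⟩
  rcases hcases with ⟨h₁, hh₁, h₂, hh₂, hne, hp₁, hp₂⟩ | ⟨⟨h, hh, hp⟩, hl⟩
  · obtain ⟨g₁, hg₁, rfl⟩ := Finset.mem_image.1 hh₁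
    obtain ⟨g₂, hg₂, rfl⟩ := Finset.mem_image.1 hh₂
    exact Or.inl ⟨g₁, hg₁, g₂, hg₂, fun h => hne (by rw [h]), hprime g₁ hg₁ hp₁, hprime g₂ hg₂ hp₂⟩
  · obtain ⟨g, hg, rfl⟩ := Finset.mem_image.1 hh
    refine Or.inr ⟨⟨g, hg, hprime g hg hp⟩, ?_⟩
    have h1 : ((n : ℤ) + c + r).toNat = n + (r + c).toNat := by omega
    rw [liouvilleLambda, h1]
    exact hl
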